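/- **Higher-order soliton formula for multiple zeros.** Let $r\ge 0$, let $\zeta_1,\dots,\zeta_r\in\mathbb{C}_{13}$ (the union of the open first and third quadrants) with $\zeta_i\ne\pm\zeta_j$ for $i\neq j$, let $n_1,\dots,n_r\ge 0$ be integers, and let $v_{i0}(\zeta)\in\mathbb{C}^2$ be analytic at $\zeta_i$ with $v_{i0}(\zeta_i)\neq0$ (for instance constant). Let $\sigma_3=\mathrm{diag}(1,-1)$. For real $x,t$ put $$|v_i\rangle(\zeta)=e^{(-i\zeta^2x-2i\zeta^6t)\sigma_3}v_{i0}(\zeta),\qquad \langle v_i|(\zeta^*)=\big(|v_i\rangle(\zeta)\big)^\dagger ,$$ and treat $\zeta$ and $\zeta^*$ as independent variables. Let $\tilde M=(\tilde M^{[ij]})_{1\le i,j\le r}$ be the block matrix with blocks of size $n_i\times n_j$ and entries, for $1\le k\le n_i$, $1\le l\le n_j$, $$\tilde M^{[ij]}_{kl}=\frac{1}{(k-1)!\,(l-1)!}\,\frac{\partial^{k+l-2}}{\partial\zeta^{k-1}\,\partial\zeta^{*\,l-1}}\left[\frac{\langle v_j|\sigma_3|v_i\rangle}{\zeta+\zeta^*}-\frac{\langle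 v_j|v_i\rangle}{\zeta-\zeta^*}\right]_{\zeta=\zeta_i,\ \zeta^*=\zeta_j^*}.$$ Let $\tilde\chi$ be the column with entries $\frac1{(k-1)!}\partial_\zeta^{k-1}|v_i\rangle_1\big|_{\zeta=\zeta_i}$, and let $\tilde\psi$, $\tilde\tau$ be the rows with entries $\frac1{(l-1)!}\partial_{\zeta^*}^{l-1}\big(\langle v_j|_2/\zeta^{*2}\big)\big|_{\zeta^*=\zeta_j^*}$ and $\frac1{(l-1)!}\partial_{\zeta^*}^{l-1}\big(\langle v_j|_1/\zeta^{*}\big)\big|_{\zeta^*=\zeta_j^*}$. Put $$\tilde F=\begin{pmatrix}\tilde M&\tilde\chi\\ \tilde\psi&0\end{pmatrix},\qquad \tilde G=\begin{pmatrix}\tilde M&\tilde\chi\\ \tilde\tau&0\end{pmatrix},\qquad u=\frac{2\det\tilde F}{\det\tilde M+2\det\tilde G},\qquad q=u_x .$$ The *reflectionless Riemann–Hilbert problem* at $(x,t)$ asks for a matrix function $\mathbf P(\zeta)\in\mathbb{C}^{2\times2}$ that is analytic off the points $\pm\zeta_i^*$ and bounded at infinity, with $\mathbf P(0)=I$, $\mathbf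 P(\zeta)\mathbf P(\zeta^*)^\dagger=I$ (off the points $\pm\zeta_i,\pm\zeta_i^*$) and $\mathbf P(-\zeta)=\sigma_3\mathbf P(\zeta)\sigma_3$, with $\det\mathbf P(\zeta)=\rho(\zeta)\prod_i(\zeta^2-\zeta_i^2)^{n_i}$ on $\mathbb{C}_{13}$, where $\rho$ is analytic and has no zeros there, and with $\mathbf P(\zeta)|v_i\rangle(\zeta)=O\big((\zeta-\zeta_i)^{n_i}\big)$ as $\zeta\to\zeta_i$ for each $i$. The *dressing matrix* is $\Gamma=\Gamma_r^{[n_r-1]}\cdots\Gamma_r^{[0]}\cdots\Gamma_1^{[n_1-1]}\cdots\Gamma_1^{[0]}$ with $$\Gamma_i^{[j]}(\zeta)=I+\frac{A}{\zeta-\zeta_i^*}-\frac{\sigma_3A\sigma_3}{\zeta+\zeta_i^*},\qquad A=\frac{\zeta_i^{*2}-\zeta_i^2}{2}\,\mathrm{diag}(\alpha^*,\alpha)\,|w\rangle\langle w|,\qquad \alpha^{-1}=\langle w|\,\mathrm{diag}(\zeta_i,\zeta_i^*)\,|w\rangle ,$$ where $\langle w|=|w\rangle^\dagger$ and $$|w\rangle=|v_i^{[j]}\rangle=\lim_{\delta\to0}\delta^{-j}\big(\Gamma_i^{[j-1]}\cdots\Gamma_i^{[0]}\,\Gamma_{i-1}^{[n_{i-1}-1]}\cdots\Gamma_1^{[0]}\big)(\zeta_i+\delta)\,|v_i\rangle(\zeta_i+\delta).$$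 Then: 1. For all real $x,t$, $\det\tilde M\ne0$ and $\det\tilde M+2\det\tilde G\neq0$, and $u$ is a $C^\infty$ function of $(x,t)$. 2. All the limits $|v_i^{[j]}\rangle$ ($0\le j<n_i$) exist and are nonzero, and $\Gamma(0)^{-1}\Gamma(\zeta)$ solves the reflectionless Riemann–Hilbert problem at every $(x,t)$. 3. Every solution of that problem at $(x,t)$ satisfies $\mathbf P'(0)=\begin{pmatrix}0&u\\-u^*&0\end{pmatrix}$. Hence the potential $Q=\mathbf P^{(1)}_x=\begin{pmatrix}0&q\\-q^*&0\end{pmatrix}$, where $\mathbf P^{(1)}=\mathbf P'(0)$, is given by $$q=\left(\frac{2\det\tilde F}{\det\tilde M+2\det\tilde G}\right)_x .$$ 4. The function $q$ is a $C^\infty$ solution of the higher-order Kaup–Newell equation $$q_t=-\tfrac12q_{xxx}-\tfrac{3i}{2}\big(|q|^2q_x\big)_x+\tfrac34\big(|q|^4q\big)_x .$$ It also satisfies the compatibility condition $M_t-N_x+[M,N]=0$ for every $\zeta\in\mathbb{C}$, where $M=-i\zeta^2\sigma_3+\zeta Q$ and $$N=-2i\zeta^6\sigma_3+2\zeta^5Q-i\zeta^4Q^2\sigma_3+\zeta^3(i\sigma_3Q_x+Q^3)-\tfrac12\zeta^2(QQ_x-Q_xQ)-\tfrac34i\zeta^2Q^4\sigma_3+\zeta\big(-\tfrac12Q_{xx}+\tfrac{3i}2\sigma_3Q^2Q_x+\tfrac34Q^5\big).$$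 -/

import Mathlib

open Filter Asymptotics
open scoped Topology Matrix ContDiff ComplexConjugate

noncomputable section

namespace KaupNewell

/-! The equation and its Lax pair. -/

/-- The third Pauli matrix. -/
def sigma3 : Matrix (Fin 2) (Fin 2) ℂ := !![1, 0; 0, -1]

/-- Partial derivative in the space variable (first argument). -/
def dx (q : ℝ → ℝ → ℂ) : ℝ → ℝ → ℂ := fun x t => deriv (fun y => q y t) x

/-- Partial derivative in the time variable (second argument). -/
def dt (q : ℝ → ℝ → ℂ) : ℝ → ℝ → ℂ := fun x t => deriv (fun s => q x s) t

/-- Classical (smooth) solutions of the higher-order Kaup-Newell equation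
`q_t = -(1/2) q_xxx - (3i/2) (|q|^2 q_x)_x + (3/4) (|q|^4 q)_x`. -/
def IsSolution (q : ℝ → ℝ → ℂ) : Prop :=
  ContDiff ℝ ∞ (fun p : ℝ × ℝ => q p.1 p.2) ∧
  ∀ x t : ℝ,
    dt q x t = -(1 / 2) * dx (dx (dx q)) x t
      - (3 * Complex.I / 2) * dx (fun y s => (‖q y s‖ : ℂ) ^ 2 * dx q y s) x t
      + (3 / 4) * dx (fun y s => (‖q y s‖ : ℂ) ^ 4 * q y s) x t

/-- The off-diagonal skew-Hermitian matrix with upper right entry `q`. -/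
def potentialMatrix (q : ℝ → ℝ → ℂ) (x t : ℝ) : Matrix (Fin 2) (Fin 2) ℂ :=
  !![0, q x t; -conj (q x t), 0]

/-- The matrix `M` of the spectral problem `Y_x = M Y`. -/
def laxM (q : ℝ → ℝ → ℂ) (z : ℂ) (x t : ℝ) : Matrix (Fin 2) (Fin 2) ℂ :=
  (-Complex.I * z ^ 2) • sigma3 + z • potentialMatrix q x t

/-- The matrix `N` of the time evolution `Y_t = N Y`. -/
def laxN (q : ℝ → ℝ → ℂ) (z : ℂ) (x t : ℝ) : Matrix (Fin 2) (Fin 2) ℂ :=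
  let Q := potentialMatrix q x t
  let Qx := potentialMatrix (dx q) x t
  let Qxx := potentialMatrix (dx (dx q)) x t
  (-2 * Complex.I * z ^ 6) • sigma3
    + (2 * z ^ 5) • Q
    - (Complex.I * z ^ 4) • (Q ^ 2 * sigma3)
    + (Complex.I * z ^ 3) • (sigma3 * Qx)
    + (z ^ 3) • Q ^ 3
    - (z ^ 2 / 2) • (Q * Qx - Qx * Q)
    - (3 / 4 * Complex.I * z ^ 2) • (Q ^ 4 * sigma3)
    - (z / 2) • Qxx
    + (3 * Complex.I / 2 * z) • (sigma3 * Q ^ 2 * Qx)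
    + (3 / 4 * z) • Q ^ 5

/-- Compatibility `M_t - N_x + [M, N] = 0` of the Lax pair, for all values of the spectral
parameter, written entrywise. -/
def IsLaxCompatible (q : ℝ → ℝ → ℂ) : Prop :=
  ∀ (z : ℂ) (x t : ℝ) (a b : Fin 2),
    dt (fun y s => laxM q z y s a b) x t - dx (fun y s => laxN q z y s a b) x t
      + (laxM q z x t * laxN q z x t - laxN q z x t * laxM q z x t) a b = 0

/-! The discrete spectral data. -/

/-- The union of the open first and third quadrants. -/
def C13 : Set ℂ := {z | (0 < z.re ∧ 0 < z.im) ∨ (z.re < 0 ∧ z.im < 0)}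

/-- Reflectionless data: `r` zeros `zeta i` (standing for the quadruples `±ζ, ±ζ^*`) of
multiplicity `mult i`, with initial kernel vectors `v0 i`, which may depend on the spectral
parameter. -/
structure SolitonData where
  r : ℕ
  zeta : Fin r → ℂ
  mult : Fin r → ℕ
  v0 : Fin r → ℂ → Fin 2 → ℂ

namespace SolitonData

variable (D : SolitonData)

/-- The column vector `|v_i⟩ = exp((-i z^2 x - 2 i z^6 t) σ_3) |v_{i0}⟩` as a function of `z`. -/
def ket (x t : ℝ) (i : Fin D.r) (z : ℂ) : Fin 2 → ℂ :=
  let θ : ℂ := -Complex.I * z ^ 2 * x - 2 * Complex.I * z ^ 6 * t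
  ![Complex.exp θ * D.v0 i z 0, Complex.exp (-θ) * D.v0 i z 1]

/-- The row vector `⟨v_i|`, a function of the variable `w = z^*`: the conjugate transpose of
`|v_i⟩` at `z = w^*`. -/
def bra (x t : ℝ) (i : Fin D.r) (w : ℂ) : Fin 2 → ℂ :=
  star (D.ket x t i (conj w))

/-! The determinants. -/

/-- The `k`-th Taylor coefficient of `f` at `c`. -/
def taylorCoeff (k : ℕ) (f : ℂ → ℂ) (c : ℂ) : ℂ :=
  ((k.factorial : ℂ))⁻¹ * iteratedDeriv k f c

/-- The kernel `⟨v_j|σ_3|v_i⟩/(z + w) - ⟨v_j|v_i⟩/(z - w)`, where `z` and `w` stand for the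
independent variables `ζ` and `ζ^*`. -/
def kernel (x t : ℝ) (i j : Fin D.r) (z w : ℂ) : ℂ :=
  (D.bra x t j w ⬝ᵥ (sigma3 *ᵥ D.ket x t i z)) / (z + w)
    - (D.bra x t j w ⬝ᵥ D.ket x t i z) / (z - w)

/-- Row and column labels: a zero together with the order of a derivative. -/
abbrev Index : Type := Σ i : Fin D.r, Fin (D.mult i)

/-- The matrix `M̃`: rows carry the derivatives in `ζ` at `ζ_i`, columns those in `ζ^*` at
`ζ_j^*`. -/
def matM (x t : ℝ) : Matrix D.Index D.Index ℂ :=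
  Matrix.of fun p s =>
    taylorCoeff p.2
      (fun z => taylorCoeff s.2 (fun w => D.kernel x t p.1 s.1 z w) (conj (D.zeta s.1)))
      (D.zeta p.1)

/-- The column `χ̃`: Taylor coefficients of the first component of `|v_i⟩` at `ζ_i`. -/
def chi (x t : ℝ) (p : D.Index) : ℂ :=
  taylorCoeff p.2 (fun z => D.ket x t p.1 z 0) (D.zeta p.1)

/-- The row `ψ̃`: Taylor coefficients at `ζ_j^*` of the second component of `⟨v_j|/ζ^{*2}`. -/
def psi (x t : ℝ) (s : D.Index) : ℂ :=
  taylorCoeff s.2 (fun w => D.bra x t s.1 w 1 / w ^ 2) (conj (D.zeta s.1))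

/-- The row `τ̃`: Taylor coefficients at `ζ_j^*` of the first component of `⟨v_j|/ζ^*`. -/
def tau (x t : ℝ) (s : D.Index) : ℂ :=
  taylorCoeff s.2 (fun w => D.bra x t s.1 w 0 / w) (conj (D.zeta s.1))

/-- `M̃` bordered by the column `χ̃`, the row `ψ̃` and the corner `0`. -/
def matF (x t : ℝ) : Matrix (D.Index ⊕ Unit) (D.Index ⊕ Unit) ℂ :=
  Matrix.fromBlocks (D.matM x t) (Matrix.replicateCol Unit (D.chi x t))
    (Matrix.replicateRow Unit (D.psi x t)) 0

/-- `M̃` bordered by the column `χ̃`, the row `τ̃` and the corner `0`. -/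
def matG (x t : ℝ) : Matrix (D.Index ⊕ Unit) (D.Index ⊕ Unit) ℂ :=
  Matrix.fromBlocks (D.matM x t) (Matrix.replicateCol Unit (D.chi x t))
    (Matrix.replicateRow Unit (D.tau x t)) 0

/-- The quotient `2 det F̃ / (det M̃ + 2 det G̃)`. -/
def quotient (x t : ℝ) : ℂ :=
  2 * (D.matF x t).det / ((D.matM x t).det + 2 * (D.matG x t).det)

/-- The higher-order soliton: the `x`-derivative of the quotient. -/
def soliton : ℝ → ℝ → ℂ := dx D.quotient

/-! The reflectionless Riemann-Hilbert problem and its dressing matrix. -/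

/-- `P` solves the Riemann-Hilbert problem with trivial jump at `(x, t)`, zeros
`±ζ_i` of multiplicity `n_i`, and kernel vectors `|v_i⟩`. Since the jump is the identity, `P` is
one meromorphic function, with poles at most at the points `±ζ_i^*`. -/
structure SolvesRHP (x t : ℝ) (P : ℂ → Matrix (Fin 2) (Fin 2) ℂ) : Prop where
  analytic : ∀ a b, DifferentiableOn ℂ (fun z => P z a b) {z | ∀ i, z ^ 2 ≠ conj (D.zeta i) ^ 2}
  normalized : P 0 = 1
  bounded : ∀ a b, (fun z => P z a b) =O[Bornology.cobounded ℂ] (fun _ => (1 : ℂ))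
  involution : ∀ z, (∀ i, z ^ 2 ≠ D.zeta i ^ 2 ∧ z ^ 2 ≠ conj (D.zeta i) ^ 2) →
    P z * (P (conj z))ᴴ = 1
  parity : ∀ z, (∀ i, z ^ 2 ≠ conj (D.zeta i) ^ 2) → P (-z) = sigma3 * P z * sigma3
  det_zeros : ∃ ρ : ℂ → ℂ, DifferentiableOn ℂ ρ C13 ∧ (∀ z ∈ C13, ρ z ≠ 0) ∧
    ∀ z ∈ C13, (P z).det = (∏ i, (z ^ 2 - D.zeta i ^ 2) ^ D.mult i) * ρ z
  kernel_chain : ∀ i, (fun z => P z *ᵥ D.ket x t i z) =O[𝓝 (D.zeta i)]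
    (fun z => (z - D.zeta i) ^ D.mult i)

end SolitonData

/-- The elementary factor `I + A/(z - ζ^*) - σ_3 A σ_3/(z + ζ^*)` with
`A = (ζ^{*2} - ζ^2)/2 · diag(α^*, α) |w⟩⟨w|` and `α⁻¹ = ⟨w| diag(ζ, ζ^*) |w⟩`. -/
def dressFactor (ζ : ℂ) (w : Fin 2 → ℂ) (z : ℂ) : Matrix (Fin 2) (Fin 2) ℂ :=
  let α : ℂ := (star w ⬝ᵥ (Matrix.diagonal ![ζ, conj ζ] *ᵥ w))⁻¹
  let A : Matrix (Fin 2) (Fin 2) ℂ :=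
    ((conj ζ ^ 2 - ζ ^ 2) / 2) • (Matrix.diagonal ![conj α, α] * Matrix.vecMulVec w (star w))
  1 + (z - conj ζ)⁻¹ • A - (z + conj ζ)⁻¹ • (sigma3 * A * sigma3)

/-- The rescaled vector `Γ(ζ + δ) |v⟩(ζ + δ) / δ^j`. -/
def scaledVector (ζ : ℂ) (v : ℂ → Fin 2 → ℂ) (Γ : ℂ → Matrix (Fin 2) (Fin 2) ℂ) (j : ℕ) (δ : ℂ) :
    Fin 2 → ℂ :=
  (δ ^ j)⁻¹ • (Γ (ζ + δ) *ᵥ v (ζ + δ))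

/-- `Γ^{[j-1]} ⋯ Γ^{[0]} Γ`: the matrix `Γ` dressed `j` times at the same zero `ζ`, where the
vector of the factor `Γ^{[j]}` is the limit of the rescaled vector as `δ → 0`. -/
def dressSteps (ζ : ℂ) (v : ℂ → Fin 2 → ℂ) (Γ : ℂ → Matrix (Fin 2) (Fin 2) ℂ) :
    ℕ → ℂ → Matrix (Fin 2) (Fin 2) ℂ
  | 0 => Γ
  | j + 1 => fun z =>
      dressFactor ζ (limUnder (𝓝[≠] 0) (scaledVector ζ v (dressSteps ζ v Γ j) j)) z
        * dressSteps ζ v Γ j z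

namespace SolitonData

variable (D : SolitonData)

/-- The dressing matrix of the first `m` zeros, each with its full multiplicity. -/
def dressStage (x t : ℝ) : ℕ → ℂ → Matrix (Fin 2) (Fin 2) ℂ
  | 0 => fun _ => 1
  | m + 1 =>
      if h : m < D.r then
        dressSteps (D.zeta ⟨m, h⟩) (D.ket x t ⟨m, h⟩) (dressStage x t m) (D.mult ⟨m, h⟩)
      else dressStage x t m

/-- The dressing matrix `Γ(z) = Γ_r^{[n_r-1]} ⋯ Γ_r^{[0]} ⋯ Γ_1^{[n_1-1]} ⋯ Γ_1^{[0]}`. -/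
def dressingMatrix (x t : ℝ) : ℂ → Matrix (Fin 2) (Fin 2) ℂ := D.dressStage x t D.r

end SolitonData

end KaupNewell

end

noncomputable section

namespace KaupNewell

/-! ### The open quadrants -/

/-! The argument runs on rows of polynomials. A solution of the Riemann–Hilbert problem is rational
off its nodes; its first row, multiplied by `poleDen` = ∏(z² − ζ_i^{*2})^{n_i}, becomes a row p =
(p₀, p₁) with p₀ even, p₁ odd, p·v_i vanishing to order n_i at ζ_i, and p parallel to v_i^* to order
n_i at ζ_i^* (`IsRow`). Write p^* for p with conjugated coefficients. For two such rows both p₀p'₁ −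
p₁p'₀ and p₀p'₀^* + p₁p'₁^* are divisible by K = `fullDen`, the product of all z² − ζ_i² and z² −
ζ_i^{*2} with multiplicities (`IsRow.fullDen_dvd_cross`, `IsRow.fullDen_dvd_inner`). Nearly
everything else is degree counting and comparison of coefficients at 0 and ∞.

Determinants. Take the constant row (c₀, 0) and add polar parts at ±ζ_i^* with weights y. The polar
conditions hold for every y, and the conditions at the ζ_i follow from the linear system M̃y = c₀χ̃;
then p₀p₀^* + p₁p₁^* = |c₀|²K (`rowPoly_inner`). For c₀ = 0 this forces p to vanish on the real
line, hence y = 0, so M̃ is invertible. For c₀ = 1, evaluation at 0, where p₁ vanishes by oddness,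
gives p₀(0) ≠ 0. Schur complements turn p₀(0) and p₁'(0) into the bordered determinants, and u =
p₁'(0)/p₀(0) (`quotient_eq`).

Existence and uniqueness. A dressing factor is unitary in the sense of the involution, has
determinant (z² − ζ²)/(z² − ζ^{*2}) and annihilates its vector at ζ, so each factor raises the order
of vanishing by one. The order of the determinant is known exactly, which prevents the leading
vector from vanishing (`IsDressed.leading_ne_zero`). Conversely, the model row times P⁻¹ = P(z^*)^†
has only removable singularities and is bounded at infinity, so it is constant by Liouville
(`exists_rowQuot_eq`). This gives the first row of P, and the symmetries give the rest of P'(0).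

Evolution. Differentiating the conditions on p in x or t and correcting by the generator of the flow
of the v_i yields a row again (`isRow_deriv`). In x, degree counting leaves p₀' = −κqz p₁^* and p₁'
= −2iz²p₁ + κqz p₀^* with a unimodular constant κ. Hence a = (p₀p₀^* − p₁p₁^*)/K, b = −2κ^*p₀p₁/K
and c = −2κp₀^*p₁^*/K satisfy a² + bc = 1, b_x = −2iz²b − 2qza and c_x = 2iz²c + 2rza with r = −q^*,
and these relations determine the needed coefficients in 1/z recursively (`coeff_five_eq`). In t a
single cross product suffices: its quotient by K is a polynomial of degree at most 6 whose
coefficient of z is u_t up to a constant, and comparison at infinity gives u_t = −2i b₅. One more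
x-derivative is the Kaup–Newell equation, and the Lax compatibility is then an entrywise check. -/

lemma C13_iff {z : ℂ} : z ∈ C13 ↔ 0 < z.re * z.im := by
  unfold C13
  simp only [Set.mem_ofPred_eq, mul_pos_iff]

lemma isOpen_C13 : IsOpen C13 := by
  have : C13 = {z : ℂ | 0 < z.re * z.im} := by ext z; exact C13_iff
  rw [this]
  exact isOpen_lt continuous_const (Complex.continuous_re.mul Complex.continuous_im)

lemma ne_zero_of_mem_C13 {z : ℂ} (h : z ∈ C13) : z ≠ 0 := by
  rintro rfl
  simp [C13_iff] at h

/-- Squaring sends the first and third quadrants into the upper half-plane and their conjugates into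
the lower one. This keeps all zeros ±ζ_i apart from all poles ±ζ_j^*. -/
lemma sq_ne_conj_sq {z w : ℂ} (hz : z ∈ C13) (hw : w ∈ C13) : z ^ 2 ≠ conj w ^ 2 := by
  rw [C13_iff] at hz hw
  intro h
  have := congrArg Complex.im h
  simp only [pow_two, Complex.mul_im, Complex.conj_re, Complex.conj_im] at this
  linarith

/-! ### Elementary dressing factors -/

/-- The reciprocal of `α` in `dressFactor`. -/
def dressDenom (ζ : ℂ) (w : Fin 2 → ℂ) : ℂ := ζ * (w 0 * conj (w 0)) + conj ζ * (w 1 * conj (w 1))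

/-- The real part is Re ζ · ‖w‖², and Re ζ ≠ 0 off the imaginary axis. -/
lemma dressDenom_ne_zero {ζ : ℂ} (hζ : ζ ∈ C13) {w : Fin 2 → ℂ} (hw : w ≠ 0) :
    dressDenom ζ w ≠ 0 := by
  intro h
  rw [C13_iff] at hζ
  have hre := congrArg Complex.re h
  have hr : ζ.re ≠ 0 := fun h0 => by simp [h0] at hζ
  simp only [dressDenom, Complex.mul_conj, Complex.add_re, Complex.mul_re, Complex.ofReal_re,
    Complex.ofReal_im, mul_zero, sub_zero, Complex.conj_re, Complex.zero_re, ← mul_add] at hre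
  have hs := (mul_eq_zero.1 hre).resolve_left hr
  have h0 := Complex.normSq_nonneg (w 0)
  have h1 := Complex.normSq_nonneg (w 1)
  apply hw
  ext i
  fin_cases i
  · have : w 0 = 0 := Complex.normSq_eq_zero.1 (by linarith)
    exact this
  · have : w 1 = 0 := Complex.normSq_eq_zero.1 (by linarith)
    exact this

/-- The numerator of `dressFactor` over the common denominator `z ^ 2 - conj ζ ^ 2`. -/
def dressNum (ζ : ℂ) (w : Fin 2 → ℂ) (z : ℂ) : Matrix (Fin 2) (Fin 2) ℂ :=
  !![z ^ 2 - ζ * conj ζ * dressDenom ζ w / conj (dressDenom ζ w),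
      (conj ζ ^ 2 - ζ ^ 2) * (w 0 * conj (w 1)) * z / conj (dressDenom ζ w);
    (conj ζ ^ 2 - ζ ^ 2) * (w 1 * conj (w 0)) * z / dressDenom ζ w,
      z ^ 2 - ζ * conj ζ * conj (dressDenom ζ w) / dressDenom ζ w]

/-- Conjugation by σ₃ changes the sign of the off-diagonal entries, so pairing the poles ±ζ^* leaves
an even diagonal and an odd off-diagonal part. The algebraic properties of a factor become
polynomial identities for the numerator. -/
lemma dressFactor_eq {ζ : ℂ} (hζ : ζ ∈ C13) {w : Fin 2 → ℂ} (hw : w ≠ 0) {z : ℂ}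
    (hz : z ^ 2 ≠ conj ζ ^ 2) :
    dressFactor ζ w z = (z ^ 2 - conj ζ ^ 2)⁻¹ • dressNum ζ w z := by
  have hβ := dressDenom_ne_zero hζ hw
  have hβ' : conj (dressDenom ζ w) ≠ 0 := by simpa using hβ
  have h1 : z - conj ζ ≠ 0 := fun h => hz (by rw [sub_eq_zero.1 h])
  have h2 : z + conj ζ ≠ 0 := fun h => hz (by rw [eq_neg_of_add_eq_zero_left h]; ring)
  have h3 : z ^ 2 - conj ζ ^ 2 ≠ 0 := sub_ne_zero.2 hz
  have hα : star w ⬝ᵥ (Matrix.diagonal ![ζ, conj ζ] *ᵥ w) = dressDenom ζ w := by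
    simp [dotProduct, Matrix.mulVec_diagonal, Fin.sum_univ_two, dressDenom]
    ring
  have hA : Matrix.diagonal ![conj (dressDenom ζ w)⁻¹, (dressDenom ζ w)⁻¹] *
      Matrix.vecMulVec w (star w)
      = !![(conj (dressDenom ζ w))⁻¹ * (w 0 * conj (w 0)),
          (conj (dressDenom ζ w))⁻¹ * (w 0 * conj (w 1));
        (dressDenom ζ w)⁻¹ * (w 1 * conj (w 0)), (dressDenom ζ w)⁻¹ * (w 1 * conj (w 1))] := by
    ext i j
    fin_cases i <;> fin_cases j <;> simp [Matrix.vecMulVec]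
  have e : z ^ 2 - conj ζ ^ 2 = (z - conj ζ) * (z + conj ζ) := by ring
  simp only [dressFactor, hα, dressNum, hA]
  rw [e]
  ext i j
  fin_cases i <;> fin_cases j <;>
    simp [sigma3] <;>
    field_simp <;> simp [dressDenom] <;> ring

lemma dressNum_mul_conjTranspose {ζ : ℂ} (hζ : ζ ∈ C13) {w : Fin 2 → ℂ} (hw : w ≠ 0) (z : ℂ) :
    dressNum ζ w z * (dressNum ζ w (conj z))ᴴ
      = ((z ^ 2 - conj ζ ^ 2) * (z ^ 2 - ζ ^ 2)) • (1 : Matrix (Fin 2) (Fin 2) ℂ) := by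
  have hβ := dressDenom_ne_zero hζ hw
  have hβ' : conj (dressDenom ζ w) ≠ 0 := by simpa using hβ
  ext i j
  fin_cases i <;> fin_cases j <;>
    simp [dressNum, Matrix.mul_apply, Fin.sum_univ_two] <;>
    field_simp <;> simp [dressDenom] <;> ring

lemma det_dressNum {ζ : ℂ} (hζ : ζ ∈ C13) {w : Fin 2 → ℂ} (hw : w ≠ 0) (z : ℂ) :
    (dressNum ζ w z).det = (z ^ 2 - conj ζ ^ 2) * (z ^ 2 - ζ ^ 2) := by
  have hβ := dressDenom_ne_zero hζ hw
  have hβ' : conj (dressDenom ζ w) ≠ 0 := by simpa using hβ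
  simp [dressNum, Matrix.det_fin_two]
  field_simp
  simp [dressDenom]
  ring

lemma dressNum_neg (ζ : ℂ) (w : Fin 2 → ℂ) (z : ℂ) :
    dressNum ζ w (-z) = sigma3 * dressNum ζ w z * sigma3 := by
  ext i j
  fin_cases i <;> fin_cases j <;>
    simp [dressNum, sigma3, Matrix.mul_apply, Fin.sum_univ_two] <;> ring

lemma dressNum_mulVec {ζ : ℂ} (hζ : ζ ∈ C13) {w : Fin 2 → ℂ} (hw : w ≠ 0) :
    dressNum ζ w ζ *ᵥ w = 0 := by
  have hβ := dressDenom_ne_zero hζ hw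
  have hβ' : conj (dressDenom ζ w) ≠ 0 := by simpa using hβ
  ext i
  fin_cases i <;>
    simp only [dressNum, Matrix.mulVec, dotProduct, Fin.sum_univ_two, Matrix.of_apply,
      Matrix.cons_val_zero, Matrix.cons_val_one, Pi.zero_apply, Fin.zero_eta, Fin.mk_one] <;>
    field_simp <;> simp only [dressDenom, map_add, map_mul, Complex.conj_conj] <;> ring

lemma dressFactor_mul_conjTranspose {ζ : ℂ} (hζ : ζ ∈ C13) {w : Fin 2 → ℂ} (hw : w ≠ 0) {z : ℂ}
    (h1 : z ^ 2 ≠ ζ ^ 2) (h2 : z ^ 2 ≠ conj ζ ^ 2) :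
    dressFactor ζ w z * (dressFactor ζ w (conj z))ᴴ = 1 := by
  have h3 : (conj z) ^ 2 ≠ conj ζ ^ 2 := by
    rw [← map_pow, ← map_pow]
    exact fun h => h1 (star_injective h)
  rw [dressFactor_eq hζ hw h2, dressFactor_eq hζ hw h3, Matrix.conjTranspose_smul,
    Matrix.smul_mul, Matrix.mul_smul, dressNum_mul_conjTranspose hζ hw, smul_smul, smul_smul]
  have e1 := sub_ne_zero.2 h1
  have e2 := sub_ne_zero.2 h2
  have : star ((conj z ^ 2 - conj ζ ^ 2)⁻¹) = (z ^ 2 - ζ ^ 2)⁻¹ := by simp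
  rw [this]
  have : (z ^ 2 - conj ζ ^ 2)⁻¹ * (z ^ 2 - ζ ^ 2)⁻¹ * ((z ^ 2 - conj ζ ^ 2) * (z ^ 2 - ζ ^ 2))
      = 1 := by field_simp
  rw [this, one_smul]

lemma det_dressFactor {ζ : ℂ} (hζ : ζ ∈ C13) {w : Fin 2 → ℂ} (hw : w ≠ 0) {z : ℂ}
    (h2 : z ^ 2 ≠ conj ζ ^ 2) :
    (dressFactor ζ w z).det = (z ^ 2 - ζ ^ 2) / (z ^ 2 - conj ζ ^ 2) := by
  have e2 := sub_ne_zero.2 h2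
  rw [dressFactor_eq hζ hw h2, Matrix.det_smul, det_dressNum hζ hw]
  simp
  field_simp

lemma dressFactor_neg {ζ : ℂ} (hζ : ζ ∈ C13) {w : Fin 2 → ℂ} (hw : w ≠ 0) {z : ℂ}
    (h2 : z ^ 2 ≠ conj ζ ^ 2) :
    dressFactor ζ w (-z) = sigma3 * dressFactor ζ w z * sigma3 := by
  rw [dressFactor_eq hζ hw h2, dressFactor_eq hζ hw (by simpa using h2), dressNum_neg]
  simp

lemma dressFactor_mulVec {ζ : ℂ} (hζ : ζ ∈ C13) {w : Fin 2 → ℂ} (hw : w ≠ 0) :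
    dressFactor ζ w ζ *ᵥ w = 0 := by
  rw [dressFactor_eq hζ hw (sq_ne_conj_sq hζ hζ), Matrix.smul_mulVec, dressNum_mulVec hζ hw,
    smul_zero]

lemma analyticAt_dressFactor (ζ : ℂ) (w : Fin 2 → ℂ) {z : ℂ} (h2 : z ^ 2 ≠ conj ζ ^ 2)
    (a b : Fin 2) : AnalyticAt ℂ (fun z => dressFactor ζ w z a b) z := by
  have h1 : z - conj ζ ≠ 0 := fun h => h2 (by rw [sub_eq_zero.1 h])
  have h2 : z + conj ζ ≠ 0 := fun h => h2 (by rw [eq_neg_of_add_eq_zero_left h]; ring)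
  simp only [dressFactor, Matrix.add_apply, Matrix.sub_apply, Matrix.smul_apply, smul_eq_mul]
  fun_prop (disch := assumption)

lemma isBigO_dressFactor (ζ : ℂ) (w : Fin 2 → ℂ) (a b : Fin 2) :
    (fun z => dressFactor ζ w z a b) =O[Bornology.cobounded ℂ] (fun _ => (1 : ℂ)) := by
  have key : ∀ c : ℂ, (fun z : ℂ => (z + c)⁻¹) =O[Bornology.cobounded ℂ] (fun _ => (1 : ℂ)) := by
    intro c
    have h : Tendsto (fun z : ℂ => (z + c)⁻¹) (Bornology.cobounded ℂ) (𝓝 0) :=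
      tendsto_inv₀_cobounded.comp (tendsto_add_const_cobounded c)
    exact h.isBigO_one ℂ
  simp only [dressFactor, Matrix.add_apply, Matrix.sub_apply, Matrix.smul_apply, smul_eq_mul]
  have k1 := key (-conj ζ)
  have k2 := key (conj ζ)
  simp only [← sub_eq_add_neg] at k1
  refine ((isBigO_const_const _ one_ne_zero _).add ?_).sub ?_
  · simpa only [mul_one] using k1.mul (isBigO_const_const _ one_ne_zero _)
  · simpa only [mul_one] using k2.mul (isBigO_const_const _ one_ne_zero _)

end KaupNewell
end

/-! ### Products of dressing factors and the solution that they provide -/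

noncomputable section

namespace KaupNewell

lemma analyticAt_mul_apply {G H : ℂ → Matrix (Fin 2) (Fin 2) ℂ} {z : ℂ}
    (hG : ∀ a b, AnalyticAt ℂ (fun z => G z a b) z) (hH : ∀ a b, AnalyticAt ℂ (fun z => H z a b) z)
    (a b : Fin 2) : AnalyticAt ℂ (fun z => (G z * H z) a b) z := by
  simp only [Matrix.mul_apply]
  exact Finset.analyticAt_fun_sum _ fun c _ => (hG a c).mul (hH c b)

lemma analyticAt_mulVec_apply {G : ℂ → Matrix (Fin 2) (Fin 2) ℂ} {v : ℂ → Fin 2 → ℂ} {z : ℂ}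
    (hG : ∀ a b, AnalyticAt ℂ (fun z => G z a b) z) (hv : ∀ a, AnalyticAt ℂ (fun z => v z a) z)
    (a : Fin 2) : AnalyticAt ℂ (fun z => (G z *ᵥ v z) a) z := by
  simp only [Matrix.mulVec, dotProduct]
  exact Finset.analyticAt_fun_sum _ fun c _ => (hG a c).mul (hv c)

/-- `v` equals `(z - ζ) ^ n` times a vector analytic at `ζ`. -/
def VanishesTo (n : ℕ) (v : ℂ → Fin 2 → ℂ) (ζ : ℂ) : Prop :=
  ∃ g : ℂ → Fin 2 → ℂ, (∀ a, AnalyticAt ℂ (fun z => g z a) ζ) ∧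
    ∀ᶠ z in 𝓝 ζ, v z = (z - ζ) ^ n • g z

lemma VanishesTo.mulVec {n : ℕ} {v : ℂ → Fin 2 → ℂ} {ζ : ℂ} (h : VanishesTo n v ζ)
    {G : ℂ → Matrix (Fin 2) (Fin 2) ℂ} (hG : ∀ a b, AnalyticAt ℂ (fun z => G z a b) ζ) :
    VanishesTo n (fun z => G z *ᵥ v z) ζ := by
  obtain ⟨g, hg, he⟩ := h
  refine ⟨fun z => G z *ᵥ g z, analyticAt_mulVec_apply hG hg, ?_⟩
  filter_upwards [he] with z hz
  rw [hz, Matrix.mulVec_smul]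

lemma VanishesTo.isBigO {n : ℕ} {v : ℂ → Fin 2 → ℂ} {ζ : ℂ} (h : VanishesTo n v ζ) :
    v =O[𝓝 ζ] (fun z => (z - ζ) ^ n) := by
  obtain ⟨g, hg, he⟩ := h
  have hc : ContinuousAt g ζ := continuousAt_pi.2 fun a => (hg a).continuousAt
  have h1 : g =O[𝓝 ζ] (fun _ => (1 : ℂ)) := hc.tendsto.isBigO_one ℂ
  have h2 : (fun z => (z - ζ) ^ n • g z) =O[𝓝 ζ] (fun z => (z - ζ) ^ n • (1 : ℂ)) :=
    (isBigO_refl _ _).smul h1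
  refine (h2.congr' (he.mono fun z hz => hz.symm) ?_)
  exact Eventually.of_forall fun z => by simp

namespace SolitonData

variable (D : SolitonData)

/-- `G` is a product of dressing factors, `m i` of which belong to the zero `ζ_i`. -/
structure IsDressed (m : Fin D.r → ℕ) (G : ℂ → Matrix (Fin 2) (Fin 2) ℂ) : Prop where
  analytic : ∀ z, (∀ i, z ^ 2 ≠ conj (D.zeta i) ^ 2) → ∀ a b, AnalyticAt ℂ (fun z => G z a b) z
  bounded : ∀ a b, (fun z => G z a b) =O[Bornology.cobounded ℂ] (fun _ => (1 : ℂ))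
  involution : ∀ z, (∀ i, z ^ 2 ≠ D.zeta i ^ 2 ∧ z ^ 2 ≠ conj (D.zeta i) ^ 2) →
    G z * (G (conj z))ᴴ = 1
  parity : ∀ z, (∀ i, z ^ 2 ≠ conj (D.zeta i) ^ 2) → G (-z) = sigma3 * G z * sigma3
  det_eq : ∀ z, (∀ i, z ^ 2 ≠ conj (D.zeta i) ^ 2) →
    (G z).det = ∏ i, ((z ^ 2 - D.zeta i ^ 2) / (z ^ 2 - conj (D.zeta i) ^ 2)) ^ m i

lemma sigma3_mul_self : sigma3 * sigma3 = 1 := by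
  ext i j
  fin_cases i <;> fin_cases j <;> simp [sigma3]

lemma isDressed_one : D.IsDressed 0 (fun _ => 1) where
  analytic _ _ _ _ := analyticAt_const
  bounded _ _ := isBigO_const_const _ one_ne_zero _
  involution _ _ := by simp
  parity _ _ := by simp [sigma3_mul_self]
  det_eq _ _ := by simp

variable {D}

lemma IsDressed.mul (hζ : ∀ i, D.zeta i ∈ C13) {m : Fin D.r → ℕ}
    {G : ℂ → Matrix (Fin 2) (Fin 2) ℂ} (hG : D.IsDressed m G) (i : Fin D.r) {w : Fin 2 → ℂ}
    (hw : w ≠ 0) :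
    D.IsDressed (Function.update m i (m i + 1)) (fun z => dressFactor (D.zeta i) w z * G z) where
  analytic z hz := analyticAt_mul_apply (fun a b => analyticAt_dressFactor _ _ (hz i) a b)
    (hG.analytic z hz)
  bounded a b := by
    simp only [Matrix.mul_apply]
    refine IsBigO.fun_sum fun c _ => ?_
    simpa only [mul_one] using (isBigO_dressFactor (D.zeta i) w a c).mul (hG.bounded c b)
  involution z hz := by
    rw [Matrix.conjTranspose_mul, Matrix.mul_assoc, ← Matrix.mul_assoc (G z), hG.involution z hz,
      Matrix.one_mul, dressFactor_mul_conjTranspose (hζ i) hw (hz i).1 (hz i).2]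
  parity z hz := by
    rw [hG.parity z hz, dressFactor_neg (hζ i) hw (hz i)]
    simp only [Matrix.mul_assoc]
    rw [← Matrix.mul_assoc sigma3 sigma3, sigma3_mul_self, Matrix.one_mul]
  det_eq z hz := by
    rw [Matrix.det_mul, hG.det_eq z hz, det_dressFactor (hζ i) hw (hz i),
      ← Finset.mul_prod_erase _ _ (Finset.mem_univ i),
      ← Finset.mul_prod_erase (a := i) _ _ (Finset.mem_univ i), Function.update_self, pow_succ' _ (m i),
      mul_assoc]
    congr 2
    refine Finset.prod_congr rfl fun k hk => ?_
    rw [Function.update_of_ne (Finset.ne_of_mem_erase hk)]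

lemma IsDressed.det_ne_zero {m : Fin D.r → ℕ} {G : ℂ → Matrix (Fin 2) (Fin 2) ℂ}
    (hG : D.IsDressed m G) {z : ℂ} (hz : ∀ i, z ^ 2 ≠ conj (D.zeta i) ^ 2)
    (hz' : ∀ i, m i ≠ 0 → z ^ 2 ≠ D.zeta i ^ 2) : (G z).det ≠ 0 := by
  rw [hG.det_eq z hz, Finset.prod_ne_zero_iff]
  intro i _
  by_cases h : m i = 0
  · simp [h]
  · exact pow_ne_zero _ (div_ne_zero (sub_ne_zero.2 (hz' i h)) (sub_ne_zero.2 (hz i)))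

/-- Because ζ_i² differs from the other ζ_k² and from every ζ_k^{*2}, the only vanishing factor of
the determinant at ζ_i is (z − ζ_i)^{m_i}; the cofactor is continuous and nonzero there. -/
lemma IsDressed.exists_det_eq (hζ : ∀ i, D.zeta i ∈ C13)
    (hsq : ∀ i j, i ≠ j → D.zeta i ^ 2 ≠ D.zeta j ^ 2) {m : Fin D.r → ℕ}
    {G : ℂ → Matrix (Fin 2) (Fin 2) ℂ} (hG : D.IsDressed m G) (i : Fin D.r) :
    ∃ ρ : ℂ → ℂ, ContinuousAt ρ (D.zeta i) ∧ ρ (D.zeta i) ≠ 0 ∧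
      ∀ᶠ z in 𝓝 (D.zeta i), (G z).det = (z - D.zeta i) ^ m i * ρ z := by
  have hgood : ∀ k, D.zeta i ^ 2 ≠ conj (D.zeta k) ^ 2 := fun k => sq_ne_conj_sq (hζ i) (hζ k)
  have hopen : ∀ᶠ z in 𝓝 (D.zeta i), ∀ k, z ^ 2 ≠ conj (D.zeta k) ^ 2 :=
    eventually_all.2 fun k => (continuousAt_id.pow 2).eventually_ne (hgood k)
  have hc : ∀ k, ContinuousAt (fun z : ℂ => z ^ 2 - conj (D.zeta k) ^ 2) (D.zeta i) :=
    fun k => by fun_prop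
  have hρk : ∀ k, ContinuousAt (fun z =>
      ((z ^ 2 - D.zeta k ^ 2) / (z ^ 2 - conj (D.zeta k) ^ 2)) ^ m k) (D.zeta i) := fun k =>
    ContinuousAt.pow (ContinuousAt.div (by fun_prop) (hc k) (sub_ne_zero.2 (hgood k))) _
  refine ⟨fun z => ((z + D.zeta i) / (z ^ 2 - conj (D.zeta i) ^ 2)) ^ m i *
    ∏ k ∈ Finset.univ.erase i, ((z ^ 2 - D.zeta k ^ 2) / (z ^ 2 - conj (D.zeta k) ^ 2)) ^ m k,
    ?_, ?_, ?_⟩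
  · refine ContinuousAt.mul (ContinuousAt.pow (ContinuousAt.div (by fun_prop) (hc i)
      (sub_ne_zero.2 (hgood i))) _) ?_
    exact tendsto_finsetProd (Finset.univ.erase i) fun k _ => (hρk k).tendsto
  · refine mul_ne_zero (pow_ne_zero _ (div_ne_zero ?_ (sub_ne_zero.2 (hgood i)))) ?_
    · rw [← two_mul]
      exact mul_ne_zero two_ne_zero (ne_zero_of_mem_C13 (hζ i))
    · refine Finset.prod_ne_zero_iff.2 fun k hk => pow_ne_zero _ (div_ne_zero (sub_ne_zero.2 ?_)
        (sub_ne_zero.2 (hgood k)))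
      exact hsq i k (Finset.ne_of_mem_erase hk).symm
  · filter_upwards [hopen] with z hz
    rw [hG.det_eq z hz, ← Finset.mul_prod_erase _ _ (Finset.mem_univ i), ← mul_assoc, ← mul_pow]
    congr 3
    ring

/-- The leading vector at `ζ_i` of a dressed kernel vector does not vanish. -/
lemma IsDressed.leading_ne_zero (hζ : ∀ i, D.zeta i ∈ C13)
    (hsq : ∀ i j, i ≠ j → D.zeta i ^ 2 ≠ D.zeta j ^ 2) {m : Fin D.r → ℕ}
    {G : ℂ → Matrix (Fin 2) (Fin 2) ℂ} (hG : D.IsDressed m G) (i : Fin D.r)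
    {v g : ℂ → Fin 2 → ℂ} (hv : ContinuousAt v (D.zeta i)) (hv0 : v (D.zeta i) ≠ 0)
    (hg : ContinuousAt g (D.zeta i))
    (he : ∀ᶠ z in 𝓝 (D.zeta i), G z *ᵥ v z = (z - D.zeta i) ^ m i • g z) :
    g (D.zeta i) ≠ 0 := by
  intro h0
  obtain ⟨ρ, hρc, hρ0, hdet⟩ := hG.exists_det_eq hζ hsq i
  have hGc : ∀ a b, ContinuousAt (fun z => G z a b) (D.zeta i) :=
    fun a b => (hG.analytic _ (fun k => sq_ne_conj_sq (hζ i) (hζ k)) a b).continuousAt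
  have hadj : ContinuousAt (fun z => (G z).adjugate *ᵥ g z) (D.zeta i) := by
    have hG' : ContinuousAt G (D.zeta i) :=
      continuousAt_pi.2 fun a => continuousAt_pi.2 fun b => hGc a b
    have : Continuous fun p : Matrix (Fin 2) (Fin 2) ℂ × (Fin 2 → ℂ) => p.1.adjugate *ᵥ p.2 :=
      (Continuous.matrix_adjugate continuous_fst).matrix_mulVec continuous_snd
    have h2 : ContinuousAt (fun z => (G z, g z)) (D.zeta i) := hG'.prodMk hg
    exact ContinuousAt.comp (g := fun p : Matrix (Fin 2) (Fin 2) ℂ × (Fin 2 → ℂ) =>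
      p.1.adjugate *ᵥ p.2) (f := fun z => (G z, g z)) this.continuousAt h2
  -- Multiplying G v = (z − ζ_i)^m g by the adjugate and cancelling the power gives adj(G) g = ρ v
  -- off ζ_i. In the limit, g(ζ_i) = 0 would contradict ρ(ζ_i) v(ζ_i) ≠ 0.
  have key : (fun z => (G z).adjugate *ᵥ g z) =ᶠ[𝓝[≠] D.zeta i] (fun z => ρ z • v z) := by
    filter_upwards [hdet.filter_mono nhdsWithin_le_nhds, he.filter_mono nhdsWithin_le_nhds,
      self_mem_nhdsWithin] with z h1 h2 h3
    have h4 : (z - D.zeta i) ^ m i ≠ 0 := pow_ne_zero _ (sub_ne_zero.2 h3)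
    have h5 := congrArg (fun u => (G z).adjugate *ᵥ u) h2
    simp only [Matrix.mulVec_mulVec, Matrix.adjugate_mul, Matrix.mulVec_smul, Matrix.smul_mulVec,
      Matrix.one_mulVec] at h5
    rw [h1, mul_smul] at h5
    exact (smul_right_injective _ h4 h5).symm
  have hlim := tendsto_nhds_unique
    ((hadj.tendsto.mono_left nhdsWithin_le_nhds).congr' key)
    ((hρc.smul hv).tendsto.mono_left nhdsWithin_le_nhds)
  rw [h0, Matrix.mulVec_zero] at hlim
  exact smul_ne_zero hρ0 hv0 hlim.symm

lemma tendsto_scaledVector {ζ : ℂ} {v g : ℂ → Fin 2 → ℂ} {G : ℂ → Matrix (Fin 2) (Fin 2) ℂ}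
    {j : ℕ} (hg : ContinuousAt g ζ) (he : ∀ᶠ z in 𝓝 ζ, G z *ᵥ v z = (z - ζ) ^ j • g z) :
    Tendsto (scaledVector ζ v G j) (𝓝[≠] 0) (𝓝 (g ζ)) := by
  have ht : Tendsto (fun δ : ℂ => ζ + δ) (𝓝 0) (𝓝 ζ) := by
    simpa using (continuous_const_add ζ).tendsto (0 : ℂ)
  refine ((hg.tendsto.comp ht).mono_left nhdsWithin_le_nhds).congr' ?_
  filter_upwards [(ht.eventually he).filter_mono nhdsWithin_le_nhds, self_mem_nhdsWithin]
    with δ h1 h2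
  have h3 : δ ^ j ≠ 0 := pow_ne_zero _ h2
  rw [scaledVector, h1, smul_smul, add_sub_cancel_left, inv_mul_cancel₀ h3, one_smul]
  rfl

/-- Dressing at another zero multiplies from the left by factors analytic at z₀, so orders of
vanishing already obtained are kept. -/
lemma vanishesTo_dressSteps {z₀ : ℂ} {n : ℕ} {u : ℂ → Fin 2 → ℂ}
    {G : ℂ → Matrix (Fin 2) (Fin 2) ℂ} (h : VanishesTo n (fun z => G z *ᵥ u z) z₀)
    {ζ : ℂ} (hz : z₀ ^ 2 ≠ conj ζ ^ 2) (v : ℂ → Fin 2 → ℂ) (j : ℕ) :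
    VanishesTo n (fun z => dressSteps ζ v G j z *ᵥ u z) z₀ := by
  induction j with
  | zero => exact h
  | succ j ih =>
    simp only [dressSteps, ← Matrix.mulVec_mulVec]
    exact ih.mulVec fun a b => analyticAt_dressFactor _ _ hz a b

lemma vanishesTo_one {ζ : ℂ} {g : ℂ → Fin 2 → ℂ} (hg : ∀ a, AnalyticAt ℂ (fun z => g z a) ζ)
    (h0 : g ζ = 0) : VanishesTo 1 g ζ := by
  choose h hh he using fun a => (natCast_le_analyticOrderAt (hg a) (n := 1)).1 (by
    rw [Nat.cast_one, Order.one_le_iff_ne_zero, analyticOrderAt_ne_zero]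
    exact ⟨hg a, by rw [h0]; rfl⟩)
  refine ⟨fun z a => h a z, hh, ?_⟩
  filter_upwards [eventually_all.2 he] with z hz
  ext a
  exact hz a

/-- The invariants of the dressing chain at the zero `ζ_i`. -/
lemma dressSteps_spec (hζ : ∀ i, D.zeta i ∈ C13)
    (hsq : ∀ i j, i ≠ j → D.zeta i ^ 2 ≠ D.zeta j ^ 2) {m : Fin D.r → ℕ}
    {G : ℂ → Matrix (Fin 2) (Fin 2) ℂ} (hG : D.IsDressed m G) (i : Fin D.r) (hm : m i = 0)
    {v : ℂ → Fin 2 → ℂ} (hv : ∀ a, AnalyticAt ℂ (fun z => v z a) (D.zeta i))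
    (hv0 : v (D.zeta i) ≠ 0) (j : ℕ) :
    D.IsDressed (Function.update m i j) (dressSteps (D.zeta i) v G j) ∧
    VanishesTo j (fun z => dressSteps (D.zeta i) v G j z *ᵥ v z) (D.zeta i) ∧
    (∃ w : Fin 2 → ℂ, w ≠ 0 ∧
      Tendsto (scaledVector (D.zeta i) v (dressSteps (D.zeta i) v G j) j) (𝓝[≠] 0) (𝓝 w)) := by
  have hgood : ∀ k, D.zeta i ^ 2 ≠ conj (D.zeta k) ^ 2 := fun k => sq_ne_conj_sq (hζ i) (hζ k)
  have hvc : ContinuousAt v (D.zeta i) := continuousAt_pi.2 fun a => (hv a).continuousAt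
  -- Nonvanishing of the leading vector is needed inside the induction, since the next factor is
  -- built from it, and once more for the conclusion.
  have limit : ∀ j, D.IsDressed (Function.update m i j) (dressSteps (D.zeta i) v G j) →
      ∀ g : ℂ → Fin 2 → ℂ, (∀ a, AnalyticAt ℂ (fun z => g z a) (D.zeta i)) →
      (∀ᶠ z in 𝓝 (D.zeta i), dressSteps (D.zeta i) v G j z *ᵥ v z = (z - D.zeta i) ^ j • g z) →
      g (D.zeta i) ≠ 0 ∧
      Tendsto (scaledVector (D.zeta i) v (dressSteps (D.zeta i) v G j) j) (𝓝[≠] 0)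
        (𝓝 (g (D.zeta i))) := by
    intro j hj g hg he
    have hgc : ContinuousAt g (D.zeta i) := continuousAt_pi.2 fun a => (hg a).continuousAt
    refine ⟨?_, tendsto_scaledVector hgc he⟩
    refine hj.leading_ne_zero hζ hsq i hvc hv0 hgc ?_
    rwa [Function.update_self]
  have main : D.IsDressed (Function.update m i j) (dressSteps (D.zeta i) v G j) ∧
      VanishesTo j (fun z => dressSteps (D.zeta i) v G j z *ᵥ v z) (D.zeta i) := by
    induction j with
    | zero =>
      refine ⟨?_, fun z => G z *ᵥ v z, analyticAt_mulVec_apply (hG.analytic _ hgood) hv, ?_⟩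
      · have : Function.update m i 0 = m := by rw [← hm, Function.update_eq_self]
        rw [this]
        exact hG
      · exact Eventually.of_forall fun z => by simp [dressSteps]
    | succ j ih =>
      obtain ⟨h1, g, hg, he⟩ := ih
      obtain ⟨hne, hlim⟩ := limit j h1 g hg he
      -- The vector in the definition is a `limUnder`, which is meaningful only because the limit
      -- has just been shown to exist.
      have hstep : dressSteps (D.zeta i) v G (j + 1) = fun z =>
          dressFactor (D.zeta i) (g (D.zeta i)) z * dressSteps (D.zeta i) v G j z := by
        funext z
        rw [dressSteps, hlim.limUnder_eq]
      have h2 := h1.mul hζ i hne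
      rw [Function.update_self, Function.update_idem] at h2
      rw [hstep]
      refine ⟨h2, ?_⟩
      have hA := analyticAt_mulVec_apply (G := dressFactor (D.zeta i) (g (D.zeta i)))
        (fun a b => analyticAt_dressFactor _ _ (hgood i) a b) hg
      -- The new factor annihilates the leading vector at ζ_i, which gains one more power of z −
      -- ζ_i.
      obtain ⟨k, hk, hke⟩ := vanishesTo_one hA (dressFactor_mulVec (hζ i) hne)
      refine ⟨k, hk, ?_⟩
      filter_upwards [he, hke] with z h3 h4
      rw [← Matrix.mulVec_mulVec, h3, Matrix.mulVec_smul, h4, pow_one, smul_smul, pow_succ]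
  obtain ⟨h1, g, hg, he⟩ := main
  exact ⟨h1, ⟨g, hg, he⟩, g (D.zeta i), limit j h1 g hg he⟩

/-- The multiplicities of the first `m` zeros. -/
def multUpTo (D : SolitonData) (m : ℕ) (i : Fin D.r) : ℕ := if (i : ℕ) < m then D.mult i else 0

lemma analyticAt_ket (hanalytic : ∀ i c, AnalyticAt ℂ (fun z => D.v0 i z c) (D.zeta i))
    (x t : ℝ) (i : Fin D.r) (c : Fin 2) : AnalyticAt ℂ (fun z => D.ket x t i z c) (D.zeta i) := by
  have h0 := hanalytic i 0
  have h1 := hanalytic i 1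
  fin_cases c <;> simp only [ket] <;> simp <;> fun_prop

lemma ket_ne_zero (hne : ∀ i, D.v0 i (D.zeta i) ≠ 0) (x t : ℝ) (i : Fin D.r) :
    D.ket x t i (D.zeta i) ≠ 0 := by
  intro h
  apply hne i
  have h0 := congrFun h 0
  have h1 := congrFun h 1
  simp [ket, Complex.exp_ne_zero] at h0 h1
  ext c
  fin_cases c
  · exact h0
  · exact h1

lemma dressStage_spec (hζ : ∀ i, D.zeta i ∈ C13)
    (hsq : ∀ i j, i ≠ j → D.zeta i ^ 2 ≠ D.zeta j ^ 2)
    (hanalytic : ∀ i c, AnalyticAt ℂ (fun z => D.v0 i z c) (D.zeta i))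
    (hne : ∀ i, D.v0 i (D.zeta i) ≠ 0) (x t : ℝ) (m : ℕ) :
    D.IsDressed (D.multUpTo m) (D.dressStage x t m) ∧
    ∀ i : Fin D.r, (i : ℕ) < m →
      VanishesTo (D.mult i) (fun z => D.dressStage x t m z *ᵥ D.ket x t i z) (D.zeta i) := by
  induction m with
  | zero =>
    refine ⟨?_, fun i hi => absurd hi (Nat.not_lt_zero _)⟩
    have : D.multUpTo 0 = 0 := by funext i; simp [multUpTo]
    rw [this]
    exact D.isDressed_one
  | succ m ih =>
    by_cases h : m < D.r
    · have hst : D.dressStage x t (m + 1) = dressSteps (D.zeta ⟨m, h⟩) (D.ket x t ⟨m, h⟩)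
          (D.dressStage x t m) (D.mult ⟨m, h⟩) := by
        rw [dressStage, dif_pos h]
      have hs := dressSteps_spec hζ hsq ih.1 ⟨m, h⟩ (by simp [multUpTo])
        (analyticAt_ket hanalytic x t _) (ket_ne_zero hne x t _) (D.mult ⟨m, h⟩)
      rw [hst]
      constructor
      · convert! hs.1 using 1
        funext i
        by_cases hi : i = ⟨m, h⟩
        · subst hi
          simp [multUpTo]
        · rw [Function.update_of_ne hi]
          have : (i : ℕ) ≠ m := fun h' => hi (Fin.ext h')
          simp only [multUpTo]
          congr 1
          simp only [eq_iff_iff]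
          omega
      · intro i hi
        by_cases him : i = ⟨m, h⟩
        · rw [him]
          exact hs.2.1
        · have : (i : ℕ) ≠ m := fun h' => him (Fin.ext h')
          exact vanishesTo_dressSteps (ih.2 i (by omega)) (sq_ne_conj_sq (hζ i) (hζ _)) _ _
    · have hst : D.dressStage x t (m + 1) = D.dressStage x t m := by
        rw [dressStage, dif_neg h]
      rw [hst]
      refine ⟨?_, fun i hi => ih.2 i (by have := i.2; omega)⟩
      convert! ih.1 using 1
      funext i
      have := i.2
      simp only [multUpTo]
      rw [if_pos (by omega), if_pos (by omega)]

lemma exists_tendsto_scaledVector (hζ : ∀ i, D.zeta i ∈ C13)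
    (hsq : ∀ i j, i ≠ j → D.zeta i ^ 2 ≠ D.zeta j ^ 2)
    (hanalytic : ∀ i c, AnalyticAt ℂ (fun z => D.v0 i z c) (D.zeta i))
    (hne : ∀ i, D.v0 i (D.zeta i) ≠ 0) (x t : ℝ) (i : Fin D.r) (j : ℕ) :
    ∃ w : Fin 2 → ℂ, w ≠ 0 ∧
      Tendsto (scaledVector (D.zeta i) (D.ket x t i)
        (dressSteps (D.zeta i) (D.ket x t i) (D.dressStage x t i) j) j) (𝓝[≠] 0) (𝓝 w) :=
  (dressSteps_spec hζ hsq (dressStage_spec hζ hsq hanalytic hne x t i).1 i (by simp [multUpTo])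
    (analyticAt_ket hanalytic x t _) (ket_ne_zero hne x t _) j).2.2

/-- The normalized dressing matrix solves the Riemann-Hilbert problem. -/
lemma solvesRHP_dressingMatrix (hζ : ∀ i, D.zeta i ∈ C13)
    (hsq : ∀ i j, i ≠ j → D.zeta i ^ 2 ≠ D.zeta j ^ 2)
    (hanalytic : ∀ i c, AnalyticAt ℂ (fun z => D.v0 i z c) (D.zeta i))
    (hne : ∀ i, D.v0 i (D.zeta i) ≠ 0) (x t : ℝ) :
    D.SolvesRHP x t (fun z => (D.dressingMatrix x t 0)⁻¹ * D.dressingMatrix x t z) := by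
  obtain ⟨hG, hv⟩ := dressStage_spec hζ hsq hanalytic hne x t D.r
  change D.IsDressed _ (D.dressingMatrix x t) at hG
  set G := D.dressingMatrix x t with hGdef
  have hmult : D.multUpTo D.r = D.mult := by
    funext i
    simp [multUpTo]
  rw [hmult] at hG
  have hz0 : ∀ i, (0 : ℂ) ^ 2 ≠ D.zeta i ^ 2 ∧ (0 : ℂ) ^ 2 ≠ conj (D.zeta i) ^ 2 := by
    intro i
    have := ne_zero_of_mem_C13 (hζ i)
    rw [zero_pow two_ne_zero]
    exact ⟨(pow_ne_zero 2 this).symm, (pow_ne_zero 2 (by simpa using this)).symm⟩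
  -- The origin is its own conjugate, so the involution makes G(0) unitary.
  have hU : G 0 * (G 0)ᴴ = 1 := by simpa using hG.involution 0 hz0
  have hinv : (G 0)⁻¹ = (G 0)ᴴ := Matrix.inv_eq_right_inv hU
  have hU' : (G 0)ᴴ * G 0 = 1 := mul_eq_one_comm.1 hU
  -- The origin is its own negative, so the parity relation says that G(0) commutes with σ₃; hence
  -- normalizing by G(0)⁻¹ from the left preserves parity.
  have hs : sigma3 * G 0 = G 0 * sigma3 := by
    have := hG.parity 0 fun i => (hz0 i).2
    rw [neg_zero] at this
    conv_rhs => rw [this]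
    rw [Matrix.mul_assoc, Matrix.mul_assoc, sigma3_mul_self, Matrix.mul_one]
  have hσ : sigma3ᴴ = sigma3 := by
    ext i j
    fin_cases i <;> fin_cases j <;> simp [sigma3]
  have hs' : (G 0)ᴴ * sigma3 = sigma3 * (G 0)ᴴ := by
    have := congrArg Matrix.conjTranspose hs
    rwa [Matrix.conjTranspose_mul, Matrix.conjTranspose_mul, hσ] at this
  have hdet0 : (G 0).det ≠ 0 := hG.det_ne_zero (fun i => (hz0 i).2) fun i _ => (hz0 i).1
  rw [hinv]
  refine ⟨?_, hU', ?_, ?_, ?_, ?_, ?_⟩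
  · intro a b z hz
    exact (analyticAt_mul_apply (G := fun _ => (G 0)ᴴ) (fun _ _ => analyticAt_const)
      (hG.analytic z hz) a b).differentiableAt.differentiableWithinAt
  · intro a b
    simp only [Matrix.mul_apply]
    refine IsBigO.fun_sum fun c _ => ?_
    exact (hG.bounded c b).const_mul_left _
  · intro z hz
    rw [Matrix.conjTranspose_mul, Matrix.conjTranspose_conjTranspose, Matrix.mul_assoc,
      ← Matrix.mul_assoc (G z), hG.involution z hz, Matrix.one_mul, hU']
  · intro z hz
    simp only [hG.parity z hz, Matrix.mul_assoc]
    rw [← Matrix.mul_assoc (G 0)ᴴ, hs', Matrix.mul_assoc]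
  -- What remains of the determinant after removing the zeros is a nonzero constant over `poleDen`,
  -- which has no zero in the two open quadrants.
  · refine ⟨fun z => ((G 0)ᴴ).det * (∏ i, (z ^ 2 - conj (D.zeta i) ^ 2) ^ D.mult i)⁻¹, ?_, ?_, ?_⟩
    · refine (differentiableOn_const _).mul (DifferentiableOn.inv (by fun_prop) ?_)
      intro z hz
      exact Finset.prod_ne_zero_iff.2 fun i _ =>
        pow_ne_zero _ (sub_ne_zero.2 (sq_ne_conj_sq hz (hζ i)))
    · intro z hz
      refine mul_ne_zero ?_ (inv_ne_zero ?_)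
      · rw [Matrix.det_conjTranspose]
        simpa using hdet0
      · exact Finset.prod_ne_zero_iff.2 fun i _ =>
          pow_ne_zero _ (sub_ne_zero.2 (sq_ne_conj_sq hz (hζ i)))
    · intro z hz
      rw [Matrix.det_mul, hG.det_eq z fun i => sq_ne_conj_sq hz (hζ i)]
      simp only [div_pow, Finset.prod_div_distrib]
      ring
  · intro i
    simp only [← Matrix.mulVec_mulVec]
    exact ((hv i i.2).mulVec (G := fun _ => (G 0)ᴴ) fun _ _ => analyticAt_const).isBigO

end SolitonData
end KaupNewell
end

/-! ### Orders of vanishing and Taylor coefficients -/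

noncomputable section

namespace KaupNewell

/-- `f` equals `(z - c) ^ n` times a function analytic at `c`. -/
def VanishesAt (n : ℕ) (f : ℂ → ℂ) (c : ℂ) : Prop :=
  ∃ g : ℂ → ℂ, AnalyticAt ℂ g c ∧ ∀ᶠ z in 𝓝 c, f z = (z - c) ^ n * g z

namespace VanishesAt

variable {n : ℕ} {f g : ℂ → ℂ} {c : ℂ}

lemma congr (h : VanishesAt n f c) (he : g =ᶠ[𝓝 c] f) : VanishesAt n g c := by
  obtain ⟨k, hk, hke⟩ := h
  exact ⟨k, hk, by filter_upwards [hke, he] with z h1 h2; rw [h2, h1]⟩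

lemma add (hf : VanishesAt n f c) (hg : VanishesAt n g c) : VanishesAt n (fun z => f z + g z) c := by
  obtain ⟨k, hk, hke⟩ := hf
  obtain ⟨l, hl, hle⟩ := hg
  exact ⟨fun z => k z + l z, hk.add hl, by filter_upwards [hke, hle] with z h1 h2; rw [h1, h2]; ring⟩

lemma mul_left (hf : VanishesAt n f c) (hg : AnalyticAt ℂ g c) :
    VanishesAt n (fun z => g z * f z) c := by
  obtain ⟨k, hk, hke⟩ := hf
  exact ⟨fun z => g z * k z, hg.mul hk, by filter_upwards [hke] with z h1; rw [h1]; ring⟩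

lemma sub (hf : VanishesAt n f c) (hg : VanishesAt n g c) : VanishesAt n (fun z => f z - g z) c := by
  refine (hf.add (hg.mul_left (analyticAt_const (v := -1)))).congr ?_
  exact Eventually.of_forall fun z => by ring

lemma of_dvd {P : Polynomial ℂ} (h : (Polynomial.X - Polynomial.C c) ^ n ∣ P) :
    VanishesAt n (fun z => P.eval z) c := by
  obtain ⟨Q, rfl⟩ := h
  exact ⟨fun z => Q.eval z, AnalyticAt.aeval_polynomial analyticAt_id Q,
    Eventually.of_forall fun z => by simp⟩

/-- If the root multiplicity m were smaller than n, the cofactor of (z − c)^m would tend to 0 at c,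
so c would be one more root. This passes from analytic conditions on the kernel vectors to
divisibility of polynomials. -/
lemma dvd {P : Polynomial ℂ} (h : VanishesAt n (fun z => P.eval z) c) :
    (Polynomial.X - Polynomial.C c) ^ n ∣ P := by
  obtain ⟨g, hg, he⟩ := h
  by_cases hP : P = 0
  · rw [hP]; exact dvd_zero _
  rw [← Polynomial.le_rootMultiplicity_iff hP]
  by_contra hlt
  push Not at hlt
  obtain ⟨Q, hQ, hQc⟩ := Polynomial.exists_eq_pow_rootMultiplicity_mul_and_not_dvd P hP c
  rw [Polynomial.dvd_iff_isRoot] at hQc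
  apply hQc
  set m := P.rootMultiplicity c
  have key : (fun z => Q.eval z) =ᶠ[𝓝[≠] c] (fun z => (z - c) ^ (n - m) * g z) := by
    filter_upwards [he.filter_mono nhdsWithin_le_nhds, self_mem_nhdsWithin] with z h1 h2
    have h3 : (z - c) ^ m ≠ 0 := pow_ne_zero _ (sub_ne_zero.2 h2)
    rw [hQ] at h1
    simp only [Polynomial.eval_mul, Polynomial.eval_pow, Polynomial.eval_sub, Polynomial.eval_X,
      Polynomial.eval_C] at h1
    apply mul_left_cancel₀ h3
    rw [h1, ← mul_assoc, ← pow_add]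
    congr 2
    omega
  have l1 : Tendsto (fun z => Q.eval z) (𝓝[≠] c) (𝓝 (Q.eval c)) :=
    Q.continuous.continuousAt.tendsto.mono_left nhdsWithin_le_nhds
  have l2 : Tendsto (fun z => (z - c) ^ (n - m) * g z) (𝓝[≠] c) (𝓝 ((c - c) ^ (n - m) * g c)) := by
    have : ContinuousAt (fun z => (z - c) ^ (n - m) * g z) c :=
      ContinuousAt.mul (by fun_prop) hg.continuousAt
    exact this.tendsto.mono_left nhdsWithin_le_nhds
  have := tendsto_nhds_unique (l1.congr' key) l2
  rw [sub_self, zero_pow (by omega), zero_mul] at this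
  exact this

end VanishesAt

namespace SolitonData

lemma taylorCoeff_congr {f g : ℂ → ℂ} {c : ℂ} (h : f =ᶠ[𝓝 c] g) (k : ℕ) :
    taylorCoeff k f c = taylorCoeff k g c := by
  rw [taylorCoeff, h.iteratedDeriv_eq, taylorCoeff]

lemma taylorCoeff_add {f g : ℂ → ℂ} {c : ℂ} (hf : AnalyticAt ℂ f c) (hg : AnalyticAt ℂ g c)
    (k : ℕ) : taylorCoeff k (fun z => f z + g z) c = taylorCoeff k f c + taylorCoeff k g c := by
  rw [taylorCoeff, iteratedDeriv_fun_add hf.contDiffAt hg.contDiffAt]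
  simp only [taylorCoeff]
  ring

lemma taylorCoeff_const_mul {f : ℂ → ℂ} {c : ℂ} (a : ℂ) (k : ℕ) :
    taylorCoeff k (fun z => a * f z) c = a * taylorCoeff k f c := by
  rw [taylorCoeff, iteratedDeriv_const_mul_field]
  simp only [taylorCoeff]
  ring

lemma taylorCoeff_sub {f g : ℂ → ℂ} {c : ℂ} (hf : AnalyticAt ℂ f c) (hg : AnalyticAt ℂ g c)
    (k : ℕ) : taylorCoeff k (fun z => f z - g z) c = taylorCoeff k f c - taylorCoeff k g c := by
  rw [taylorCoeff, iteratedDeriv_fun_sub hf.contDiffAt hg.contDiffAt]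
  simp only [taylorCoeff]
  ring

lemma taylorCoeff_sum {ι : Type*} {s : Finset ι} {f : ι → ℂ → ℂ} {c : ℂ}
    (hf : ∀ i ∈ s, AnalyticAt ℂ (f i) c) (k : ℕ) :
    taylorCoeff k (fun z => ∑ i ∈ s, f i z) c = ∑ i ∈ s, taylorCoeff k (f i) c := by
  rw [taylorCoeff, iteratedDeriv_fun_sum fun i hi => (hf i hi).contDiffAt, Finset.mul_sum]
  rfl

lemma taylorCoeff_mul {f g : ℂ → ℂ} {c : ℂ} (hf : AnalyticAt ℂ f c) (hg : AnalyticAt ℂ g c)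
    (k : ℕ) : taylorCoeff k (fun z => f z * g z) c
      = ∑ i ∈ Finset.range (k + 1), taylorCoeff i f c * taylorCoeff (k - i) g c := by
  rw [taylorCoeff, iteratedDeriv_fun_mul hf.contDiffAt hg.contDiffAt, Finset.mul_sum]
  refine Finset.sum_congr rfl fun i hi => ?_
  have hi' : i ≤ k := Nat.lt_succ_iff.1 (Finset.mem_range.1 hi)
  simp only [taylorCoeff]
  rw [Nat.choose_eq_factorial_div_factorial hi',
    Nat.cast_div (Nat.factorial_mul_factorial_dvd_factorial hi')
      (by exact_mod_cast mul_ne_zero (Nat.factorial_ne_zero _) (Nat.factorial_ne_zero _))]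
  have h1 : (k.factorial : ℂ) ≠ 0 := by exact_mod_cast Nat.factorial_ne_zero _
  have h2 : (i.factorial : ℂ) ≠ 0 := by exact_mod_cast Nat.factorial_ne_zero _
  have h3 : ((k - i).factorial : ℂ) ≠ 0 := by exact_mod_cast Nat.factorial_ne_zero _
  push_cast
  field_simp

lemma iteratedDeriv_conj_conj (f : ℂ → ℂ) (k : ℕ) :
    iteratedDeriv k (fun w => conj (f (conj w))) = fun w => conj (iteratedDeriv k f (conj w)) := by
  induction k with
  | zero => simp
  | succ k ih =>
    rw [iteratedDeriv_succ, ih, iteratedDeriv_succ]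
    have := deriv_conj_conj (f := iteratedDeriv k f)
    exact this

lemma taylorCoeff_conj (f : ℂ → ℂ) (c : ℂ) (k : ℕ) :
    taylorCoeff k (fun w => conj (f (conj w))) (conj c) = conj (taylorCoeff k f c) := by
  simp only [taylorCoeff, iteratedDeriv_conj_conj]
  simp

/-- Taylor coefficients of the Cauchy kernel in its second variable are the pure poles of order k +
1; the polar parts of the rows arise from the matrix kernel in this way. -/
lemma taylorCoeff_inv_sub (z c : ℂ) (k : ℕ) :
    taylorCoeff k (fun w => (z - w)⁻¹) c = ((z - c) ^ (k + 1))⁻¹ := by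
  have h := congrFun (iter_deriv_inv_linear k (-1 : ℂ) z) c
  have e : (fun x : ℂ => (-1 * x + z)⁻¹) = fun w => (z - w)⁻¹ := by
    funext x; congr 1; ring
  rw [e, ← iteratedDeriv_eq_iterate] at h
  have h1 : (k.factorial : ℂ) ≠ 0 := by exact_mod_cast Nat.factorial_ne_zero _
  have h2 : ((-1 : ℂ) ^ k) * (-1) ^ k = 1 := by rw [← mul_pow]; norm_num
  have h3 : (-1 - (k : ℤ)) = -((k + 1 : ℕ) : ℤ) := by push_cast; ring
  rw [taylorCoeff, h, h3, zpow_neg, zpow_natCast]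
  have e2 : -1 * c + z = z - c := by ring
  rw [e2]
  calc _ = ((k.factorial : ℂ)⁻¹ * k.factorial) * ((-1) ^ k * (-1) ^ k) * ((z - c) ^ (k + 1))⁻¹ := by
        ring
    _ = _ := by rw [h2, inv_mul_cancel₀ h1]; ring

lemma taylorCoeff_inv_add (z c : ℂ) (k : ℕ) :
    taylorCoeff k (fun w => (z + w)⁻¹) c = (-1) ^ k * ((z + c) ^ (k + 1))⁻¹ := by
  have h := congrFun (iter_deriv_inv_linear k (1 : ℂ) z) c
  have e : (fun x : ℂ => (1 * x + z)⁻¹) = fun w => (z + w)⁻¹ := by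
    funext x; congr 1; ring
  rw [e, ← iteratedDeriv_eq_iterate] at h
  have h1 : (k.factorial : ℂ) ≠ 0 := by exact_mod_cast Nat.factorial_ne_zero _
  have h3 : (-1 - (k : ℤ)) = -((k + 1 : ℕ) : ℤ) := by push_cast; ring
  rw [taylorCoeff, h, h3, zpow_neg, zpow_natCast]
  have e2 : 1 * c + z = z + c := by ring
  rw [e2, one_pow]
  calc _ = ((k.factorial : ℂ)⁻¹ * k.factorial) * (-1) ^ k * ((z + c) ^ (k + 1))⁻¹ := by ring
    _ = _ := by rw [inv_mul_cancel₀ h1, one_mul]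

lemma taylorCoeff_inv_sq (c : ℂ) (k : ℕ) :
    taylorCoeff k (fun w => (w ^ 2)⁻¹) c = (-1) ^ k * (k + 1) * (c ^ (k + 2))⁻¹ := by
  -- Since w⁻² is minus the derivative of w⁻¹, the coefficient follows from the next Taylor
  -- coefficient of w⁻¹.
  have e : (fun w : ℂ => (w ^ 2)⁻¹) = fun w => (-1) * deriv (fun w : ℂ => (0 + w)⁻¹) w := by
    funext w
    simp
  rw [e, taylorCoeff_const_mul, taylorCoeff, ← iteratedDeriv_succ']
  have h := taylorCoeff_inv_add 0 c (k + 1)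
  rw [taylorCoeff, zero_add, Nat.factorial_succ] at h
  have h1 : (k.factorial : ℂ) ≠ 0 := by exact_mod_cast Nat.factorial_ne_zero _
  have h2 : ((k : ℂ) + 1) ≠ 0 := by exact_mod_cast Nat.succ_ne_zero k
  push_cast at h
  have h3 : iteratedDeriv (k + 1) (fun w : ℂ => (0 + w)⁻¹) c
      = (k + 1) * k.factorial * ((-1) ^ (k + 1) * (c ^ (k + 1 + 1))⁻¹) := by
    rw [← h]
    field_simp
  rw [h3]
  field_simp
  ring

/-- Taylor's formula with analytic remainder. -/
lemma vanishesAt_sub_taylor {f : ℂ → ℂ} {c : ℂ} (hf : AnalyticAt ℂ f c) (n : ℕ) :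
    VanishesAt n (fun z => f z - ∑ a ∈ Finset.range n, taylorCoeff a f c * (z - c) ^ a) c := by
  have hf0 : AnalyticAt ℂ (fun z => f (z + c)) 0 := by
    have : AnalyticAt ℂ f (0 + c) := by simpa using hf
    exact this.comp_of_eq (by fun_prop) rfl
  obtain ⟨F, hF, he⟩ := hf0.exists_eq_sum_add_pow_mul n
  refine ⟨fun z => F (z - c), ?_, Eventually.of_forall fun z => ?_⟩
  · have : AnalyticAt ℂ F (c - c) := by simpa using hF
    exact this.comp_of_eq (by fun_prop) rfl
  · have h := he (z - c)
    simp only [sub_add_cancel, smul_eq_mul] at h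
    beta_reduce
    rw [h, add_sub_assoc, add_comm, sub_add_eq_add_sub]
    rw [add_sub_assoc, add_eq_left, sub_eq_zero]
    refine Finset.sum_congr rfl fun a _ => ?_
    have := congrFun (iteratedDeriv_comp_add_const a f c) 0
    rw [this, taylorCoeff, zero_add]
    ring

lemma vanishesAt_of_taylorCoeff {f : ℂ → ℂ} {c : ℂ} (hf : AnalyticAt ℂ f c) (n : ℕ)
    (h : ∀ a < n, taylorCoeff a f c = 0) : VanishesAt n f c := by
  refine (vanishesAt_sub_taylor hf n).congr (Eventually.of_forall fun z => ?_)
  simp only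
  rw [Finset.sum_eq_zero, sub_zero]
  intro a ha
  rw [h a (Finset.mem_range.1 ha), zero_mul]

/-- Taylor coefficients of exponentials depend smoothly on parameters in the exponent. -/
lemma contDiff_taylorCoeff_exp {α β : ℂ → ℂ} {c : ℂ} (hα : AnalyticAt ℂ α c)
    (hβ : AnalyticAt ℂ β c) (k : ℕ) {h : ℂ → ℂ} (hh : AnalyticAt ℂ h c) :
    ContDiff ℝ ∞ (fun p : ℝ × ℝ =>
      taylorCoeff k (fun z => Complex.exp (p.1 * α z + p.2 * β z) * h z) c) := by
  unfold taylorCoeff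
  refine contDiff_const.mul ?_
  induction k generalizing h with
  | zero =>
    simp only [iteratedDeriv_zero]
    have h1 : ContDiff ℝ ∞ (fun p : ℝ × ℝ => (p.1 : ℂ)) :=
      Complex.ofRealCLM.contDiff.comp contDiff_fst
    have h2 : ContDiff ℝ ∞ (fun p : ℝ × ℝ => (p.2 : ℂ)) :=
      Complex.ofRealCLM.contDiff.comp contDiff_snd
    exact ((h1.mul contDiff_const).add (h2.mul contDiff_const)).cexp.mul contDiff_const
  | succ k ih =>
    have h1 : ContDiff ℝ ∞ (fun p : ℝ × ℝ => (p.1 : ℂ)) :=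
      Complex.ofRealCLM.contDiff.comp contDiff_fst
    have h2 : ContDiff ℝ ∞ (fun p : ℝ × ℝ => (p.2 : ℂ)) :=
      Complex.ofRealCLM.contDiff.comp contDiff_snd
    -- A z-derivative reproduces the exponential, changes only the amplitude h and brings the
    -- parameters out as linear prefactors. This is why the induction runs over all amplitudes.
    have e : ∀ p : ℝ × ℝ, iteratedDeriv (k + 1)
        (fun z => Complex.exp (p.1 * α z + p.2 * β z) * h z) c
        = p.1 * iteratedDeriv k
            (fun z => Complex.exp (p.1 * α z + p.2 * β z) * (deriv α z * h z)) c
          + p.2 * iteratedDeriv k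
            (fun z => Complex.exp (p.1 * α z + p.2 * β z) * (deriv β z * h z)) c
          + iteratedDeriv k (fun z => Complex.exp (p.1 * α z + p.2 * β z) * deriv h z) c := by
      intro p
      have hE : AnalyticAt ℂ (fun z => Complex.exp (p.1 * α z + p.2 * β z)) c := by fun_prop
      have b1 : ContDiffAt ℂ k (fun z => (p.1 : ℂ) * (Complex.exp (p.1 * α z + p.2 * β z) * (deriv α z * h z))) c :=
        (analyticAt_const.mul (hE.mul (hα.deriv.mul hh))).contDiffAt
      have b2 : ContDiffAt ℂ k (fun z => (p.2 : ℂ) * (Complex.exp (p.1 * α z + p.2 * β z) * (deriv β z * h z))) c :=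
        (analyticAt_const.mul (hE.mul (hβ.deriv.mul hh))).contDiffAt
      have b3 : ContDiffAt ℂ k (fun z => (p.1 : ℂ) * (Complex.exp (p.1 * α z + p.2 * β z) * (deriv α z * h z))
          + (p.2 : ℂ) * (Complex.exp (p.1 * α z + p.2 * β z) * (deriv β z * h z))) c := b1.add b2
      have a3 : ContDiffAt ℂ k (fun z => Complex.exp (p.1 * α z + p.2 * β z) * deriv h z) c :=
        (hE.mul hh.deriv).contDiffAt
      rw [iteratedDeriv_succ', ← iteratedDeriv_const_mul_field, ← iteratedDeriv_const_mul_field,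
        ← iteratedDeriv_fun_add b1 b2, ← iteratedDeriv_fun_add b3 a3]
      refine EventuallyEq.iteratedDeriv_eq k ?_
      filter_upwards [hα.eventually_analyticAt, hβ.eventually_analyticAt, hh.eventually_analyticAt]
        with z z1 z2 z3
      have d1 := z1.differentiableAt.hasDerivAt
      have d2 := z2.differentiableAt.hasDerivAt
      have d3 := z3.differentiableAt.hasDerivAt
      have := (((d1.const_mul (p.1 : ℂ)).add (d2.const_mul (p.2 : ℂ))).cexp.mul d3).deriv
      refine Eq.trans this ?_
      simp only [Pi.add_apply]
      ring
    simp_rw [e]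
    exact ((h1.mul (ih (hα.deriv.mul hh))).add (h2.mul (ih (hβ.deriv.mul hh)))).add (ih hh.deriv)

/-- Differentiation under a Taylor coefficient. -/
lemma hasDerivAt_taylorCoeff_exp {α η : ℂ → ℂ} {c : ℂ} (hα : AnalyticAt ℂ α c)
    (hη : AnalyticAt ℂ η c) (k : ℕ) {h : ℂ → ℂ} (hh : AnalyticAt ℂ h c) (x : ℝ) :
    HasDerivAt (fun x : ℝ => taylorCoeff k (fun z => Complex.exp (x * α z + η z) * h z) c)
      (taylorCoeff k (fun z => Complex.exp (x * α z + η z) * (α z * h z)) c) x := by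
  unfold taylorCoeff
  refine HasDerivAt.const_mul _ ?_
  induction k generalizing h with
  | zero =>
    simp only [iteratedDeriv_zero]
    have h1 : HasDerivAt (fun x : ℝ => (x : ℂ) * α c + η c) (α c) x := by
      simpa using ((Complex.ofRealCLM.hasDerivAt (x := x)).mul_const (α c)).add_const (η c)
    have := h1.cexp.mul_const (h c)
    simpa [mul_assoc] using this
  | succ k ih =>
    -- Only α' carries the parameter x; the η' term is absorbed into the amplitude, so the induction
    -- hypothesis applies to both summands.
    have e : ∀ (x : ℝ) (g : ℂ → ℂ), AnalyticAt ℂ g c → iteratedDeriv (k + 1)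
        (fun z => Complex.exp (x * α z + η z) * g z) c
        = x * iteratedDeriv k
            (fun z => Complex.exp (x * α z + η z) * (deriv α z * g z)) c
          + iteratedDeriv k
            (fun z => Complex.exp (x * α z + η z) * (deriv η z * g z + deriv g z)) c := by
      intro x g hg
      have hE : AnalyticAt ℂ (fun z => Complex.exp (x * α z + η z)) c := by fun_prop
      have b1 : ContDiffAt ℂ k (fun z => (x : ℂ) * (Complex.exp (x * α z + η z) * (deriv α z * g z))) c :=
        (analyticAt_const.mul (hE.mul (hα.deriv.mul hg))).contDiffAt
      have a3 : ContDiffAt ℂ k (fun z => Complex.exp (x * α z + η z) * (deriv η z * g z + deriv g z)) c :=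
        (hE.mul ((hη.deriv.mul hg).add hg.deriv)).contDiffAt
      rw [iteratedDeriv_succ', ← iteratedDeriv_const_mul_field, ← iteratedDeriv_fun_add b1 a3]
      refine EventuallyEq.iteratedDeriv_eq k ?_
      filter_upwards [hα.eventually_analyticAt, hη.eventually_analyticAt, hg.eventually_analyticAt]
        with z z1 z2 z3
      have d1 := z1.differentiableAt.hasDerivAt
      have d2 := z2.differentiableAt.hasDerivAt
      have d3 := z3.differentiableAt.hasDerivAt
      have := (((d1.const_mul (x : ℂ)).add d2).cexp.mul d3).deriv
      refine Eq.trans this ?_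
      simp only [Pi.add_apply]
      ring
    have e1 : (fun x : ℝ => iteratedDeriv (k + 1) (fun z => Complex.exp (x * α z + η z) * h z) c)
        = fun x : ℝ => x * iteratedDeriv k
            (fun z => Complex.exp (x * α z + η z) * (deriv α z * h z)) c
          + iteratedDeriv k
            (fun z => Complex.exp (x * α z + η z) * (deriv η z * h z + deriv h z)) c :=
      funext fun x => e x h hh
    rw [e1, e x (fun z => α z * h z) (hα.mul hh)]
    have d := ((Complex.ofRealCLM.hasDerivAt (x := x)).mul (ih (hα.deriv.mul hh))).add
      (ih ((hη.deriv.mul hh).add hh.deriv))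
    refine HasDerivAt.congr_deriv d ?_
    have hE : AnalyticAt ℂ (fun z => Complex.exp (x * α z + η z)) c := by fun_prop
    have a1 : ContDiffAt ℂ k (fun z => Complex.exp (x * α z + η z) * (deriv α z * h z)) c :=
      (hE.mul (hα.deriv.mul hh)).contDiffAt
    have a2 : ContDiffAt ℂ k (fun z => Complex.exp (x * α z + η z) * (α z * (deriv η z * h z + deriv h z))) c :=
      (hE.mul (hα.mul ((hη.deriv.mul hh).add hh.deriv))).contDiffAt
    -- The term that comes from differentiating the prefactor x supplies the missing part of (αh)' =
    -- α'h + αh'.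
    have a3 : iteratedDeriv k (fun z => Complex.exp (x * α z + η z) * (deriv α z * h z)) c
        + iteratedDeriv k (fun z => Complex.exp (x * α z + η z) * (α z * (deriv η z * h z + deriv h z))) c
        = iteratedDeriv k (fun z => Complex.exp (x * α z + η z) *
          (deriv η z * (α z * h z) + deriv (fun z => α z * h z) z)) c := by
      rw [← iteratedDeriv_fun_add a1 a2]
      refine EventuallyEq.iteratedDeriv_eq k ?_
      filter_upwards [hα.eventually_analyticAt, hh.eventually_analyticAt] with z z1 z3
      have : deriv (fun z => α z * h z) z = deriv α z * h z + α z * deriv h z :=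
        (z1.differentiableAt.hasDerivAt.mul z3.differentiableAt.hasDerivAt).deriv
      rw [this]
      ring
    have a4 : (fun z => Complex.exp (x * α z + η z) * (deriv α z * (α z * h z)))
        = fun z => Complex.exp (x * α z + η z) * (α z * (deriv α z * h z)) := by
      funext z
      ring
    rw [← a3, a4]
    simp only [Complex.ofRealCLM_apply, Complex.ofReal_one, one_mul, Pi.mul_apply, Pi.add_apply]
    ring

end SolitonData
end KaupNewell
end

/-! ### Polynomial rows with prescribed zeros, poles and parity -/

noncomputable section

namespace KaupNewell

open Polynomial

/-- Complex conjugation of the coefficients of a polynomial. -/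
def conjPoly : ℂ[X] →+* ℂ[X] := Polynomial.mapRingHom (starRingEnd ℂ)

@[simp] lemma conjPoly_X : conjPoly X = X := by simp [conjPoly]

@[simp] lemma conjPoly_C (a : ℂ) : conjPoly (C a) = C (conj a) := by simp [conjPoly]

@[simp] lemma conjPoly_conjPoly (p : ℂ[X]) : conjPoly (conjPoly p) = p := by
  ext n
  simp [conjPoly]

@[simp] lemma coeff_conjPoly (p : ℂ[X]) (n : ℕ) : (conjPoly p).coeff n = conj (p.coeff n) := by
  simp [conjPoly]

lemma natDegree_conjPoly (p : ℂ[X]) : (conjPoly p).natDegree = p.natDegree := by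
  simp only [conjPoly, Polynomial.coe_mapRingHom]
  exact Polynomial.natDegree_map _

lemma eval_conjPoly (p : ℂ[X]) (z : ℂ) : (conjPoly p).eval z = conj (p.eval (conj z)) := by
  have := Polynomial.eval_map_apply (f := starRingEnd ℂ) (p := p) (x := conj z)
  rw [Complex.conj_conj] at this
  exact this

lemma conjPoly_comp_neg_X (p : ℂ[X]) : (conjPoly p).comp (-X) = conjPoly (p.comp (-X)) := by
  simp only [conjPoly, Polynomial.coe_mapRingHom]
  rw [Polynomial.map_comp]
  simp

lemma X_sub_C_pow_dvd_conjPoly {a : ℂ} {n : ℕ} {p : ℂ[X]} (h : (X - C a) ^ n ∣ p) :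
    (X - C (conj a)) ^ n ∣ conjPoly p := by
  have := map_dvd conjPoly h
  simpa using this

lemma X_add_C_pow_dvd_comp {a : ℂ} {n : ℕ} {p : ℂ[X]} (h : (X - C a) ^ n ∣ p) :
    (X - C (-a)) ^ n ∣ p.comp (-X) := by
  obtain ⟨q, rfl⟩ := h
  refine ⟨(-1) ^ n * q.comp (-X), ?_⟩
  simp only [mul_comp, pow_comp, sub_comp, X_comp, C_comp, ← mul_assoc, ← mul_pow, C_neg]
  congr 2
  ring

lemma isCoprime_X_sub_C_pow {a b : ℂ} (h : a ≠ b) (m n : ℕ) :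
    IsCoprime ((X - C a) ^ m) ((X - C b) ^ n) :=
  (Polynomial.isCoprime_X_sub_C_of_isUnit_sub (sub_ne_zero.2 h).isUnit).pow

lemma isCoprime_X_sq_sub_C {a b : ℂ} (h : a ≠ b) :
    IsCoprime (X ^ 2 - C a) (X ^ 2 - C b : ℂ[X]) := by
  refine ⟨C (b - a)⁻¹, -C (b - a)⁻¹, ?_⟩
  have : C (b - a)⁻¹ * (X ^ 2 - C a) + -C (b - a)⁻¹ * (X ^ 2 - C b)
      = C ((b - a)⁻¹ * (b - a)) := by
    rw [C_mul, C_sub]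
    ring
  rw [this, inv_mul_cancel₀ (sub_ne_zero.2 h.symm), C_1]

lemma X_sub_C_pow_dvd_of_mul {c : ℂ} {n : ℕ} {v W : ℂ[X]} (hv : v.eval c ≠ 0)
    (h : (X - C c) ^ n ∣ v * W) : (X - C c) ^ n ∣ W := by
  have : IsCoprime ((X - C c) ^ n) v := by
    refine IsCoprime.pow_left ?_
    rw [Polynomial.isCoprime_iff_aeval_ne_zero_of_isAlgClosed ℂ ℂ]
    intro a
    by_cases hac : a = c
    · right; simpa [hac] using hv
    · left; simpa [sub_eq_zero] using hac
  exact this.dvd_of_dvd_mul_left h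

/-- Parity copies the zero at a to −a, and a ≠ 0 makes the two powers coprime. -/
lemma X_sq_sub_C_pow_dvd {a : ℂ} (ha : a ≠ 0) {n : ℕ} {W : ℂ[X]} (h1 : (X - C a) ^ n ∣ W)
    (h2 : W.comp (-X) = W ∨ W.comp (-X) = -W) : (X ^ 2 - C (a ^ 2)) ^ n ∣ W := by
  have h3 : (X - C (-a)) ^ n ∣ W := by
    have := X_add_C_pow_dvd_comp h1
    rcases h2 with h2 | h2
    · rwa [h2] at this
    · rwa [h2, dvd_neg] at this
  have hne : a ≠ -a := fun h => ha (by linear_combination h / 2)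
  have := (isCoprime_X_sub_C_pow hne n n).mul_dvd h1 h3
  rw [← mul_pow] at this
  convert this using 2
  rw [C_neg, C_pow]
  ring

lemma eq_C_mul_of_dvd {R : Type*} [CommRing R] {K W : R[X]} (hK : K.Monic) (h : K ∣ W)
    (hW : W.natDegree ≤ K.natDegree) : W = C (W.coeff K.natDegree) * K := by
  obtain ⟨Q, rfl⟩ := h
  nontriviality R
  have hQ : Q.natDegree = 0 := by
    by_cases hQ0 : Q = 0
    · simp [hQ0]
    rw [hK.natDegree_mul' hQ0] at hW
    omega
  rw [Polynomial.eq_C_of_natDegree_eq_zero hQ]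
  simp [hK.coeff_natDegree]
  ring

namespace SolitonData

variable (D : SolitonData)

/-- The polynomial `∏ (z ^ 2 - ζ_i^{*2}) ^ n_i`. -/
def poleDen : ℂ[X] := ∏ i, (X ^ 2 - C (conj (D.zeta i) ^ 2)) ^ D.mult i

/-- The polynomial `∏ (z ^ 2 - ζ_i ^ 2) ^ n_i`. -/
def zeroDen : ℂ[X] := ∏ i, (X ^ 2 - C (D.zeta i ^ 2)) ^ D.mult i

lemma conjPoly_poleDen : conjPoly D.poleDen = D.zeroDen := by
  simp [poleDen, zeroDen, map_prod]

lemma monic_poleDen : D.poleDen.Monic :=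
  monic_prod_of_monic _ _ fun _ _ => (monic_X_pow_sub_C _ two_ne_zero).pow _

lemma monic_zeroDen : D.zeroDen.Monic :=
  monic_prod_of_monic _ _ fun _ _ => (monic_X_pow_sub_C _ two_ne_zero).pow _

lemma natDegree_zeroDen : D.zeroDen.natDegree = D.poleDen.natDegree := by
  rw [← conjPoly_poleDen, natDegree_conjPoly]

lemma poleDen_comp : D.poleDen.comp (-X) = D.poleDen := by
  simp [poleDen, prod_comp]

lemma eval_poleDen (z : ℂ) :
    D.poleDen.eval z = ∏ i, (z ^ 2 - conj (D.zeta i) ^ 2) ^ D.mult i := by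
  simp [poleDen, eval_prod]

lemma eval_zeroDen (z : ℂ) :
    D.zeroDen.eval z = ∏ i, (z ^ 2 - D.zeta i ^ 2) ^ D.mult i := by
  simp [zeroDen, eval_prod]

lemma eval_poleDen_ne_zero {z : ℂ} (h : ∀ i, z ^ 2 ≠ conj (D.zeta i) ^ 2) :
    D.poleDen.eval z ≠ 0 := by
  rw [eval_poleDen]
  exact Finset.prod_ne_zero_iff.2 fun i _ => pow_ne_zero _ (sub_ne_zero.2 (h i))

/-- The common denominator of products of a row and a conjugate row. -/
def fullDen : ℂ[X] := D.poleDen * D.zeroDen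

lemma monic_fullDen : D.fullDen.Monic := D.monic_poleDen.mul D.monic_zeroDen

lemma natDegree_fullDen : D.fullDen.natDegree = D.poleDen.natDegree + D.poleDen.natDegree := by
  rw [fullDen, D.monic_poleDen.natDegree_mul D.monic_zeroDen, natDegree_zeroDen]

/-- The rows of polynomials which, divided by `poleDen`, have the parity, the zeros and the polar
parts of the first row of a solution of the Riemann-Hilbert problem, up to growth. -/
structure IsRow (v : Fin D.r → Fin 2 → ℂ[X]) (p : Fin 2 → ℂ[X]) : Prop where
  even : (p 0).comp (-X) = p 0
  odd : (p 1).comp (-X) = -p 1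
  zeros : ∀ i, (X - C (D.zeta i)) ^ D.mult i ∣ p 0 * v i 0 + p 1 * v i 1
  poles : ∀ i, (X - C (conj (D.zeta i))) ^ D.mult i ∣
    p 0 * conjPoly (v i 1) - p 1 * conjPoly (v i 0)

variable {D}

/-- Parity reduces the four families ±ζ_i, ±ζ_i^* to two, and the quadratic factors are pairwise
coprime because the squares ζ_i² are distinct and never meet the ζ_j^{*2}. -/
lemma fullDen_dvd (hζ : ∀ i, D.zeta i ∈ C13)
    (hsq : ∀ i j, i ≠ j → D.zeta i ^ 2 ≠ D.zeta j ^ 2) {W : ℂ[X]}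
    (h : W.comp (-X) = W ∨ W.comp (-X) = -W)
    (h1 : ∀ i, (X - C (D.zeta i)) ^ D.mult i ∣ W)
    (h2 : ∀ i, (X - C (conj (D.zeta i))) ^ D.mult i ∣ W) : D.fullDen ∣ W := by
  have hz : ∀ i, D.zeta i ≠ 0 := fun i => ne_zero_of_mem_C13 (hζ i)
  have hsq' : ∀ i j, i ≠ j → conj (D.zeta i) ^ 2 ≠ conj (D.zeta j) ^ 2 := by
    intro i j hij h
    rw [← map_pow, ← map_pow] at h
    exact hsq i j hij (star_injective h)
  refine IsCoprime.mul_dvd ?_ ?_ ?_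
  · refine IsCoprime.prod_left fun i _ => IsCoprime.prod_right fun j _ => IsCoprime.pow ?_
    exact isCoprime_X_sq_sub_C (sq_ne_conj_sq (hζ j) (hζ i)).symm
  · refine Finset.prod_dvd_of_coprime ?_ fun i _ =>
      X_sq_sub_C_pow_dvd (by simpa using hz i) (h2 i) h
    intro i _ j _ hij
    exact (isCoprime_X_sq_sub_C (hsq' i j hij)).pow
  · refine Finset.prod_dvd_of_coprime ?_ fun i _ => X_sq_sub_C_pow_dvd (hz i) (h1 i) h
    intro i _ j _ hij
    exact (isCoprime_X_sq_sub_C (hsq i j hij)).pow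

/-- Near ζ_i both rows annihilate the same vector v_i, and near ζ_i^* both are parallel to v_i^*, so
they are parallel to each other to order n_i at both points. Multiplying the cross product by a
component of v_i nonzero at ζ_i, or by its conjugate at ζ_i^*, makes this a linear combination of
the defining divisibilities. The cross product is odd. -/
lemma IsRow.fullDen_dvd_cross (hζ : ∀ i, D.zeta i ∈ C13)
    (hsq : ∀ i j, i ≠ j → D.zeta i ^ 2 ≠ D.zeta j ^ 2) {v : Fin D.r → Fin 2 → ℂ[X]}
    (hv : ∀ i, D.mult i ≠ 0 → ∃ c, (v i c).eval (D.zeta i) ≠ 0) {p p' : Fin 2 → ℂ[X]} (hp : D.IsRow v p)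
    (hp' : D.IsRow v p') : D.fullDen ∣ p 0 * p' 1 - p 1 * p' 0 := by
  refine fullDen_dvd hζ hsq (Or.inr ?_) (fun i => ?_) (fun i => ?_)
  · rw [sub_comp, mul_comp, mul_comp, hp.even, hp.odd, hp'.even, hp'.odd]
    ring
  · by_cases hm : D.mult i = 0
    · simp [hm]
    obtain ⟨c, hc⟩ := hv i hm
    refine X_sub_C_pow_dvd_of_mul hc ?_
    have h1 := hp.zeros i
    have h2 := hp'.zeros i
    fin_cases c
    · have := (h1.mul_right (p' 1)).sub (h2.mul_right (p 1))
      convert this using 1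
      simp only [Fin.zero_eta]
      ring
    · have := (h2.mul_right (p 0)).sub (h1.mul_right (p' 0))
      convert this using 1
      simp only [Fin.mk_one]
      ring
  · by_cases hm : D.mult i = 0
    · simp [hm]
    obtain ⟨c, hc⟩ := hv i hm
    have hc' : (conjPoly (v i c)).eval (conj (D.zeta i)) ≠ 0 := by
      rw [eval_conjPoly, Complex.conj_conj]
      simpa using hc
    refine X_sub_C_pow_dvd_of_mul hc' ?_
    have h1 := hp.poles i
    have h2 := hp'.poles i
    fin_cases c
    · have := (h1.mul_right (p' 0)).sub (h2.mul_right (p 0))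
      convert this using 1
      simp only [Fin.zero_eta]
      ring
    · have := (h1.mul_right (p' 1)).sub (h2.mul_right (p 1))
      convert this using 1
      simp only [Fin.mk_one]
      ring

/-- Conjugating the polar condition of p' at ζ_i^* shows that p'^* is parallel to v_i near ζ_i,
while p annihilates v_i there. -/
lemma IsRow.X_sub_C_dvd_inner {v : Fin D.r → Fin 2 → ℂ[X]}
    (hv : ∀ i, D.mult i ≠ 0 → ∃ c, (v i c).eval (D.zeta i) ≠ 0) {p p' : Fin 2 → ℂ[X]} (hp : D.IsRow v p)
    (hp' : D.IsRow v p') (i : Fin D.r) :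
    (X - C (D.zeta i)) ^ D.mult i ∣ p 0 * conjPoly (p' 0) + p 1 * conjPoly (p' 1) := by
  by_cases hm : D.mult i = 0
  · simp [hm]
  obtain ⟨c, hc⟩ := hv i hm
  refine X_sub_C_pow_dvd_of_mul hc ?_
  have h1 := hp.zeros i
  have h2 := X_sub_C_pow_dvd_conjPoly (hp'.poles i)
  simp only [Complex.conj_conj, map_sub, map_mul, conjPoly_conjPoly] at h2
  fin_cases c
  · have := (h1.mul_right (conjPoly (p' 0))).sub (h2.mul_right (p 1))
    convert this using 1
    simp only [Fin.zero_eta]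
    ring
  · have := (h1.mul_right (conjPoly (p' 1))).add (h2.mul_right (p 0))
    convert this using 1
    simp only [Fin.mk_one]
    ring

lemma IsRow.fullDen_dvd_inner (hζ : ∀ i, D.zeta i ∈ C13)
    (hsq : ∀ i j, i ≠ j → D.zeta i ^ 2 ≠ D.zeta j ^ 2) {v : Fin D.r → Fin 2 → ℂ[X]}
    (hv : ∀ i, D.mult i ≠ 0 → ∃ c, (v i c).eval (D.zeta i) ≠ 0) {p p' : Fin 2 → ℂ[X]} (hp : D.IsRow v p)
    (hp' : D.IsRow v p') : D.fullDen ∣ p 0 * conjPoly (p' 0) + p 1 * conjPoly (p' 1) := by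
  refine fullDen_dvd hζ hsq (Or.inl ?_) (fun i => hp.X_sub_C_dvd_inner hv hp' i) (fun i => ?_)
  · rw [add_comp, mul_comp, mul_comp, conjPoly_comp_neg_X, conjPoly_comp_neg_X, hp.even, hp.odd,
      hp'.even, hp'.odd, map_neg]
    ring
  · have := X_sub_C_pow_dvd_conjPoly (hp'.X_sub_C_dvd_inner hv hp i)
    simp only [map_add, map_mul, conjPoly_conjPoly] at this
    convert this using 1
    ring

end SolitonData
end KaupNewell
end

/-! ### The linear system with matrix M̃ -/

noncomputable section

namespace KaupNewell

open Polynomial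

namespace SolitonData

variable (D : SolitonData)

/-- Taylor coefficients of `|v_i⟩` at `ζ_i`. -/
def ketCoeff (x t : ℝ) (i : Fin D.r) (c : Fin 2) (a : ℕ) : ℂ :=
  taylorCoeff a (fun z => D.ket x t i z c) (D.zeta i)

/-- The Taylor polynomial of `|v_i⟩` at `ζ_i` of the order of the zero. -/
def jet (x t : ℝ) (i : Fin D.r) (c : Fin 2) : ℂ[X] :=
  ∑ a ∈ Finset.range (D.mult i), C (D.ketCoeff x t i c a) * (X - C (D.zeta i)) ^ a

/-- The quotient of `poleDen` by `(z - ζ_i^*) ^ (l + 1)`. -/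
def cofactor (i : Fin D.r) (l : ℕ) : ℂ[X] := D.poleDen /ₘ (X - C (conj (D.zeta i))) ^ (l + 1)

/-- Numerator of the polar part at `ζ_i^*` with label `s`. -/
def poleNum (x t : ℝ) (s : D.Index) (c : Fin 2) : ℂ[X] :=
  D.cofactor s.1 s.2 * ∑ a ∈ Finset.range (s.2 + 1),
    C (conj (D.ketCoeff x t s.1 c a)) * (X - C (conj (D.zeta s.1))) ^ a

/-- The signs `1, -1`. -/
def sgn : Fin 2 → ℂ := ![1, -1]

/-- Numerator of the symmetrized polar part with label `s`. -/
def rowTerm (x t : ℝ) (s : D.Index) (c : Fin 2) : ℂ[X] :=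
  D.poleNum x t s c + C (sgn c) * (D.poleNum x t s c).comp (-X)

/-- Numerator of the row `c₀ e₁` plus polar parts with coefficients `y`. -/
def rowPoly (x t : ℝ) (c₀ : ℂ) (y : D.Index → ℂ) (c : Fin 2) : ℂ[X] :=
  C (if c = 0 then c₀ else 0) * D.poleDen + ∑ s, C (y s) * D.rowTerm x t s c

/-- The symmetrized polar part with label `s`. -/
def poleFun (x t : ℝ) (s : D.Index) (c : Fin 2) (z : ℂ) : ℂ :=
  ∑ a ∈ Finset.range (s.2 + 1), conj (D.ketCoeff x t s.1 c a) *
    (((z - conj (D.zeta s.1)) ^ (s.2 - a + 1))⁻¹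
      - sgn c * ((-1) ^ (s.2 - a) * ((z + conj (D.zeta s.1)) ^ (s.2 - a + 1))⁻¹))

variable {D}

lemma X_sub_C_pow_dvd_poleDen (i : Fin D.r) :
    (X - C (conj (D.zeta i))) ^ D.mult i ∣ D.poleDen := by
  refine dvd_trans (pow_dvd_pow_of_dvd ?_ _) (Finset.dvd_prod_of_mem _ (Finset.mem_univ i))
  refine ⟨X + C (conj (D.zeta i)), ?_⟩
  rw [C_pow]
  ring

lemma X_sub_C_pow_mul_cofactor (s : D.Index) :
    (X - C (conj (D.zeta s.1))) ^ ((s.2 : ℕ) + 1) * D.cofactor s.1 s.2 = D.poleDen := by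
  have h : (X - C (conj (D.zeta s.1))) ^ ((s.2 : ℕ) + 1) ∣ D.poleDen :=
    (pow_dvd_pow _ s.2.2).trans (X_sub_C_pow_dvd_poleDen s.1)
  have hm : ((X - C (conj (D.zeta s.1))) ^ ((s.2 : ℕ) + 1)).Monic := (monic_X_sub_C _).pow _
  have := modByMonic_add_div D.poleDen ((X - C (conj (D.zeta s.1))) ^ ((s.2 : ℕ) + 1))
  rwa [(modByMonic_eq_zero_iff_dvd hm).2 h, zero_add] at this

lemma eval_cofactor (s : D.Index) {z : ℂ} (hz : z ≠ conj (D.zeta s.1)) :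
    (D.cofactor s.1 s.2).eval z
      = D.poleDen.eval z * ((z - conj (D.zeta s.1)) ^ ((s.2 : ℕ) + 1))⁻¹ := by
  have h := congrArg (eval z) (X_sub_C_pow_mul_cofactor s)
  simp only [eval_mul, eval_pow, eval_sub, eval_X, eval_C] at h
  have h0 : (z - conj (D.zeta s.1)) ^ ((s.2 : ℕ) + 1) ≠ 0 := pow_ne_zero _ (sub_ne_zero.2 hz)
  rw [← h]
  field_simp

lemma eval_poleNum (x t : ℝ) (s : D.Index) (c : Fin 2) {z : ℂ} (hz : z ≠ conj (D.zeta s.1)) :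
    (D.poleNum x t s c).eval z = D.poleDen.eval z * ∑ a ∈ Finset.range (s.2 + 1),
      conj (D.ketCoeff x t s.1 c a) * ((z - conj (D.zeta s.1)) ^ ((s.2 : ℕ) - a + 1))⁻¹ := by
  rw [poleNum, eval_mul, eval_cofactor s hz, mul_assoc, eval_finsetSum, Finset.mul_sum]
  congr 1
  refine Finset.sum_congr rfl fun a ha => ?_
  have ha' : a ≤ (s.2 : ℕ) := Nat.lt_succ_iff.1 (Finset.mem_range.1 ha)
  have h0 : z - conj (D.zeta s.1) ≠ 0 := sub_ne_zero.2 hz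
  have e : (s.2 : ℕ) + 1 = ((s.2 : ℕ) - a + 1) + a := by omega
  simp only [eval_mul, eval_pow, eval_sub, eval_X, eval_C]
  rw [e, pow_add]
  field_simp

lemma eval_rowTerm (x t : ℝ) (s : D.Index) (c : Fin 2) {z : ℂ} (hz : z ≠ conj (D.zeta s.1))
    (hz' : z ≠ -conj (D.zeta s.1)) :
    (D.rowTerm x t s c).eval z = D.poleDen.eval z * D.poleFun x t s c z := by
  have hz'' : -z ≠ conj (D.zeta s.1) := fun h => hz' (by rw [← h, neg_neg])
  have hD : D.poleDen.eval (-z) = D.poleDen.eval z := by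
    conv_rhs => rw [← poleDen_comp]
    simp
  rw [rowTerm, eval_add, eval_mul, eval_C, eval_comp, eval_neg, eval_X, eval_poleNum x t s c hz,
    eval_poleNum x t s c hz'', hD, poleFun]
  have e : ∀ a, ((-z - conj (D.zeta s.1)) ^ ((s.2 : ℕ) - a + 1))⁻¹
      = - ((-1) ^ ((s.2 : ℕ) - a) * ((z + conj (D.zeta s.1)) ^ ((s.2 : ℕ) - a + 1))⁻¹) := by
    intro a
    rw [show -z - conj (D.zeta s.1) = (-1) * (z + conj (D.zeta s.1)) by ring, mul_pow, mul_inv,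
      ← inv_pow, pow_succ (-1 : ℂ)⁻¹]
    norm_num
  simp only [e, Finset.mul_sum]
  rw [← Finset.sum_add_distrib]
  refine Finset.sum_congr rfl fun a _ => ?_
  ring

lemma bra_apply (x t : ℝ) (i : Fin D.r) (c : Fin 2) :
    (fun w => D.bra x t i w c) = fun w => conj (D.ket x t i (conj w) c) := by
  funext w
  simp [bra]

lemma analyticAt_conj_conj {f : ℂ → ℂ} {c : ℂ} (hf : AnalyticAt ℂ f c) :
    AnalyticAt ℂ (fun w => conj (f (conj w))) (conj c) := by
  rw [Complex.analyticAt_iff_eventually_differentiableAt] at hf ⊢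
  have ht : Tendsto (fun w : ℂ => conj w) (𝓝 (conj c)) (𝓝 c) := by
    have := (Complex.continuous_conj.continuousAt (x := conj c)).tendsto
    rwa [Complex.conj_conj] at this
  filter_upwards [ht.eventually hf] with w hw
  have := hw.conj_conj
  rw [Complex.conj_conj] at this
  exact this

lemma analyticAt_bra (hanalytic : ∀ i c, AnalyticAt ℂ (fun z => D.v0 i z c) (D.zeta i))
    (x t : ℝ) (i : Fin D.r) (c : Fin 2) :
    AnalyticAt ℂ (fun w => D.bra x t i w c) (conj (D.zeta i)) := by
  rw [bra_apply]
  exact analyticAt_conj_conj (analyticAt_ket hanalytic x t i c)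

lemma taylorCoeff_bra (x t : ℝ) (i : Fin D.r) (c : Fin 2) (a : ℕ) :
    taylorCoeff a (fun w => D.bra x t i w c) (conj (D.zeta i)) = conj (D.ketCoeff x t i c a) := by
  rw [bra_apply, taylorCoeff_conj (fun z => D.ket x t i z c)]
  rfl

lemma analyticAt_cauchy {z c : ℂ} (hz : z ≠ c) (hz' : z ≠ -c) (ε : ℂ) :
    AnalyticAt ℂ (fun w => (z - w)⁻¹ - ε * (z + w)⁻¹) c := by
  have h1 : z - c ≠ 0 := sub_ne_zero.2 hz
  have h2 : z + c ≠ 0 := fun h => hz' (eq_neg_of_add_eq_zero_left h)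
  fun_prop (disch := assumption)

/-- By Leibniz, a symmetrized polar part is a Taylor coefficient in w of ⟨v| times the
parity-adapted Cauchy kernel. In this form it can be compared with the entries of M̃, τ̃ and ψ̃. -/
lemma taylorCoeff_bra_mul_cauchy
    (hanalytic : ∀ i c, AnalyticAt ℂ (fun z => D.v0 i z c) (D.zeta i))
    (x t : ℝ) (s : D.Index) (c : Fin 2) {z : ℂ} (hz : z ≠ conj (D.zeta s.1))
    (hz' : z ≠ -conj (D.zeta s.1)) :
    taylorCoeff s.2 (fun w => D.bra x t s.1 w c * ((z - w)⁻¹ - sgn c * (z + w)⁻¹))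
      (conj (D.zeta s.1)) = D.poleFun x t s c z := by
  have h1 : z - conj (D.zeta s.1) ≠ 0 := sub_ne_zero.2 hz
  have h2 : z + conj (D.zeta s.1) ≠ 0 := fun h => hz' (eq_neg_of_add_eq_zero_left h)
  rw [taylorCoeff_mul (analyticAt_bra hanalytic x t s.1 c) (analyticAt_cauchy hz hz' _)]
  refine Finset.sum_congr rfl fun a _ => ?_
  have a1 : AnalyticAt ℂ (fun w => (z - w)⁻¹) (conj (D.zeta s.1)) := by
    fun_prop (disch := assumption)
  have a2 : AnalyticAt ℂ (fun w => (z + w)⁻¹) (conj (D.zeta s.1)) := by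
    fun_prop (disch := assumption)
  have a3 : AnalyticAt ℂ (fun w => sgn c * (z + w)⁻¹) (conj (D.zeta s.1)) :=
    analyticAt_const.mul a2
  rw [taylorCoeff_bra, taylorCoeff_sub a1 a3, taylorCoeff_const_mul,
    taylorCoeff_inv_sub, taylorCoeff_inv_add]

/-- Componentwise the kernel equals −Σ_c ⟨v|_c |v⟩_c (1/(z − w) ∓ 1/(z + w)), with upper sign for
the first component. The entries of M̃ therefore measure how the polar parts act on |v_i⟩, with a
minus sign. -/
lemma taylorCoeff_kernel (hanalytic : ∀ i c, AnalyticAt ℂ (fun z => D.v0 i z c) (D.zeta i))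
    (x t : ℝ) (i : Fin D.r) (s : D.Index) {z : ℂ} (hz : z ≠ conj (D.zeta s.1))
    (hz' : z ≠ -conj (D.zeta s.1)) :
    taylorCoeff s.2 (fun w => D.kernel x t i s.1 z w) (conj (D.zeta s.1))
      = -∑ c, D.poleFun x t s c z * D.ket x t i z c := by
  have e : (fun w => D.kernel x t i s.1 z w) = fun w =>
      (-D.ket x t i z 0) * (D.bra x t s.1 w 0 * ((z - w)⁻¹ - sgn 0 * (z + w)⁻¹))
        + (-D.ket x t i z 1) * (D.bra x t s.1 w 1 * ((z - w)⁻¹ - sgn 1 * (z + w)⁻¹)) := by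
    funext w
    simp [kernel, sigma3, sgn, dotProduct, Matrix.mulVec, Fin.sum_univ_two, div_eq_mul_inv]
    ring
  have a : ∀ c, AnalyticAt ℂ (fun w => (-D.ket x t i z c) *
      (D.bra x t s.1 w c * ((z - w)⁻¹ - sgn c * (z + w)⁻¹))) (conj (D.zeta s.1)) := fun c =>
    analyticAt_const.mul ((analyticAt_bra hanalytic x t s.1 c).mul (analyticAt_cauchy hz hz' _))
  rw [e, taylorCoeff_add (a 0) (a 1), taylorCoeff_const_mul, taylorCoeff_const_mul,
    taylorCoeff_bra_mul_cauchy hanalytic x t s 0 hz hz',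
    taylorCoeff_bra_mul_cauchy hanalytic x t s 1 hz hz', Fin.sum_univ_two]
  ring

lemma ne_conj_of_mem_C13 {z w : ℂ} (hz : z ∈ C13) (hw : w ∈ C13) : z ≠ conj w :=
  fun h => sq_ne_conj_sq hz hw (by rw [h])

lemma ne_neg_conj_of_mem_C13 {z w : ℂ} (hz : z ∈ C13) (hw : w ∈ C13) : z ≠ -conj w :=
  fun h => sq_ne_conj_sq hz hw (by rw [h, neg_sq])

lemma analyticAt_poleFun (x t : ℝ) (s : D.Index) (c : Fin 2) {z : ℂ}
    (hz : z ≠ conj (D.zeta s.1)) (hz' : z ≠ -conj (D.zeta s.1)) :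
    AnalyticAt ℂ (D.poleFun x t s c) z := by
  have h1 : z - conj (D.zeta s.1) ≠ 0 := sub_ne_zero.2 hz
  have h2 : z + conj (D.zeta s.1) ≠ 0 := fun h => hz' (eq_neg_of_add_eq_zero_left h)
  unfold poleFun
  refine Finset.analyticAt_fun_sum _ fun a _ => analyticAt_const.mul ?_
  refine AnalyticAt.sub ?_ (analyticAt_const.mul (analyticAt_const.mul ?_))
  · exact AnalyticAt.inv (by fun_prop) (pow_ne_zero _ h1)
  · exact AnalyticAt.inv (by fun_prop) (pow_ne_zero _ h2)

lemma eventually_taylorCoeff_kernel (hζ : ∀ i, D.zeta i ∈ C13)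
    (hanalytic : ∀ i c, AnalyticAt ℂ (fun z => D.v0 i z c) (D.zeta i))
    (x t : ℝ) (i : Fin D.r) (s : D.Index) :
    (fun z => taylorCoeff s.2 (fun w => D.kernel x t i s.1 z w) (conj (D.zeta s.1)))
      =ᶠ[𝓝 (D.zeta i)] fun z => -∑ c, D.poleFun x t s c z * D.ket x t i z c := by
  filter_upwards [continuousAt_id.eventually_ne (ne_conj_of_mem_C13 (hζ i) (hζ s.1)),
    continuousAt_id.eventually_ne (ne_neg_conj_of_mem_C13 (hζ i) (hζ s.1))] with z h1 h2
  exact taylorCoeff_kernel hanalytic x t i s h1 h2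

lemma analyticAt_poleFun_mul_ket (hζ : ∀ i, D.zeta i ∈ C13)
    (hanalytic : ∀ i c, AnalyticAt ℂ (fun z => D.v0 i z c) (D.zeta i))
    (x t : ℝ) (i : Fin D.r) (s : D.Index) :
    AnalyticAt ℂ (fun z => ∑ c, D.poleFun x t s c z * D.ket x t i z c) (D.zeta i) :=
  Finset.analyticAt_fun_sum _ fun c _ => (analyticAt_poleFun x t s c
    (ne_conj_of_mem_C13 (hζ i) (hζ s.1)) (ne_neg_conj_of_mem_C13 (hζ i) (hζ s.1))).mul
    (analyticAt_ket hanalytic x t i c)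

lemma matM_apply_eq (hζ : ∀ i, D.zeta i ∈ C13)
    (hanalytic : ∀ i c, AnalyticAt ℂ (fun z => D.v0 i z c) (D.zeta i))
    (x t : ℝ) (p s : D.Index) : D.matM x t p s
      = -taylorCoeff p.2 (fun z => ∑ c, D.poleFun x t s c z * D.ket x t p.1 z c) (D.zeta p.1) := by
  rw [matM, Matrix.of_apply,
    taylorCoeff_congr (eventually_taylorCoeff_kernel hζ hanalytic x t p.1 s)]
  have := taylorCoeff_const_mul (f := fun z => ∑ c, D.poleFun x t s c z * D.ket x t p.1 z c)
    (c := D.zeta p.1) (-1) p.2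
  simpa using this

lemma vanishesAt_sub_jet (hanalytic : ∀ i c, AnalyticAt ℂ (fun z => D.v0 i z c) (D.zeta i))
    (x t : ℝ) (i : Fin D.r) (c : Fin 2) :
    VanishesAt (D.mult i) (fun z => D.ket x t i z c - (D.jet x t i c).eval z) (D.zeta i) := by
  refine (vanishesAt_sub_taylor (analyticAt_ket hanalytic x t i c) (D.mult i)).congr
    (Eventually.of_forall fun z => ?_)
  simp [jet, eval_finsetSum, ketCoeff]

/-- The vector |v_i⟩ and its Taylor polynomial of length n_i differ by a term of order n_i, so the
analytic condition and the polynomial one agree. -/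
lemma vanishesAt_row_iff (hanalytic : ∀ i c, AnalyticAt ℂ (fun z => D.v0 i z c) (D.zeta i))
    (x t : ℝ) (i : Fin D.r) (p : Fin 2 → ℂ[X]) :
    VanishesAt (D.mult i) (fun z => (p 0).eval z * D.ket x t i z 0
      + (p 1).eval z * D.ket x t i z 1) (D.zeta i) ↔
    (X - C (D.zeta i)) ^ D.mult i ∣ p 0 * D.jet x t i 0 + p 1 * D.jet x t i 1 := by
  have hp : ∀ c, AnalyticAt ℂ (fun z => (p c).eval z) (D.zeta i) := fun c =>
    AnalyticAt.aeval_polynomial analyticAt_id _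
  have h := ((vanishesAt_sub_jet hanalytic x t i 0).mul_left (hp 0)).add
    ((vanishesAt_sub_jet hanalytic x t i 1).mul_left (hp 1))
  constructor
  · intro h1
    refine VanishesAt.dvd ((h1.sub h).congr (Eventually.of_forall fun z => ?_))
    simp
    ring
  · intro h1
    refine ((VanishesAt.of_dvd h1).add h).congr (Eventually.of_forall fun z => ?_)
    simp
    ring

lemma eventually_ne_poles (hζ : ∀ i, D.zeta i ∈ C13) (i : Fin D.r) :
    ∀ᶠ z in 𝓝 (D.zeta i), ∀ j, z ≠ conj (D.zeta j) ∧ z ≠ -conj (D.zeta j) :=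
  eventually_all.2 fun j =>
    (continuousAt_id.eventually_ne (ne_conj_of_mem_C13 (hζ i) (hζ j))).and
      (continuousAt_id.eventually_ne (ne_neg_conj_of_mem_C13 (hζ i) (hζ j)))

lemma eval_rowPoly (x t : ℝ) (c₀ : ℂ) (y : D.Index → ℂ) (c : Fin 2) {z : ℂ}
    (hz : ∀ j, z ≠ conj (D.zeta j) ∧ z ≠ -conj (D.zeta j)) :
    (D.rowPoly x t c₀ y c).eval z = D.poleDen.eval z *
      ((if c = 0 then c₀ else 0) + ∑ s, y s * D.poleFun x t s c z) := by
  rw [rowPoly, eval_add, eval_mul, eval_C, eval_finsetSum, mul_add, mul_comm, Finset.mul_sum]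
  congr 1
  refine Finset.sum_congr rfl fun s _ => ?_
  rw [eval_mul, eval_C, eval_rowTerm x t s c (hz s.1).1 (hz s.1).2]
  ring

/-- The Taylor coefficients of (c₀e₁ + Σ y_s·polar part)·|v_i⟩ below order n_i are the entries of
c₀χ̃ − M̃y, all zero by assumption; multiplying by `poleDen` keeps the order of vanishing. -/
lemma rowPoly_zeros (hζ : ∀ i, D.zeta i ∈ C13)
    (hanalytic : ∀ i c, AnalyticAt ℂ (fun z => D.v0 i z c) (D.zeta i))
    (x t : ℝ) {c₀ : ℂ} {y : D.Index → ℂ} (hy : D.matM x t *ᵥ y = c₀ • D.chi x t) (i : Fin D.r) :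
    (X - C (D.zeta i)) ^ D.mult i ∣
      D.rowPoly x t c₀ y 0 * D.jet x t i 0 + D.rowPoly x t c₀ y 1 * D.jet x t i 1 := by
  rw [← vanishesAt_row_iff hanalytic]
  have hs := fun s => analyticAt_poleFun_mul_ket hζ hanalytic x t i s
  have hk := analyticAt_ket hanalytic x t i 0
  have hys : ∀ s, AnalyticAt ℂ (fun z => y s * ∑ c, D.poleFun x t s c z * D.ket x t i z c)
      (D.zeta i) := fun s => analyticAt_const.mul (hs s)
  have hsum : AnalyticAt ℂ (fun z => ∑ s, y s * ∑ c, D.poleFun x t s c z * D.ket x t i z c)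
      (D.zeta i) := Finset.analyticAt_fun_sum _ fun s _ => hys s
  have hR : VanishesAt (D.mult i) (fun z => c₀ * D.ket x t i z 0
      + ∑ s, y s * ∑ c, D.poleFun x t s c z * D.ket x t i z c) (D.zeta i) := by
    have hck : AnalyticAt ℂ (fun z => c₀ * D.ket x t i z 0) (D.zeta i) := analyticAt_const.mul hk
    have hf : AnalyticAt ℂ (fun z => c₀ * D.ket x t i z 0
      + ∑ s, y s * ∑ c, D.poleFun x t s c z * D.ket x t i z c) (D.zeta i) := hck.add hsum
    refine vanishesAt_of_taylorCoeff hf _ fun a ha => ?_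
    rw [taylorCoeff_add hck hsum, taylorCoeff_const_mul,
      taylorCoeff_sum fun s _ => hys s]
    simp only [taylorCoeff_const_mul]
    have h := congrFun hy ⟨i, ⟨a, ha⟩⟩
    simp only [Matrix.mulVec, dotProduct, matM_apply_eq hζ hanalytic, Pi.smul_apply, smul_eq_mul,
      chi] at h
    rw [← h, ← Finset.sum_add_distrib]
    exact Finset.sum_eq_zero fun s _ => by ring
  refine (hR.mul_left (AnalyticAt.aeval_polynomial analyticAt_id D.poleDen)).congr ?_
  filter_upwards [eventually_ne_poles hζ i] with z hz
  rw [eval_rowPoly x t c₀ y 0 hz, eval_rowPoly x t c₀ y 1 hz]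
  have e : ∑ s, y s * ∑ c, D.poleFun x t s c z * D.ket x t i z c
      = (∑ s, y s * D.poleFun x t s 0 z) * D.ket x t i z 0
        + (∑ s, y s * D.poleFun x t s 1 z) * D.ket x t i z 1 := by
    rw [Finset.sum_mul, Finset.sum_mul, ← Finset.sum_add_distrib]
    refine Finset.sum_congr rfl fun s _ => ?_
    rw [Fin.sum_univ_two]
    ring
  rw [e]
  simp
  ring

end SolitonData
end KaupNewell
end

/-! ### Polar conditions, degrees, and recovery of the weights -/

noncomputable section

namespace KaupNewell

open Polynomial

namespace SolitonData

variable {D : SolitonData}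

lemma comp_neg_X_comp_neg_X (p : ℂ[X]) : (p.comp (-X)).comp (-X) = p := by
  rw [comp_assoc]
  simp

lemma rowPoly_comp (x t : ℝ) (c₀ : ℂ) (y : D.Index → ℂ) (c : Fin 2) :
    (D.rowPoly x t c₀ y c).comp (-X) = C (sgn c) * D.rowPoly x t c₀ y c := by
  have h2 : ∀ s, (D.rowTerm x t s c).comp (-X) = C (sgn c) * D.rowTerm x t s c := by
    intro s
    rw [rowTerm, add_comp, mul_comp, comp_neg_X_comp_neg_X, C_comp]
    fin_cases c
    · simp [sgn]; ring
    · simp [sgn]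
  rw [rowPoly, add_comp, mul_comp, poleDen_comp, C_comp, mul_add, Finset.mul_sum]
  congr 1
  · fin_cases c <;> simp [sgn]
  · rw [← Polynomial.coe_compRingHom_apply, map_sum]
    refine Finset.sum_congr rfl fun s _ => ?_
    rw [Polynomial.coe_compRingHom_apply, mul_comp, C_comp, h2]
    ring

/-- The truncation in `poleNum` agrees with the conjugate jet to the order needed. -/
lemma poleDen_dvd_poleNum_sub (x t : ℝ) (s : D.Index) (c : Fin 2) :
    D.poleDen ∣ D.poleNum x t s c - D.cofactor s.1 s.2 * conjPoly (D.jet x t s.1 c) := by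
  rw [poleNum, ← mul_sub, ← X_sub_C_pow_mul_cofactor s, mul_comm]
  refine mul_dvd_mul_left _ ?_
  have hl : (s.2 : ℕ) + 1 ≤ D.mult s.1 := s.2.2
  simp only [jet, map_sum, map_mul, conjPoly_C, map_pow, map_sub, conjPoly_X]
  -- The omitted terms of the jet have degree at least l + 1 in z − ζ^*, exactly the power missing
  -- from the cofactor.
  rw [← Finset.sum_range_add_sum_Ico _ hl, sub_add_cancel_left, dvd_neg]
  refine Finset.dvd_sum fun a ha => Dvd.dvd.mul_left (pow_dvd_pow _ (Finset.mem_Ico.1 ha).1) _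

lemma X_sub_C_pow_dvd_cofactor {i : Fin D.r} {s : D.Index}
    (h : conj (D.zeta i) ≠ conj (D.zeta s.1)) :
    (X - C (conj (D.zeta i))) ^ D.mult i ∣ D.cofactor s.1 s.2 := by
  refine (isCoprime_X_sub_C_pow h _ ((s.2 : ℕ) + 1)).dvd_of_dvd_mul_left ?_
  rw [X_sub_C_pow_mul_cofactor]
  exact X_sub_C_pow_dvd_poleDen i

lemma X_sub_C_pow_dvd_cofactor_comp {i : Fin D.r} {s : D.Index}
    (h : conj (D.zeta i) ≠ -conj (D.zeta s.1)) :
    (X - C (conj (D.zeta i))) ^ D.mult i ∣ (D.cofactor s.1 s.2).comp (-X) := by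
  refine (isCoprime_X_sub_C_pow h _ ((s.2 : ℕ) + 1)).dvd_of_dvd_mul_left ?_
  have h1 := congrArg (fun p : ℂ[X] => p.comp (-X)) (X_sub_C_pow_mul_cofactor s)
  simp only [mul_comp, pow_comp, sub_comp, X_comp, C_comp, poleDen_comp] at h1
  have h2 : (X - C (-conj (D.zeta s.1))) ^ ((s.2 : ℕ) + 1) * (D.cofactor s.1 s.2).comp (-X)
      = (-1) ^ ((s.2 : ℕ) + 1) * D.poleDen := by
    rw [← h1, ← mul_assoc, ← mul_pow, C_neg]
    congr 2
    ring
  rw [h2]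
  exact (X_sub_C_pow_dvd_poleDen i).mul_left _

lemma conj_ne_neg_conj (hζ : ∀ i, D.zeta i ∈ C13)
    (hsq : ∀ i j, i ≠ j → D.zeta i ^ 2 ≠ D.zeta j ^ 2) (i j : Fin D.r) :
    conj (D.zeta i) ≠ -conj (D.zeta j) := by
  intro h
  by_cases hij : i = j
  · rw [hij] at h
    have h0 : conj (D.zeta j) = 0 := by linear_combination h / 2
    exact ne_zero_of_mem_C13 (hζ j) (by simpa using h0)
  · refine hsq i j hij (star_injective ?_)
    have := congrArg (· ^ 2) h
    simpa using this

/-- The half with poles at −ζ_s^* is regular at ζ_i^*, so after clearing denominators it carries the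
full power there, and so does the other half when i differs from the label's zero. In the remaining
case both components are, to the needed order, one cofactor times the components of v_i^*, and the
cross product cancels. -/
lemma rowTerm_poles (hζ : ∀ i, D.zeta i ∈ C13)
    (hsq : ∀ i j, i ≠ j → D.zeta i ^ 2 ≠ D.zeta j ^ 2) (x t : ℝ) (s : D.Index) (i : Fin D.r) :
    (X - C (conj (D.zeta i))) ^ D.mult i ∣
      D.rowTerm x t s 0 * conjPoly (D.jet x t i 1) - D.rowTerm x t s 1 * conjPoly (D.jet x t i 0) := by
  have hneg := conj_ne_neg_conj hζ hsq i s.1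
  have hcomp : ∀ c, (X - C (conj (D.zeta i))) ^ D.mult i ∣
      C (sgn c) * (D.poleNum x t s c).comp (-X) := by
    intro c
    rw [poleNum, mul_comp]
    exact ((X_sub_C_pow_dvd_cofactor_comp hneg).mul_right _).mul_left _
  have main : (X - C (conj (D.zeta i))) ^ D.mult i ∣
      D.poleNum x t s 0 * conjPoly (D.jet x t i 1)
        - D.poleNum x t s 1 * conjPoly (D.jet x t i 0) := by
    by_cases his : i = s.1
    · subst his
      have h0 := (X_sub_C_pow_dvd_poleDen s.1).trans (poleDen_dvd_poleNum_sub x t s 0)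
      have h1 := (X_sub_C_pow_dvd_poleDen s.1).trans (poleDen_dvd_poleNum_sub x t s 1)
      have := (h0.mul_right (conjPoly (D.jet x t s.1 1))).sub
        (h1.mul_right (conjPoly (D.jet x t s.1 0)))
      convert this using 1
      ring
    · have hne : conj (D.zeta i) ≠ conj (D.zeta s.1) := by
        intro h
        exact hsq i s.1 his (by rw [star_injective h])
      have h : ∀ c, (X - C (conj (D.zeta i))) ^ D.mult i ∣ D.poleNum x t s c :=
        fun c => (X_sub_C_pow_dvd_cofactor hne).mul_right _
      exact ((h 0).mul_right _).sub ((h 1).mul_right _)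
  have := (main.add ((hcomp 0).mul_right (conjPoly (D.jet x t i 1)))).sub
    ((hcomp 1).mul_right (conjPoly (D.jet x t i 0)))
  convert this using 1
  simp only [rowTerm]
  ring

/-- Parity and the polar conditions hold by construction for every y; only the conditions at the ζ_i
use the linear system. -/
lemma isRow_rowPoly (hζ : ∀ i, D.zeta i ∈ C13)
    (hsq : ∀ i j, i ≠ j → D.zeta i ^ 2 ≠ D.zeta j ^ 2)
    (hanalytic : ∀ i c, AnalyticAt ℂ (fun z => D.v0 i z c) (D.zeta i))
    (x t : ℝ) {c₀ : ℂ} {y : D.Index → ℂ} (hy : D.matM x t *ᵥ y = c₀ • D.chi x t) :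
    D.IsRow (D.jet x t) (D.rowPoly x t c₀ y) where
  even := by rw [rowPoly_comp]; simp [sgn]
  odd := by rw [rowPoly_comp]; simp [sgn]
  zeros := rowPoly_zeros hζ hanalytic x t hy
  poles i := by
    have h : (X - C (conj (D.zeta i))) ^ D.mult i ∣ ∑ s, C (y s) *
        (D.rowTerm x t s 0 * conjPoly (D.jet x t i 1)
          - D.rowTerm x t s 1 * conjPoly (D.jet x t i 0)) :=
      Finset.dvd_sum fun s _ => (rowTerm_poles hζ hsq x t s i).mul_left _
    have h' := (X_sub_C_pow_dvd_poleDen i).mul_right (C c₀ * conjPoly (D.jet x t i 1))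
    have := h'.add h
    convert this using 1
    simp only [rowPoly, if_true, one_ne_zero, if_false, C_0, zero_mul, zero_add, add_mul,
      Finset.sum_mul, mul_sub, Finset.sum_sub_distrib]
    simp only [← mul_assoc]
    ring

/-! ### Degrees -/

lemma natDegree_cofactor (s : D.Index) :
    (D.cofactor s.1 s.2).natDegree + (s.2 + 1) = D.poleDen.natDegree := by
  have h := X_sub_C_pow_mul_cofactor s
  have hm : ((X - C (conj (D.zeta s.1))) ^ ((s.2 : ℕ) + 1)).Monic := (monic_X_sub_C _).pow _
  have hne : D.cofactor s.1 s.2 ≠ 0 := by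
    intro h0
    rw [h0, mul_zero] at h
    exact D.monic_poleDen.ne_zero h.symm
  rw [← h, hm.natDegree_mul' hne, natDegree_pow, natDegree_X_sub_C]
  ring

lemma natDegree_poleNum_lt (x t : ℝ) (s : D.Index) (c : Fin 2) :
    (D.poleNum x t s c).natDegree < D.poleDen.natDegree := by
  have h := natDegree_cofactor s
  have h2 : (∑ a ∈ Finset.range ((s.2 : ℕ) + 1),
      C (conj (D.ketCoeff x t s.1 c a)) * (X - C (conj (D.zeta s.1))) ^ a).natDegree ≤ (s.2 : ℕ) := by
    refine natDegree_sum_le_of_forall_le _ _ fun a ha => ?_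
    refine (natDegree_C_mul_le _ _).trans ?_
    rw [natDegree_pow, natDegree_X_sub_C]
    have := Finset.mem_range.1 ha
    omega
  have h3 := natDegree_mul_le (p := D.cofactor s.1 s.2) (q := ∑ a ∈ Finset.range ((s.2 : ℕ) + 1),
      C (conj (D.ketCoeff x t s.1 c a)) * (X - C (conj (D.zeta s.1))) ^ a)
  rw [← poleNum] at h3
  omega

lemma natDegree_rowTerm_lt (x t : ℝ) (s : D.Index) (c : Fin 2) :
    (D.rowTerm x t s c).natDegree < D.poleDen.natDegree := by
  have h := natDegree_poleNum_lt x t s c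
  refine (natDegree_add_le _ _).trans_lt (max_lt h ?_)
  refine (natDegree_C_mul_le _ _).trans_lt ?_
  rw [natDegree_comp]
  simpa using h

/-- Polar parts vanish at infinity, so the top coefficients see only the constant row (c₀, 0). -/
lemma coeff_rowPoly (x t : ℝ) (c₀ : ℂ) (y : D.Index → ℂ) (c : Fin 2) {n : ℕ}
    (hn : D.poleDen.natDegree ≤ n) : (D.rowPoly x t c₀ y c).coeff n
      = if n = D.poleDen.natDegree ∧ c = 0 then c₀ else 0 := by
  rw [rowPoly, coeff_add, coeff_C_mul, finsetSum_coeff, Finset.sum_eq_zero, add_zero]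
  · by_cases h : n = D.poleDen.natDegree
    · subst h
      simp [D.monic_poleDen.coeff_natDegree]
    · rw [coeff_eq_zero_of_natDegree_lt (lt_of_le_of_ne hn (Ne.symm h))]
      simp [h]
  · intro s _
    rw [coeff_C_mul, coeff_eq_zero_of_natDegree_lt ((natDegree_rowTerm_lt x t s c).trans_le hn),
      mul_zero]

lemma natDegree_rowPoly_le (x t : ℝ) (c₀ : ℂ) (y : D.Index → ℂ) (c : Fin 2) :
    (D.rowPoly x t c₀ y c).natDegree ≤ D.poleDen.natDegree := by
  rw [natDegree_le_iff_coeff_eq_zero]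
  intro n hn
  rw [coeff_rowPoly x t c₀ y c hn.le, if_neg (fun h => hn.ne' h.1)]

/-! ### Rows are determined by their polar parts -/

/-- The constant term of the jet is |v_i⟩(ζ_i). A zero of multiplicity 0 has an empty jet and must
be excluded. -/
lemma exists_eval_jet_ne_zero (hne : ∀ i, D.v0 i (D.zeta i) ≠ 0) (x t : ℝ) (i : Fin D.r)
    (hm : D.mult i ≠ 0) : ∃ c, (D.jet x t i c).eval (D.zeta i) ≠ 0 := by
  by_contra! h
  refine ket_ne_zero hne x t i ?_
  ext c
  have := h c
  rw [jet, eval_finsetSum, Finset.sum_eq_single_of_mem 0 (by simpa using Nat.pos_of_ne_zero hm)] at this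
  · simpa [ketCoeff, taylorCoeff] using this
  · intro a _ ha
    simp [ha]

lemma exists_poleDen_eq (hζ : ∀ i, D.zeta i ∈ C13)
    (hsq : ∀ i j, i ≠ j → D.zeta i ^ 2 ≠ D.zeta j ^ 2) (i : Fin D.r) :
    ∃ Q : ℂ[X], D.poleDen = (X - C (conj (D.zeta i))) ^ D.mult i * Q ∧
      Q.eval (conj (D.zeta i)) ≠ 0 := by
  have h0 : conj (D.zeta i) ≠ 0 := by simpa using ne_zero_of_mem_C13 (hζ i)
  refine ⟨(X + C (conj (D.zeta i))) ^ D.mult i *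
    ∏ k ∈ Finset.univ.erase i, (X ^ 2 - C (conj (D.zeta k) ^ 2)) ^ D.mult k, ?_, ?_⟩
  · rw [poleDen, ← Finset.mul_prod_erase _ _ (Finset.mem_univ i), ← mul_assoc, ← mul_pow, C_pow]
    congr 2
    ring
  · rw [eval_mul, eval_prod]
    refine mul_ne_zero ?_ (Finset.prod_ne_zero_iff.2 fun k hk => ?_)
    · simp only [eval_pow, eval_add, eval_X, eval_C]
      exact pow_ne_zero _ (by rw [← two_mul]; exact mul_ne_zero two_ne_zero h0)
    · simp only [eval_pow, eval_sub, eval_X, eval_C]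
      refine pow_ne_zero _ (sub_ne_zero.2 fun h => hsq i k (Finset.ne_of_mem_erase hk).symm ?_)
      rw [← map_pow, ← map_pow] at h
      exact star_injective h

/-- The leading vector of each polar part is a nonzero multiple of v_i^*(ζ_i^*), so pole orders
separate the weights and no cancellation among distinct labels is possible. -/
lemma eq_zero_of_rowPoly_eq_zero (hζ : ∀ i, D.zeta i ∈ C13)
    (hsq : ∀ i j, i ≠ j → D.zeta i ^ 2 ≠ D.zeta j ^ 2) (hne : ∀ i, D.v0 i (D.zeta i) ≠ 0)
    (x t : ℝ) {y : D.Index → ℂ} (h : ∀ c, D.rowPoly x t 0 y c = 0) : y = 0 := by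
  by_contra hy
  obtain ⟨⟨i, l₁⟩, hl₁⟩ := Function.ne_iff.1 hy
  have hm : D.mult i ≠ 0 := fun h0 => by have := l₁.2; omega
  obtain ⟨c, hc⟩ := exists_eval_jet_ne_zero hne x t i hm
  have hc' : (conjPoly (D.jet x t i c)).eval (conj (D.zeta i)) ≠ 0 := by
    rw [eval_conjPoly, Complex.conj_conj]
    simpa using hc
  set u : ℂ := conj (D.zeta i) with hu
  -- Modulo (X − u)^{n_i} only the labels at the zero ζ_i survive, each with the full conjugate jet
  -- in place of its truncation.
  have h1 : (X - C u) ^ D.mult i ∣ ∑ s : D.Index, C (y s) *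
      (if s.1 = i then D.cofactor s.1 s.2 * conjPoly (D.jet x t i c) else 0) := by
    have h2 : (X - C u) ^ D.mult i ∣ ∑ s : D.Index, C (y s) * (D.rowTerm x t s c -
        (if s.1 = i then D.cofactor s.1 s.2 * conjPoly (D.jet x t i c) else 0)) := by
      refine Finset.dvd_sum fun s _ => Dvd.dvd.mul_left ?_ _
      rw [rowTerm, add_sub_right_comm]
      refine dvd_add ?_ ?_
      · split_ifs with his
        · subst his
          exact (X_sub_C_pow_dvd_poleDen s.1).trans (poleDen_dvd_poleNum_sub x t s c)
        · rw [sub_zero]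
          refine (X_sub_C_pow_dvd_cofactor ?_).mul_right _
          intro h'
          exact hsq i s.1 (Ne.symm his) (by rw [star_injective h'])
      · rw [poleNum, mul_comp]
        exact ((X_sub_C_pow_dvd_cofactor_comp (conj_ne_neg_conj hζ hsq i s.1)).mul_right _).mul_left _
    have h3 := h c
    rw [rowPoly, ite_self, C_0, zero_mul, zero_add] at h3
    simp only [mul_sub, Finset.sum_sub_distrib, h3, zero_sub, dvd_neg] at h2
    exact h2
  have h4 : (X - C u) ^ D.mult i ∣ ∑ l : Fin (D.mult i), C (y ⟨i, l⟩) * D.cofactor i l := by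
    refine X_sub_C_pow_dvd_of_mul hc' ?_
    rw [Finset.mul_sum]
    rw [Fintype.sum_sigma, Finset.sum_eq_single i] at h1
    · convert h1 using 2 with l
      rw [if_pos rfl]
      ring
    · intro j _ hj
      exact Finset.sum_eq_zero fun l _ => by rw [if_neg hj, mul_zero]
    · intro hi
      exact absurd (Finset.mem_univ i) hi
  obtain ⟨Q, hQ, hQ0⟩ := exists_poleDen_eq hζ hsq i
  have hmon : ((X - C u) ^ D.mult i).Monic := (monic_X_sub_C _).pow _
  -- Each remaining cofactor equals (X − u)^{n−1−l} times the same Q with Q(u) ≠ 0. Since cofactors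
  -- are known only through their product with (X − u)^{l+1}, the comparison is made after
  -- multiplication by (X − u)^n.
  have h5 : (X - C u) ^ D.mult i ∣
      ∑ l : Fin (D.mult i), C (y ⟨i, l⟩) * (X - C u) ^ (D.mult i - 1 - l) := by
    refine X_sub_C_pow_dvd_of_mul hQ0 ?_
    rw [← mul_dvd_mul_iff_left hmon.ne_zero, ← mul_assoc, ← hQ]
    convert mul_dvd_mul_left ((X - C u) ^ D.mult i) h4 using 1
    rw [Finset.mul_sum, Finset.mul_sum]
    refine Finset.sum_congr rfl fun l _ => ?_
    have h6 := X_sub_C_pow_mul_cofactor (D := D) ⟨i, l⟩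
    simp only at h6
    have h7 : (X - C u) ^ D.mult i = (X - C u) ^ (D.mult i - 1 - l) * (X - C u) ^ ((l : ℕ) + 1) := by
      rw [← pow_add]
      congr 1
      have := l.2
      omega
    rw [← h6, ← hu]
    rw [h7]
    ring
  have h8 := eq_zero_of_dvd_of_degree_lt h5 (by
    refine (degree_sum_le _ _).trans_lt ?_
    rw [Finset.sup_lt_iff]
    · intro l _
      rw [degree_pow, degree_X_sub_C]
      refine ((degree_mul_le _ _).trans (add_le_add degree_C_le le_rfl)).trans_lt ?_
      rw [degree_pow, degree_X_sub_C]
      simp only [nsmul_eq_mul, mul_one, zero_add]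
      have := l.2
      exact_mod_cast (by omega : D.mult i - 1 - l < D.mult i)
    · rw [degree_pow, degree_X_sub_C]
      exact bot_lt_iff_ne_bot.2 (by simp))
  -- The sum has degree below n and so vanishes. After the shift by u the exponents n − 1 − l are
  -- distinct, and one coefficient isolates y at l₁.
  have h9 := congrArg (fun p : ℂ[X] => (p.comp (X + C u)).coeff (D.mult i - 1 - l₁)) h8
  simp only [zero_comp, coeff_zero] at h9
  rw [← Polynomial.coe_compRingHom_apply, map_sum, finsetSum_coeff,
    Finset.sum_eq_single l₁] at h9
  · simp at h9
    exact hl₁ h9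
  · intro l _ hl
    simp only [Polynomial.coe_compRingHom_apply, mul_comp, C_comp, pow_comp, sub_comp, X_comp,
      add_sub_cancel_right, coeff_C_mul_X_pow]
    rw [if_neg]
    intro h'
    apply hl
    ext
    have h1 := l.2
    have h2 := l₁.2
    omega
  · intro h'
    exact absurd (Finset.mem_univ _) h'

end SolitonData
end KaupNewell
end

/-! ### Nonvanishing determinants and the determinant formula -/

noncomputable section

namespace KaupNewell

open Polynomial

namespace SolitonData

variable {D : SolitonData}

/-- The product is divisible by `fullDen` and has at most the same degree, so it is a constant
multiple; the top coefficient comes from c₀ alone. -/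
lemma rowPoly_inner (hζ : ∀ i, D.zeta i ∈ C13)
    (hsq : ∀ i j, i ≠ j → D.zeta i ^ 2 ≠ D.zeta j ^ 2)
    (hanalytic : ∀ i c, AnalyticAt ℂ (fun z => D.v0 i z c) (D.zeta i))
    (hne : ∀ i, D.v0 i (D.zeta i) ≠ 0)
    (x t : ℝ) {c₀ : ℂ} {y : D.Index → ℂ} (hy : D.matM x t *ᵥ y = c₀ • D.chi x t) :
    D.rowPoly x t c₀ y 0 * conjPoly (D.rowPoly x t c₀ y 0)
      + D.rowPoly x t c₀ y 1 * conjPoly (D.rowPoly x t c₀ y 1) = C (c₀ * conj c₀) * D.fullDen := by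
  have hp := isRow_rowPoly hζ hsq hanalytic x t hy
  have hd := hp.fullDen_dvd_inner hζ hsq (exists_eval_jet_ne_zero hne x t) hp
  have hdeg : ∀ c, (D.rowPoly x t c₀ y c).natDegree ≤ D.poleDen.natDegree :=
    natDegree_rowPoly_le x t c₀ y
  have hdeg' : ∀ c, (conjPoly (D.rowPoly x t c₀ y c)).natDegree ≤ D.poleDen.natDegree := by
    intro c
    rw [natDegree_conjPoly]
    exact hdeg c
  have h := eq_C_mul_of_dvd D.monic_fullDen hd (by
    rw [natDegree_fullDen]
    refine (natDegree_add_le _ _).trans (max_le ?_ ?_)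
    · exact natDegree_mul_le.trans (add_le_add (hdeg 0) (hdeg' 0))
    · exact natDegree_mul_le.trans (add_le_add (hdeg 1) (hdeg' 1)))
  rw [h]
  congr 2
  rw [natDegree_fullDen, coeff_add, coeff_mul_add_eq_of_natDegree_le (hdeg 0) (hdeg' 0),
    coeff_mul_add_eq_of_natDegree_le (hdeg 1) (hdeg' 1)]
  simp [coeff_rowPoly]

lemma eq_zero_of_eval_real {p : ℂ[X]} (h : ∀ x : ℝ, p.eval (x : ℂ) = 0) : p = 0 := by
  refine p.eq_zero_of_infinite_isRoot ?_
  refine Set.Infinite.mono ?_ (Set.infinite_range_of_injective Complex.ofReal_injective)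
  rintro _ ⟨x, rfl⟩
  exact h x

/-- A kernel vector y of M̃ gives a row without constant part, for which p₀p₀^* + p₁p₁^* = 0.
Positivity on the real line kills the row, and the row determines y. -/
lemma det_matM_ne_zero (hζ : ∀ i, D.zeta i ∈ C13)
    (hsq : ∀ i j, i ≠ j → D.zeta i ^ 2 ≠ D.zeta j ^ 2)
    (hanalytic : ∀ i c, AnalyticAt ℂ (fun z => D.v0 i z c) (D.zeta i))
    (hne : ∀ i, D.v0 i (D.zeta i) ≠ 0) (x t : ℝ) : (D.matM x t).det ≠ 0 := by
  intro hdet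
  obtain ⟨y, hy0, hy⟩ := Matrix.exists_mulVec_eq_zero_iff.2 hdet
  apply hy0
  have h := rowPoly_inner hζ hsq hanalytic hne x t (c₀ := 0) (y := y) (by rw [hy, zero_smul])
  rw [zero_mul, C_0, zero_mul] at h
  -- On the real axis p^* is the complex conjugate of p, so the identity says that a sum of two
  -- squared absolute values is 0.
  have h0 : ∀ c (r : ℝ), (D.rowPoly x t 0 y c).eval (r : ℂ) = 0 := by
    intro c r
    have h1 := congrArg (eval (r : ℂ)) h
    simp only [eval_add, eval_mul, eval_conjPoly, Complex.conj_ofReal, Complex.mul_conj,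
      eval_zero] at h1
    rw [← Complex.ofReal_add, Complex.ofReal_eq_zero] at h1
    have n0 := Complex.normSq_nonneg ((D.rowPoly x t 0 y 0).eval (r : ℂ))
    have n1 := Complex.normSq_nonneg ((D.rowPoly x t 0 y 1).eval (r : ℂ))
    fin_cases c
    · exact Complex.normSq_eq_zero.1 (le_antisymm (by simp only [Fin.zero_eta]; linarith) n0)
    · exact Complex.normSq_eq_zero.1 (le_antisymm (by simp only [Fin.mk_one]; linarith) n1)
  exact eq_zero_of_rowPoly_eq_zero hζ hsq hne x t fun c => eq_zero_of_eval_real (h0 c)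

/-- The solution of the linear system for the polar parts of the first row. -/
def rowCoeff (D : SolitonData) (x t : ℝ) : D.Index → ℂ := (D.matM x t)⁻¹ *ᵥ D.chi x t

/-- The first row of the solution of the Riemann-Hilbert problem up to normalization. -/
def row (D : SolitonData) (x t : ℝ) : Fin 2 → ℂ[X] := D.rowPoly x t 1 (D.rowCoeff x t)

lemma matM_mulVec_rowCoeff {x t : ℝ} (h : (D.matM x t).det ≠ 0) :
    D.matM x t *ᵥ D.rowCoeff x t = (1 : ℂ) • D.chi x t := by
  rw [rowCoeff, Matrix.mulVec_mulVec, Matrix.mul_nonsing_inv _ h.isUnit, Matrix.one_mulVec,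
    one_smul]

/-- The Schur complement of M̃ in the bordered matrix is the scalar −b·M̃⁻¹χ̃. -/
lemma det_bordered {x t : ℝ} (h : (D.matM x t).det ≠ 0) (b : D.Index → ℂ) :
    (Matrix.fromBlocks (D.matM x t) (Matrix.replicateCol Unit (D.chi x t))
      (Matrix.replicateRow Unit b) 0).det = -((D.matM x t).det * (b ⬝ᵥ D.rowCoeff x t)) := by
  let _ : Invertible (D.matM x t) := Matrix.invertibleOfIsUnitDet _ h.isUnit
  rw [Matrix.det_fromBlocks₁₁, zero_sub, Matrix.invOf_eq_nonsing_inv,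
    Matrix.det_unique (-(Matrix.replicateRow Unit b * _ * _)),
    Matrix.neg_apply, Matrix.mul_assoc, ← Matrix.replicateCol_mulVec, mul_neg]
  rfl

lemma conj_zeta_ne_zero (hζ : ∀ i, D.zeta i ∈ C13) (i : Fin D.r) : conj (D.zeta i) ≠ 0 := by
  simpa using ne_zero_of_mem_C13 (hζ i)

/-- At z = 0 the even kernel 1/(z − w) − 1/(z + w) is −2/w: hence the row τ̃ and the factor 2 in
front of det G̃. -/
lemma poleFun_zero_zero (hζ : ∀ i, D.zeta i ∈ C13)
    (hanalytic : ∀ i c, AnalyticAt ℂ (fun z => D.v0 i z c) (D.zeta i)) (x t : ℝ) (s : D.Index) :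
    D.poleFun x t s 0 0 = -2 * D.tau x t s := by
  have h0 := conj_zeta_ne_zero hζ s.1
  rw [← taylorCoeff_bra_mul_cauchy hanalytic x t s 0 h0.symm (neg_ne_zero.2 h0).symm, tau,
    ← taylorCoeff_const_mul]
  congr 1
  funext w
  simp [sgn, div_eq_mul_inv]
  ring

lemma poleFun_one_zero (hζ : ∀ i, D.zeta i ∈ C13)
    (hanalytic : ∀ i c, AnalyticAt ℂ (fun z => D.v0 i z c) (D.zeta i)) (x t : ℝ) (s : D.Index) :
    D.poleFun x t s 1 0 = 0 := by
  have h0 := conj_zeta_ne_zero hζ s.1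
  rw [← taylorCoeff_bra_mul_cauchy hanalytic x t s 1 h0.symm (neg_ne_zero.2 h0).symm]
  have : (fun w => D.bra x t s.1 w 1 * ((0 - w)⁻¹ - sgn 1 * (0 + w)⁻¹)) = fun _ => 0 * (0 : ℂ) := by
    funext w
    simp [sgn]
  rw [this, taylorCoeff_const_mul, zero_mul]

/-- The z-derivative of 1/(z − w) + 1/(z + w) at 0 is −2/w²: hence the row ψ̃ and the factor 2 in
front of det F̃. The finite sum is differentiated explicitly, and the Taylor coefficients of w⁻² are
recognized. -/
lemma hasDerivAt_poleFun_one (hζ : ∀ i, D.zeta i ∈ C13)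
    (hanalytic : ∀ i c, AnalyticAt ℂ (fun z => D.v0 i z c) (D.zeta i)) (x t : ℝ) (s : D.Index) :
    HasDerivAt (D.poleFun x t s 1) (-2 * D.psi x t s) 0 := by
  have h0 := conj_zeta_ne_zero hζ s.1
  have hd : ∀ (c : ℂ), c ≠ 0 → ∀ m : ℕ, HasDerivAt (fun z : ℂ => ((z + c) ^ (m + 1))⁻¹)
      (-((m + 1) * (c ^ (m + 2))⁻¹)) 0 := by
    intro c hc m
    have := (((hasDerivAt_id (0 : ℂ)).add_const c).pow (m + 1)).inv (by simpa using hc)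
    refine this.congr_deriv ?_
    simp
    field_simp
    ring
  have hψ : D.psi x t s = ∑ a ∈ Finset.range (s.2 + 1), conj (D.ketCoeff x t s.1 1 a) *
      ((-1) ^ ((s.2 : ℕ) - a) * (((s.2 : ℕ) - a : ℕ) + 1) *
        (conj (D.zeta s.1) ^ ((s.2 : ℕ) - a + 2))⁻¹) := by
    have a2 : AnalyticAt ℂ (fun w : ℂ => (w ^ 2)⁻¹) (conj (D.zeta s.1)) :=
      AnalyticAt.inv (by fun_prop) (pow_ne_zero _ h0)
    simp only [psi, div_eq_mul_inv]
    rw [taylorCoeff_mul (analyticAt_bra hanalytic x t s.1 1) a2]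
    refine Finset.sum_congr rfl fun a _ => ?_
    rw [taylorCoeff_bra, taylorCoeff_inv_sq]
  have := HasDerivAt.fun_sum (u := Finset.range ((s.2 : ℕ) + 1)) fun a _ =>
    (((hd _ (neg_ne_zero.2 h0) ((s.2 : ℕ) - a)).sub
      (((hd _ h0 ((s.2 : ℕ) - a)).const_mul ((-1) ^ ((s.2 : ℕ) - a))).const_mul (sgn 1))).const_mul
        (conj (D.ketCoeff x t s.1 1 a)))
  simp only [Pi.sub_apply, ← sub_eq_add_neg] at this
  refine this.congr_deriv ?_
  rw [hψ, Finset.mul_sum]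
  refine Finset.sum_congr rfl fun a _ => ?_
  have e : (-conj (D.zeta s.1)) ^ ((s.2 : ℕ) - a + 2)
      = (-1) ^ ((s.2 : ℕ) - a) * conj (D.zeta s.1) ^ ((s.2 : ℕ) - a + 2) := by
    rw [neg_pow, pow_add]
    norm_num
  rw [e, mul_inv, ← inv_pow]
  have e2 : (-1 : ℂ)⁻¹ = -1 := by norm_num
  rw [e2]
  simp only [sgn, Matrix.cons_val_one, Matrix.cons_val_fin_one]
  ring

lemma zero_ne_poles (hζ : ∀ i, D.zeta i ∈ C13) (j : Fin D.r) :
    (0 : ℂ) ≠ conj (D.zeta j) ∧ (0 : ℂ) ≠ -conj (D.zeta j) :=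
  ⟨(conj_zeta_ne_zero hζ j).symm, (neg_ne_zero.2 (conj_zeta_ne_zero hζ j)).symm⟩

lemma row_eval_zero (hζ : ∀ i, D.zeta i ∈ C13)
    (hanalytic : ∀ i c, AnalyticAt ℂ (fun z => D.v0 i z c) (D.zeta i)) (x t : ℝ) :
    (D.row x t 0).eval 0
      = D.poleDen.eval 0 * (1 - 2 * (D.tau x t ⬝ᵥ D.rowCoeff x t)) := by
  rw [row, eval_rowPoly x t 1 _ 0 (zero_ne_poles hζ), if_pos rfl]
  simp only [poleFun_zero_zero hζ hanalytic]
  congr 1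
  rw [dotProduct, Finset.mul_sum, sub_eq_add_neg, ← Finset.sum_neg_distrib]
  congr 1
  exact Finset.sum_congr rfl fun s _ => by ring

lemma row_coeff_one (hζ : ∀ i, D.zeta i ∈ C13)
    (hanalytic : ∀ i c, AnalyticAt ℂ (fun z => D.v0 i z c) (D.zeta i)) (x t : ℝ) :
    (D.row x t 1).coeff 1 = D.poleDen.eval 0 * (-2 * (D.psi x t ⬝ᵥ D.rowCoeff x t)) := by
  have h1 : HasDerivAt (fun z => ∑ s, D.rowCoeff x t s * D.poleFun x t s 1 z)
      (∑ s, D.rowCoeff x t s * (-2 * D.psi x t s)) 0 :=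
    HasDerivAt.fun_sum fun s _ => (hasDerivAt_poleFun_one hζ hanalytic x t s).const_mul _
  have h2 := (D.poleDen.hasDerivAt 0).mul h1
  have hev : (fun z => (D.row x t 1).eval z) =ᶠ[𝓝 0]
      (fun z => D.poleDen.eval z * ∑ s, D.rowCoeff x t s * D.poleFun x t s 1 z) := by
    have : ∀ᶠ z in 𝓝 (0 : ℂ), ∀ j, z ≠ conj (D.zeta j) ∧ z ≠ -conj (D.zeta j) :=
      eventually_all.2 fun j => (continuousAt_id.eventually_ne (zero_ne_poles hζ j).1).and
        (continuousAt_id.eventually_ne (zero_ne_poles hζ j).2)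
    filter_upwards [this] with z hz
    rw [row, eval_rowPoly x t 1 _ 1 hz]
    simp
  have h3 := (((D.row x t 1).hasDerivAt 0).congr_of_eventuallyEq hev.symm).unique h2
  have h4 : (D.row x t 1).coeff 1 = (derivative (D.row x t 1)).eval 0 := by
    rw [← coeff_zero_eq_eval_zero, coeff_derivative]
    simp
  rw [h4, h3]
  simp only [poleFun_one_zero hζ hanalytic, mul_zero, Finset.sum_const_zero, zero_add]
  congr 1
  rw [dotProduct, Finset.mul_sum]
  exact Finset.sum_congr rfl fun s _ => by ring

section main

variable (hζ : ∀ i, D.zeta i ∈ C13) (hsq : ∀ i j, i ≠ j → D.zeta i ^ 2 ≠ D.zeta j ^ 2)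
  (hanalytic : ∀ i c, AnalyticAt ℂ (fun z => D.v0 i z c) (D.zeta i))
  (hne : ∀ i, D.v0 i (D.zeta i) ≠ 0) (x t : ℝ)

include hζ hsq hanalytic hne

lemma isRow_row : D.IsRow (D.jet x t) (D.row x t) :=
  isRow_rowPoly hζ hsq hanalytic x t
    (matM_mulVec_rowCoeff (det_matM_ne_zero hζ hsq hanalytic hne x t))

lemma row_inner : D.row x t 0 * conjPoly (D.row x t 0) + D.row x t 1 * conjPoly (D.row x t 1)
    = D.fullDen := by
  have := rowPoly_inner hζ hsq hanalytic hne x t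
    (matM_mulVec_rowCoeff (det_matM_ne_zero hζ hsq hanalytic hne x t))
  simpa [row] using this

/-- At 0 the odd component vanishes, so the identity `row_inner` leaves p₀(0)p₀(0)^* =
|`poleDen`(0)|² ≠ 0. -/
lemma row_eval_zero_ne_zero : (D.row x t 0).eval 0 ≠ 0 := by
  intro h
  have h1 := congrArg (eval 0) (row_inner hζ hsq hanalytic hne x t)
  have h2 : (D.row x t 1).eval 0 = 0 := by
    have := congrArg (eval 0) (isRow_row hζ hsq hanalytic hne x t).odd
    rw [eval_comp, eval_neg, eval_neg, eval_X, neg_zero] at this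
    linear_combination this / 2
  simp only [eval_add, eval_mul, h, h2, zero_mul, zero_add, fullDen] at h1
  have h3 : D.poleDen.eval 0 ≠ 0 := eval_poleDen_ne_zero D fun i h' => by
    have := conj_zeta_ne_zero hζ i
    rw [zero_pow two_ne_zero] at h'
    exact pow_ne_zero 2 this h'.symm
  have h4 : D.zeroDen.eval 0 = conj (D.poleDen.eval 0) := by
    rw [← conjPoly_poleDen, eval_conjPoly, map_zero]
  rw [h4] at h1
  exact mul_ne_zero h3 (by simpa using h3) h1.symm

lemma det_add_ne_zero : (D.matM x t).det + 2 * (D.matG x t).det ≠ 0 := by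
  have hdet := det_matM_ne_zero hζ hsq hanalytic hne x t
  have h := row_eval_zero_ne_zero hζ hsq hanalytic hne x t
  rw [row_eval_zero hζ hanalytic] at h
  rw [matG, det_bordered hdet]
  have : (D.matM x t).det + 2 * -((D.matM x t).det * (D.tau x t ⬝ᵥ D.rowCoeff x t))
      = (D.matM x t).det * (1 - 2 * (D.tau x t ⬝ᵥ D.rowCoeff x t)) := by ring
  rw [this]
  exact mul_ne_zero hdet (right_ne_zero_of_mul h)

/-- Both bordered determinants are det M̃ times a scalar, and the common factors det M̃ and
`poleDen`(0) cancel in the quotient. -/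
lemma quotient_eq : D.quotient x t = (D.row x t 1).coeff 1 / (D.row x t 0).eval 0 := by
  have hdet := det_matM_ne_zero hζ hsq hanalytic hne x t
  have h := row_eval_zero_ne_zero hζ hsq hanalytic hne x t
  rw [row_eval_zero hζ hanalytic] at h
  have h1 := left_ne_zero_of_mul h
  have h2 := right_ne_zero_of_mul h
  rw [quotient, matF, matG, det_bordered hdet, det_bordered hdet, row_eval_zero hζ hanalytic,
    row_coeff_one hζ hanalytic]
  have : (D.matM x t).det + 2 * -((D.matM x t).det * (D.tau x t ⬝ᵥ D.rowCoeff x t))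
      = (D.matM x t).det * (1 - 2 * (D.tau x t ⬝ᵥ D.rowCoeff x t)) := by ring
  rw [this]
  field_simp

end main

end SolitonData
end KaupNewell
end

/-! ### Uniqueness for the Riemann–Hilbert problem -/

noncomputable section

namespace KaupNewell

open Polynomial

/-! ### Removable singularities and Liouville's theorem -/

/-- The singular points are removed one at a time: boundedness near c is stronger than the o(|z −
c|⁻¹) growth required for a removable singularity. -/
lemma exists_differentiable_eq (S : Finset ℂ) {f : ℂ → ℂ}
    (hd : DifferentiableOn ℂ f (S : Set ℂ)ᶜ)
    (hb : ∀ c ∈ S, f =O[𝓝[≠] c] (fun _ => (1 : ℂ))) :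
    ∃ F : ℂ → ℂ, Differentiable ℂ F ∧ ∀ z ∉ S, F z = f z := by
  induction S using Finset.induction_on generalizing f with
  | empty => exact ⟨f, by simpa [differentiableOn_univ] using hd, fun _ _ => rfl⟩
  | insert c S hc ih =>
    set f' := Function.update f c (limUnder (𝓝[≠] c) f) with hf'
    have hopen : IsOpen ((S : Set ℂ)ᶜ) := S.finite_toSet.isClosed.isOpen_compl
    have h1 : DifferentiableOn ℂ f' ((S : Set ℂ)ᶜ) := by
      refine Complex.differentiableOn_update_limUnder_of_isLittleO
        (hopen.mem_nhds (by simpa using hc)) (hd.mono ?_) ?_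
      · intro z hz
        simp only [Set.mem_sdiff, Set.mem_compl_iff, Set.mem_singleton_iff] at hz
        simp only [Finset.coe_insert, Set.mem_compl_iff, Set.mem_insert_iff, not_or]
        exact ⟨hz.2, hz.1⟩
      · have h2 : (fun z => f z - f c) =O[𝓝[≠] c] (fun _ => (1 : ℂ)) :=
          (hb c (Finset.mem_insert_self c S)).sub (isBigO_const_const _ one_ne_zero _)
        refine h2.trans_isLittleO ?_
        rw [isLittleO_const_left]
        right
        have := tendsto_norm_cobounded_atTop.comp (tendsto_inv₀_nhdsNE_zero (α := ℂ))
        refine this.comp (f := fun z => z - c) ?_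
        refine tendsto_nhdsWithin_iff.2 ⟨?_, ?_⟩
        · have : Tendsto (fun z : ℂ => z - c) (𝓝 c) (𝓝 (c - c)) :=
            (continuous_id.sub continuous_const).tendsto c
          rw [sub_self] at this
          exact this.mono_left nhdsWithin_le_nhds
        · filter_upwards [self_mem_nhdsWithin] with z hz
          exact sub_ne_zero.2 hz
    have h2 : ∀ s ∈ S, f' =O[𝓝[≠] s] (fun _ => (1 : ℂ)) := by
      intro s hs
      have hsc : s ≠ c := fun h => hc (h ▸ hs)
      refine (hb s (Finset.mem_insert_of_mem hs)).congr' ?_ EventuallyEq.rfl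
      have : ∀ᶠ z in 𝓝[≠] s, z ≠ c :=
        (continuousAt_id.eventually_ne hsc).filter_mono nhdsWithin_le_nhds
      filter_upwards [this] with z hz
      rw [hf', Function.update_of_ne hz]
    obtain ⟨F, hF, hFe⟩ := ih h1 h2
    refine ⟨F, hF, fun z hz => ?_⟩
    simp only [Finset.mem_insert, not_or] at hz
    rw [hFe z hz.2, hf', Function.update_of_ne hz.1]

lemma exists_const_of_bounded (S : Finset ℂ) {f : ℂ → ℂ}
    (hd : DifferentiableOn ℂ f (S : Set ℂ)ᶜ)
    (hb : ∀ c ∈ S, f =O[𝓝[≠] c] (fun _ => (1 : ℂ)))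
    (hi : f =O[Bornology.cobounded ℂ] (fun _ => (1 : ℂ))) :
    ∃ k, ∀ z ∉ S, f z = k := by
  obtain ⟨F, hF, hFe⟩ := exists_differentiable_eq S hd hb
  refine ⟨F 0, fun z hz => ?_⟩
  rw [← hFe z hz]
  refine hF.apply_eq_apply_of_bounded ?_ z 0
  obtain ⟨K, hK⟩ := hi.bound
  have hS : ∀ᶠ z in Bornology.cobounded ℂ, z ∉ S := by
    have h : (S : Set ℂ)ᶜ ∈ Bornology.cobounded ℂ :=
      Bornology.isBounded_def.1 S.finite_toSet.isBounded
    filter_upwards [h] with z hz using by simpa using hz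
  have h1 : ∀ᶠ z in Bornology.cobounded ℂ, ‖F z‖ ≤ K := by
    filter_upwards [hK, hS] with z h1 h2
    rw [hFe z h2]
    simpa using h1
  obtain ⟨R, -, hR⟩ := (Metric.hasBasis_cobounded_compl_closedBall (0 : ℂ)).eventually_iff.1 h1
  have h2 := ((isCompact_closedBall (0 : ℂ) R).image hF.continuous).isBounded
  refine (h2.union (Metric.isBounded_closedBall (x := (0 : ℂ)) (r := K))).subset ?_
  rintro _ ⟨w, rfl⟩
  by_cases hw : w ∈ Metric.closedBall (0 : ℂ) R
  · exact Or.inl (Set.mem_image_of_mem _ hw)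
  · exact Or.inr (by simpa using hR hw)

/-! ### Growth near a zero -/

/-- Two rows that nearly annihilate the same vector are nearly parallel: multiplying their cross
product by a component of w expresses it through a·w and b·w, and that component can be divided out.
-/
lemma isBigO_cross {l : Filter ℂ} {w a b : Fin 2 → ℂ → ℂ} {h : ℂ → ℂ}
    (ha : ∀ c, a c =O[l] (fun _ => (1 : ℂ))) (hb : ∀ c, b c =O[l] (fun _ => (1 : ℂ)))
    (hwa : (fun z => a 0 z * w 0 z + a 1 z * w 1 z) =O[l] h)
    (hwb : (fun z => b 0 z * w 0 z + b 1 z * w 1 z) =O[l] h)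
    {c : Fin 2} (hc : ∀ᶠ z in l, w c z ≠ 0) (hc' : (fun z => (w c z)⁻¹) =O[l] (fun _ => (1 : ℂ))) :
    (fun z => a 0 z * b 1 z - a 1 z * b 0 z) =O[l] h := by
  have key : ∀ k : Fin 2, (fun z => (w c z)⁻¹ * (b k z * (a 0 z * w 0 z + a 1 z * w 1 z)
      - a k z * (b 0 z * w 0 z + b 1 z * w 1 z))) =O[l] h := by
    intro k
    have := hc'.mul (((hb k).mul hwa).sub ((ha k).mul hwb))
    simpa using this
  fin_cases c
  · refine (key 1).congr' ?_ EventuallyEq.rfl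
    filter_upwards [hc] with z hz
    simp only [Fin.zero_eta] at hz ⊢
    field_simp
    ring
  · refine (key 0).neg_left.congr' ?_ EventuallyEq.rfl
    filter_upwards [hc] with z hz
    simp only [Fin.mk_one] at hz ⊢
    field_simp
    ring

lemma isBigO_div_of_eq {c : ℂ} {n : ℕ} {f g q : ℂ → ℂ}
    (hf : f =O[𝓝[≠] c] (fun z => (z - c) ^ n)) (hg : ∀ᶠ z in 𝓝[≠] c, g z = (z - c) ^ n * q z)
    (hq : ContinuousAt q c) (hq0 : q c ≠ 0) : (fun z => f z / g z) =O[𝓝[≠] c] (fun _ => (1 : ℂ)) := by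
  have h1 : (fun z => (q z)⁻¹) =O[𝓝[≠] c] (fun _ => (1 : ℂ)) :=
    ((hq.inv₀ hq0).tendsto.isBigO_one ℂ).mono nhdsWithin_le_nhds
  have h2 : (fun z => ((z - c) ^ n)⁻¹ * f z) =O[𝓝[≠] c] (fun _ => (1 : ℂ)) := by
    refine ((isBigO_refl (fun z => ((z - c) ^ n)⁻¹) _).mul hf).trans ?_
    refine IsBigO.of_bound 1 ?_
    filter_upwards [self_mem_nhdsWithin] with z hz
    have : (z - c) ^ n ≠ 0 := pow_ne_zero _ (sub_ne_zero.2 hz)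
    rw [inv_mul_cancel₀ this]
    simp
  have h3 := h2.mul h1
  simp only [mul_one] at h3
  refine h3.congr' ?_ EventuallyEq.rfl
  filter_upwards [hg] with z hz
  rw [hz]
  ring

lemma isBigO_one_of_continuousAt {f : ℂ → ℂ} {c : ℂ} (hf : ContinuousAt f c) :
    f =O[𝓝[≠] c] (fun _ => (1 : ℂ)) :=
  (hf.tendsto.isBigO_one ℂ).mono nhdsWithin_le_nhds

lemma isBigO_one_neg {f : ℂ → ℂ} {c : ℂ} (hf : f =O[𝓝[≠] c] (fun _ => (1 : ℂ))) :
    (fun z => f (-z)) =O[𝓝[≠] (-c)] (fun _ => (1 : ℂ)) := by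
  refine hf.comp_tendsto (k := fun z => -z) ?_
  refine tendsto_nhdsWithin_iff.2 ⟨?_, ?_⟩
  · have : Tendsto (fun z : ℂ => -z) (𝓝 (-c)) (𝓝 (- -c)) := continuous_neg.tendsto _
    rw [neg_neg] at this
    exact this.mono_left nhdsWithin_le_nhds
  · filter_upwards [self_mem_nhdsWithin] with z hz h
    exact hz (by rw [← h]; simp)

namespace SolitonData

variable {D : SolitonData}

/-- The points `±ζ_i`, `±ζ_i^*`. -/
def nodes (D : SolitonData) : Finset ℂ :=
  Finset.univ.biUnion fun i => {D.zeta i, -D.zeta i, conj (D.zeta i), -conj (D.zeta i)}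

lemma notMem_nodes {z : ℂ} : z ∉ D.nodes ↔
    ∀ i, z ^ 2 ≠ D.zeta i ^ 2 ∧ z ^ 2 ≠ conj (D.zeta i) ^ 2 := by
  simp [nodes, sq_eq_sq_iff_eq_or_eq_neg, not_or, and_assoc]

lemma notMem_nodes_conj {z : ℂ} (hz : z ∉ D.nodes) : conj z ∉ D.nodes := by
  rw [notMem_nodes] at hz ⊢
  intro i
  have h : ∀ w, conj z ^ 2 = w ^ 2 → z ^ 2 = conj w ^ 2 := by
    intro w hw
    rw [← map_pow, ← hw, map_pow, Complex.conj_conj]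
  refine ⟨fun h1 => (hz i).2 (h _ h1), fun h1 => (hz i).1 ?_⟩
  rw [h _ h1, Complex.conj_conj]

lemma eventually_notMem_nodes (c : ℂ) : ∀ᶠ z in 𝓝[≠] c, z ∉ D.nodes := by
  have h : ∀ w ∈ D.nodes, ∀ᶠ z in 𝓝[≠] c, z ≠ w := by
    intro w _
    by_cases hw : c = w
    · rw [hw]
      exact self_mem_nhdsWithin
    · exact (continuousAt_id.eventually_ne hw).filter_mono nhdsWithin_le_nhds
  filter_upwards [(Finset.eventually_all _).2 h] with z hz hm
  exact hz z hm rfl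

/-- The product of the first row of the model solution and the inverse of `P`. -/
def rowQuot (D : SolitonData) (x t : ℝ) (P : ℂ → Matrix (Fin 2) (Fin 2) ℂ) (b : Fin 2) (z : ℂ) :
    ℂ :=
  (∑ c, (D.row x t c).eval z * conj (P (conj z) b c)) / D.poleDen.eval z

variable {x t : ℝ} {P : ℂ → Matrix (Fin 2) (Fin 2) ℂ}

lemma SolvesRHP.differentiableAt (hP : D.SolvesRHP x t P) {z : ℂ}
    (hz : ∀ i, z ^ 2 ≠ conj (D.zeta i) ^ 2) (a b : Fin 2) :
    DifferentiableAt ℂ (fun z => P z a b) z := by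
  refine (hP.analytic a b).differentiableAt (IsOpen.mem_nhds ?_ hz)
  simp only [Set.ofPred_forall]
  exact isOpen_iInter_of_finite fun i => isOpen_ne_fun (by fun_prop) (by fun_prop)

lemma SolvesRHP.differentiableAt_conj (hP : D.SolvesRHP x t P) {z : ℂ}
    (hz : ∀ i, z ^ 2 ≠ D.zeta i ^ 2) (a b : Fin 2) :
    DifferentiableAt ℂ (fun z => conj (P (conj z) a b)) z := by
  have h := (hP.differentiableAt (z := conj z) (fun i h => hz i ?_) a b).conj_conj
  · rwa [Complex.conj_conj] at h
  · rw [← map_pow, ← map_pow] at h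
    exact star_injective h

lemma SolvesRHP.mul_inv (hP : D.SolvesRHP x t P) {z : ℂ} (hz : z ∉ D.nodes) :
    P z * (P (conj z))ᴴ = 1 := hP.involution z (notMem_nodes.1 hz)

lemma sigma3_mul_mul_sigma3 (A : Matrix (Fin 2) (Fin 2) ℂ) (a b : Fin 2) :
    (sigma3 * A * sigma3) a b = sgn a * sgn b * A a b := by
  fin_cases a <;> fin_cases b <;>
    simp [sigma3, sgn, Matrix.mul_apply, Fin.sum_univ_two, Matrix.vecMul, dotProduct]

lemma rowQuot_neg (hζ : ∀ i, D.zeta i ∈ C13)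
    (hsq : ∀ i j, i ≠ j → D.zeta i ^ 2 ≠ D.zeta j ^ 2)
    (hanalytic : ∀ i c, AnalyticAt ℂ (fun z => D.v0 i z c) (D.zeta i))
    (hne : ∀ i, D.v0 i (D.zeta i) ≠ 0) (hP : D.SolvesRHP x t P) (b : Fin 2) {z : ℂ}
    (hz : z ∉ D.nodes) : D.rowQuot x t P b (-z) = sgn b * D.rowQuot x t P b z := by
  have hr := isRow_row hζ hsq hanalytic hne x t
  have h0 : (D.row x t 0).eval (-z) = (D.row x t 0).eval z := by
    have := congrArg (eval z) hr.even
    simpa using this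
  have h1 : (D.row x t 1).eval (-z) = -(D.row x t 1).eval z := by
    have := congrArg (eval z) hr.odd
    simpa using this
  have hD : D.poleDen.eval (-z) = D.poleDen.eval z := by
    have := congrArg (eval z) D.poleDen_comp
    simpa using this
  have hPz := hP.parity (conj z) fun i => (notMem_nodes.1 (notMem_nodes_conj hz) i).2
  rw [rowQuot, rowQuot, hD, map_neg, hPz, Fin.sum_univ_two, Fin.sum_univ_two, h0, h1]
  simp only [sigma3_mul_mul_sigma3]
  fin_cases b
  · simp [sgn]
  · simp [sgn]
    ring

/-- Near ζ_i^* the matrix P(z^*)^† is regular and annihilates ⟨v_i| to order n_i, and the model row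
is parallel to ⟨v_i| to the same order. Their product thus vanishes to order n_i, which compensates
the zero of `poleDen`. -/
lemma isBigO_rowQuot_conj (hζ : ∀ i, D.zeta i ∈ C13)
    (hsq : ∀ i j, i ≠ j → D.zeta i ^ 2 ≠ D.zeta j ^ 2)
    (hanalytic : ∀ i c, AnalyticAt ℂ (fun z => D.v0 i z c) (D.zeta i))
    (hne : ∀ i, D.v0 i (D.zeta i) ≠ 0) (hP : D.SolvesRHP x t P) (b : Fin 2) (i : Fin D.r) :
    D.rowQuot x t P b =O[𝓝[≠] (conj (D.zeta i))] (fun _ => (1 : ℂ)) := by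
  obtain ⟨Q, hQ, hQ0⟩ := exists_poleDen_eq hζ hsq i
  have hr := isRow_row hζ hsq hanalytic hne x t
  have hconj : Tendsto (fun z : ℂ => conj z) (𝓝 (conj (D.zeta i))) (𝓝 (D.zeta i)) := by
    have := (Complex.continuous_conj.continuousAt (x := conj (D.zeta i))).tendsto
    rwa [Complex.conj_conj] at this
  have hbig : ∀ {f : ℂ → ℂ}, f =O[𝓝 (D.zeta i)] (fun z => (z - D.zeta i) ^ D.mult i) →
      (fun z => conj (f (conj z))) =O[𝓝[≠] (conj (D.zeta i))]
        (fun z => (z - conj (D.zeta i)) ^ D.mult i) := by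
    intro f hf
    have h := (hf.comp_tendsto hconj).norm_norm.mono
      (nhdsWithin_le_nhds (s := {conj (D.zeta i)}ᶜ))
    refine IsBigO.of_norm_norm (h.congr (fun z => ?_) (fun z => ?_))
    · simp
    · have : conj (z - conj (D.zeta i)) = conj z - D.zeta i := by simp
      simp only [Function.comp_apply, norm_pow]
      rw [← this, Complex.norm_conj]
  obtain ⟨c, hc⟩ := Function.ne_iff.1 (ket_ne_zero hne x t i)
  have hbra : ∀ c, ContinuousAt (fun w => D.bra x t i w c) (conj (D.zeta i)) := fun c =>
    (analyticAt_bra hanalytic x t i c).continuousAt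
  have hbc : D.bra x t i (conj (D.zeta i)) c ≠ 0 := by
    simpa [bra] using hc
  have hrow : ∀ c, ContinuousAt (fun z => (D.row x t c).eval z) (conj (D.zeta i)) := fun c =>
    (D.row x t c).continuous.continuousAt
  -- Taking a = (−p₁, p₀) turns parallelism of p to ⟨v_i| into annihilation; the cross product of a
  -- with b is then minus the desired numerator.
  have hcr := isBigO_cross (l := 𝓝[≠] (conj (D.zeta i)))
    (w := fun c w => D.bra x t i w c)
    (a := ![fun z => -(D.row x t 1).eval z, fun z => (D.row x t 0).eval z])
    (b := fun c z => conj (P (conj z) b c)) (h := fun z => (z - conj (D.zeta i)) ^ D.mult i)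
    (fun c => ?_) (fun c => ?_) ?_ ?_ (c := c) ?_ ?_
  · refine (isBigO_div_of_eq hcr.neg_left (g := fun z => D.poleDen.eval z) (q := fun z => Q.eval z)
      (Eventually.of_forall fun z => ?_) Q.continuous.continuousAt hQ0).congr_left fun z => ?_
    · simp [hQ]
    · rw [rowQuot, Fin.sum_univ_two]
      congr 1
      simp
  · fin_cases c
    · exact (isBigO_one_of_continuousAt (hrow 1)).neg_left
    · exact isBigO_one_of_continuousAt (hrow 0)
  · refine isBigO_one_of_continuousAt (hP.differentiableAt_conj (fun j h => ?_) b c).continuousAt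
    exact sq_ne_conj_sq (hζ j) (hζ i) h.symm
  · obtain ⟨W, hW⟩ := hr.poles i
    have h1 : (fun z => (D.row x t 0).eval z * conj ((D.jet x t i 1).eval (conj z))
        - (D.row x t 1).eval z * conj ((D.jet x t i 0).eval (conj z)))
        =O[𝓝[≠] (conj (D.zeta i))] (fun z => (z - conj (D.zeta i)) ^ D.mult i) := by
      have e : (fun z => (D.row x t 0).eval z * conj ((D.jet x t i 1).eval (conj z))
        - (D.row x t 1).eval z * conj ((D.jet x t i 0).eval (conj z)))
          = fun z => (z - conj (D.zeta i)) ^ D.mult i * W.eval z := by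
        funext z
        have := congrArg (eval z) hW
        simpa [eval_conjPoly] using this
      rw [e]
      simpa using (isBigO_refl (fun z => (z - conj (D.zeta i)) ^ D.mult i) _).mul
        (isBigO_one_of_continuousAt W.continuous.continuousAt)
    have h2 : ∀ c, (fun z => conj (D.ket x t i (conj z) c - (D.jet x t i c).eval (conj z)))
        =O[𝓝[≠] (conj (D.zeta i))] (fun z => (z - conj (D.zeta i)) ^ D.mult i) := by
      intro c
      obtain ⟨g, hg, hge⟩ := vanishesAt_sub_jet hanalytic x t i c
      refine hbig (f := fun z => D.ket x t i z c - (D.jet x t i c).eval z) ?_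
      have := (isBigO_refl (fun z => (z - D.zeta i) ^ D.mult i) (𝓝 (D.zeta i))).mul
        (hg.continuousAt.tendsto.isBigO_one ℂ)
      simp only [mul_one] at this
      exact this.congr' (hge.mono fun z hz => hz.symm) EventuallyEq.rfl
    have h3 := ((isBigO_one_of_continuousAt (hrow 0)).mul (h2 1)).sub
      ((isBigO_one_of_continuousAt (hrow 1)).mul (h2 0))
    simp only [one_mul] at h3
    refine (h1.add h3).congr_left fun z => ?_
    have hb : ∀ c, D.bra x t i z c = conj (D.ket x t i (conj z) c) := fun c =>
      congrFun (bra_apply x t i c) z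
    simp [hb]
    ring
  · refine (hbig (isBigO_pi.1 (hP.kernel_chain i) b)).congr_left fun z => ?_
    have hb : ∀ c, D.bra x t i z c = conj (D.ket x t i (conj z) c) := fun c =>
      congrFun (bra_apply x t i c) z
    simp [Matrix.mulVec, dotProduct, Fin.sum_univ_two, hb]
  · exact ((hbra c).eventually_ne hbc).filter_mono nhdsWithin_le_nhds
  · exact isBigO_one_of_continuousAt ((hbra c).inv₀ hbc)

/-- Near ζ_i the point z^* approaches a pole of P, so P(z^*)^† is replaced by adj P(z)/det P(z),
which turns the numerator into a cross product of rows regular at ζ_i. -/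
lemma rowQuot_eq_cross (hP : D.SolvesRHP x t P) {z : ℂ} (hz : z ∉ D.nodes) (b : Fin 2) :
    D.rowQuot x t P b z = (![(D.row x t 0).eval z * P z 1 1 - (D.row x t 1).eval z * P z 1 0,
      P z 0 0 * (D.row x t 1).eval z - P z 0 1 * (D.row x t 0).eval z] : Fin 2 → ℂ) b
        / (D.poleDen.eval z * (P z).det) := by
  have h := hP.mul_inv hz
  have hd : (P z).det ≠ 0 := by
    intro h0
    have := congrArg Matrix.det h
    rw [Matrix.det_mul, h0, zero_mul, Matrix.det_one] at this
    exact zero_ne_one this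
  have h2 : (P z).det • (P (conj z))ᴴ = (P z).adjugate := by
    have := congrArg (fun A => (P z).adjugate * A) h
    simp only [← mul_assoc, Matrix.adjugate_mul, mul_one, Matrix.smul_mul, one_mul] at this
    exact this
  have h3 : ∀ c, conj (P (conj z) b c) = (P z).adjugate c b / (P z).det := by
    intro c
    rw [← h2]
    simp [hd]
  rw [rowQuot, Fin.sum_univ_two, h3, h3, Matrix.adjugate_fin_two]
  by_cases h0 : D.poleDen.eval z = 0
  · simp [h0]
  fin_cases b <;> simp <;> field_simp <;> ring

lemma exists_zeroDen_eq (hζ : ∀ i, D.zeta i ∈ C13)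
    (hsq : ∀ i j, i ≠ j → D.zeta i ^ 2 ≠ D.zeta j ^ 2) (i : Fin D.r) :
    ∃ Q : ℂ[X], D.zeroDen = (X - C (D.zeta i)) ^ D.mult i * Q ∧ Q.eval (D.zeta i) ≠ 0 := by
  obtain ⟨Q, hQ, hQ0⟩ := exists_poleDen_eq hζ hsq i
  refine ⟨conjPoly Q, ?_, ?_⟩
  · rw [← conjPoly_poleDen, hQ]
    simp
  · rw [eval_conjPoly]
    simpa using hQ0

/-- The model row and each row of P annihilate |v_i⟩ to order n_i, so their cross product is of that
order. The determinant of P has a zero of exactly this order, because ρ does not vanish. -/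
lemma isBigO_rowQuot_zeta (hζ : ∀ i, D.zeta i ∈ C13)
    (hsq : ∀ i j, i ≠ j → D.zeta i ^ 2 ≠ D.zeta j ^ 2)
    (hanalytic : ∀ i c, AnalyticAt ℂ (fun z => D.v0 i z c) (D.zeta i))
    (hne : ∀ i, D.v0 i (D.zeta i) ≠ 0) (hP : D.SolvesRHP x t P) (b : Fin 2) (i : Fin D.r) :
    D.rowQuot x t P b =O[𝓝[≠] (D.zeta i)] (fun _ => (1 : ℂ)) := by
  obtain ⟨Q, hQ, hQ0⟩ := exists_zeroDen_eq hζ hsq i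
  obtain ⟨ρ, hρ, hρ0, hdet⟩ := hP.det_zeros
  have hr := isRow_row hζ hsq hanalytic hne x t
  obtain ⟨c, hc⟩ := Function.ne_iff.1 (ket_ne_zero hne x t i)
  have hket : ∀ c, ContinuousAt (fun w => D.ket x t i w c) (D.zeta i) := fun c =>
    (analyticAt_ket hanalytic x t i c).continuousAt
  have hrow : ∀ c, (fun z => (D.row x t c).eval z) =O[𝓝[≠] (D.zeta i)] (fun _ => (1 : ℂ)) :=
    fun c => isBigO_one_of_continuousAt (D.row x t c).continuous.continuousAt
  have hPc : ∀ a c, (fun z => P z a c) =O[𝓝[≠] (D.zeta i)] (fun _ => (1 : ℂ)) := fun a c =>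
    isBigO_one_of_continuousAt
      (hP.differentiableAt (fun j => sq_ne_conj_sq (hζ i) (hζ j)) a c).continuousAt
  have hrk : (fun z => (D.row x t 0).eval z * D.ket x t i z 0
      + (D.row x t 1).eval z * D.ket x t i z 1) =O[𝓝[≠] (D.zeta i)]
        (fun z => (z - D.zeta i) ^ D.mult i) := by
    obtain ⟨g, hg, hge⟩ := (vanishesAt_row_iff hanalytic x t i _).2 (hr.zeros i)
    have := (isBigO_refl (fun z => (z - D.zeta i) ^ D.mult i) (𝓝 (D.zeta i))).mul
        (hg.continuousAt.tendsto.isBigO_one ℂ)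
    simp only [mul_one] at this
    exact (this.congr' (hge.mono fun z hz => hz.symm) EventuallyEq.rfl).mono nhdsWithin_le_nhds
  have hPk : ∀ a, (fun z => P z a 0 * D.ket x t i z 0 + P z a 1 * D.ket x t i z 1)
      =O[𝓝[≠] (D.zeta i)] (fun z => (z - D.zeta i) ^ D.mult i) := by
    intro a
    refine ((isBigO_pi.1 (hP.kernel_chain i) a).mono nhdsWithin_le_nhds).congr_left fun z => ?_
    simp [Matrix.mulVec, dotProduct, Fin.sum_univ_two]
  have hc0 := ((hket c).eventually_ne hc).filter_mono (nhdsWithin_le_nhds (s := {D.zeta i}ᶜ))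
  have hc1 := isBigO_one_of_continuousAt ((hket c).inv₀ hc)
  have hnum : (fun z => (![(D.row x t 0).eval z * P z 1 1 - (D.row x t 1).eval z * P z 1 0,
      P z 0 0 * (D.row x t 1).eval z - P z 0 1 * (D.row x t 0).eval z] : Fin 2 → ℂ) b)
        =O[𝓝[≠] (D.zeta i)] (fun z => (z - D.zeta i) ^ D.mult i) := by
    fin_cases b
    · exact isBigO_cross (a := fun c z => (D.row x t c).eval z) (b := fun c z => P z 1 c)
        (w := fun c z => D.ket x t i z c) hrow (hPc 1) hrk (hPk 1) (c := c) hc0 hc1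
    · exact isBigO_cross (b := fun c z => (D.row x t c).eval z) (a := fun c z => P z 0 c)
        (w := fun c z => D.ket x t i z c) (hPc 0) hrow (hPk 0) hrk (c := c) hc0 hc1
  have hnhds : C13 ∈ 𝓝 (D.zeta i) := isOpen_C13.mem_nhds (hζ i)
  refine (isBigO_div_of_eq hnum (g := fun z => D.poleDen.eval z * (P z).det)
    (q := fun z => D.poleDen.eval z * (Q.eval z * ρ z)) ?_ ?_ ?_).congr' ?_ EventuallyEq.rfl
  · filter_upwards [nhdsWithin_le_nhds hnhds] with z hz
    have : D.zeroDen.eval z = (z - D.zeta i) ^ D.mult i * Q.eval z := by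
      rw [hQ]
      simp
    rw [hdet z hz, ← eval_zeroDen, this]
    ring
  · exact D.poleDen.continuous.continuousAt.mul (Q.continuous.continuousAt.mul
      (hρ.continuousOn.continuousAt hnhds))
  · exact mul_ne_zero (eval_poleDen_ne_zero D fun j => sq_ne_conj_sq (hζ i) (hζ j))
      (mul_ne_zero hQ0 (hρ0 _ (hζ i)))
  · filter_upwards [eventually_notMem_nodes (D.zeta i)] with z hz
    rw [rowQuot_eq_cross hP hz]

lemma isBigO_poleFun_cobounded (s : D.Index) (c : Fin 2) :
    D.poleFun x t s c =O[Bornology.cobounded ℂ] (fun _ => (1 : ℂ)) := by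
  have h : ∀ (w : ℂ) (m : ℕ), (fun z : ℂ => ((z + w) ^ (m + 1))⁻¹)
      =O[Bornology.cobounded ℂ] (fun _ => (1 : ℂ)) := by
    intro w m
    have h1 : Tendsto (fun z : ℂ => (z + w)⁻¹) (Bornology.cobounded ℂ) (𝓝 0) :=
      tendsto_inv₀_cobounded.comp (tendsto_add_const_cobounded (R := ℂ) w)
    have h2 := (h1.pow (m + 1)).isBigO_one ℂ
    simpa [inv_pow] using h2
  unfold poleFun
  refine IsBigO.fun_sum fun a _ => ?_
  refine IsBigO.const_mul_left (IsBigO.sub ?_ (IsBigO.const_mul_left (IsBigO.const_mul_left ?_ _) _)) _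
  · simpa [sub_eq_add_neg] using h (-conj (D.zeta s.1)) _
  · exact h _ _

/-- Boundedness at ζ_i and ζ_i^* is shown directly and passes to the negatives by parity; both
factors stay bounded at infinity. Liouville's theorem applies. -/
lemma exists_rowQuot_eq (hζ : ∀ i, D.zeta i ∈ C13)
    (hsq : ∀ i j, i ≠ j → D.zeta i ^ 2 ≠ D.zeta j ^ 2)
    (hanalytic : ∀ i c, AnalyticAt ℂ (fun z => D.v0 i z c) (D.zeta i))
    (hne : ∀ i, D.v0 i (D.zeta i) ≠ 0) (hP : D.SolvesRHP x t P) (b : Fin 2) :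
    ∃ k, ∀ z ∉ D.nodes, D.rowQuot x t P b z = k := by
  have hcob : Tendsto (fun z : ℂ => conj z) (Bornology.cobounded ℂ) (Bornology.cobounded ℂ) := by
    rw [← tendsto_norm_atTop_iff_cobounded]
    simpa using tendsto_norm_cobounded_atTop (E := ℂ)
  have hnode : ∀ᶠ z in Bornology.cobounded ℂ, z ∉ D.nodes := by
    have h : (D.nodes : Set ℂ)ᶜ ∈ Bornology.cobounded ℂ :=
      Bornology.isBounded_def.1 D.nodes.finite_toSet.isBounded
    filter_upwards [h] with z hz using by simpa using hz
  refine exists_const_of_bounded D.nodes (fun z hz => ?_) (fun w hw => ?_) ?_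
  · have hz' := notMem_nodes.1 (by simpa using hz : z ∉ D.nodes)
    have hden := eval_poleDen_ne_zero D fun i => (hz' i).2
    have h1 : ∀ c, DifferentiableAt ℂ (fun z => (D.row x t c).eval z * conj (P (conj z) b c)) z :=
      fun c => (D.row x t c).differentiable.differentiableAt.mul
        (hP.differentiableAt_conj (fun i => (hz' i).1) b c)
    exact ((DifferentiableAt.fun_sum fun c _ => h1 c).div
      D.poleDen.differentiable.differentiableAt hden).differentiableWithinAt
  · have hneg : ∀ {u : ℂ}, D.rowQuot x t P b =O[𝓝[≠] u] (fun _ => (1 : ℂ)) →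
        D.rowQuot x t P b =O[𝓝[≠] (-u)] (fun _ => (1 : ℂ)) := by
      intro u hu
      refine ((isBigO_one_neg hu).const_mul_left (sgn b)).congr' ?_ EventuallyEq.rfl
      filter_upwards [eventually_notMem_nodes (-u)] with z hz
      rw [rowQuot_neg hζ hsq hanalytic hne hP b hz, ← mul_assoc]
      fin_cases b <;> simp [sgn]
    simp only [nodes, Finset.mem_biUnion, Finset.mem_univ, true_and, Finset.mem_insert,
      Finset.mem_singleton] at hw
    obtain ⟨i, rfl | rfl | rfl | rfl⟩ := hw
    · exact isBigO_rowQuot_zeta hζ hsq hanalytic hne hP b i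
    · exact hneg (isBigO_rowQuot_zeta hζ hsq hanalytic hne hP b i)
    · exact isBigO_rowQuot_conj hζ hsq hanalytic hne hP b i
    · exact hneg (isBigO_rowQuot_conj hζ hsq hanalytic hne hP b i)
  · have h1 : ∀ c, (fun z => ((if c = 0 then 1 else 0) + ∑ s, D.rowCoeff x t s * D.poleFun x t s c z)
        * conj (P (conj z) b c)) =O[Bornology.cobounded ℂ] (fun _ => (1 : ℂ)) := by
      intro c
      have h2 : (fun z => conj (P (conj z) b c)) =O[Bornology.cobounded ℂ] (fun _ => (1 : ℂ)) := by
        refine IsBigO.of_norm_left ?_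
        refine (((hP.bounded b c).comp_tendsto hcob).norm_left).congr_left fun z => ?_
        simp
      have h3 : (fun z => ((if c = 0 then (1 : ℂ) else 0)
          + ∑ s, D.rowCoeff x t s * D.poleFun x t s c z)) =O[Bornology.cobounded ℂ]
            (fun _ => (1 : ℂ)) :=
        (isBigO_const_const _ one_ne_zero _).add
          (IsBigO.fun_sum fun s _ => (isBigO_poleFun_cobounded s c).const_mul_left _)
      simpa using h3.mul h2
    refine ((h1 0).add (h1 1)).congr' ?_ EventuallyEq.rfl
    filter_upwards [hnode] with z hz
    have hz' := notMem_nodes.1 hz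
    have hden := eval_poleDen_ne_zero D fun i => (hz' i).2
    have hz'' : ∀ j, z ≠ conj (D.zeta j) ∧ z ≠ -conj (D.zeta j) := fun j =>
      ⟨fun h => (hz' j).2 (by rw [h]), fun h => (hz' j).2 (by rw [h, neg_sq])⟩
    rw [rowQuot, Fin.sum_univ_two, row, eval_rowPoly x t 1 _ 0 hz'', eval_rowPoly x t 1 _ 1 hz'']
    field_simp

lemma zero_notMem_nodes (hζ : ∀ i, D.zeta i ∈ C13) : (0 : ℂ) ∉ D.nodes := by
  rw [notMem_nodes]
  intro i
  have := ne_zero_of_mem_C13 (hζ i)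
  rw [zero_pow two_ne_zero]
  exact ⟨(pow_ne_zero 2 this).symm, (pow_ne_zero 2 (by simpa using this)).symm⟩

/-- The first row of every solution of the Riemann-Hilbert problem. -/
lemma SolvesRHP.row_eq (hζ : ∀ i, D.zeta i ∈ C13)
    (hsq : ∀ i j, i ≠ j → D.zeta i ^ 2 ≠ D.zeta j ^ 2)
    (hanalytic : ∀ i c, AnalyticAt ℂ (fun z => D.v0 i z c) (D.zeta i))
    (hne : ∀ i, D.v0 i (D.zeta i) ≠ 0) (hP : D.SolvesRHP x t P) (c : Fin 2) {z : ℂ}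
    (hz : z ∉ D.nodes) : P z 0 c = D.poleDen.eval 0 / (D.row x t 0).eval 0
      * ((D.row x t c).eval z / D.poleDen.eval z) := by
  have h0 := zero_notMem_nodes hζ
  have hr0 := row_eval_zero_ne_zero hζ hsq hanalytic hne x t
  have hr1 : (D.row x t 1).eval 0 = 0 := by
    have := congrArg (eval 0) (isRow_row hζ hsq hanalytic hne x t).odd
    rw [eval_comp, eval_neg, eval_neg, eval_X, neg_zero] at this
    linear_combination this / 2
  have hD0 := eval_poleDen_ne_zero D fun i => (notMem_nodes.1 h0 i).2
  have hk : ∀ b, D.rowQuot x t P b z = D.rowQuot x t P b 0 := by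
    intro b
    obtain ⟨k, hk⟩ := exists_rowQuot_eq hζ hsq hanalytic hne hP b
    rw [hk z hz, hk 0 h0]
  have hk0 := hk 0
  have hk1 := hk 1
  simp only [rowQuot, Fin.sum_univ_two, map_zero, hP.normalized, Matrix.one_apply_eq, hr1,
    map_one, zero_mul, mul_one, add_zero, zero_div,
    Matrix.one_apply_ne (show (1 : Fin 2) ≠ 0 by decide), mul_zero] at hk0 hk1
  have hinv : (P (conj z))ᴴ * P z = 1 := mul_eq_one_comm.1 (hP.mul_inv hz)
  have e : ∀ a b, conj (P (conj z) 0 a) * P z 0 b + conj (P (conj z) 1 a) * P z 1 b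
      = (1 : Matrix (Fin 2) (Fin 2) ℂ) a b := by
    intro a b
    rw [← hinv, Matrix.mul_apply, Fin.sum_univ_two]
    simp
  have e0 := e 0 c
  have e1 := e 1 c
  -- The constant row is found at z = 0, where P = I and the model row is (p₀(0), 0); multiplying it
  -- by P(z) from the right undoes the inverse.
  have hq : (D.row x t 0).eval 0 / D.poleDen.eval 0 * P z 0 c
      = (D.row x t c).eval z / D.poleDen.eval z := by
    rw [← hk0]
    have : (D.row x t c).eval z = (D.row x t 0).eval z * (1 : Matrix (Fin 2) (Fin 2) ℂ) 0 c
        + (D.row x t 1).eval z * (1 : Matrix (Fin 2) (Fin 2) ℂ) 1 c := by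
      fin_cases c
      · simp [Matrix.one_apply]
      · simp [Matrix.one_apply]
    rw [this, ← e0, ← e1]
    linear_combination P z 1 c * hk1 * (-1)
  rw [← hq]
  field_simp

/-- The first Taylor coefficient at zero of a solution of the Riemann-Hilbert problem. -/
lemma SolvesRHP.hasDerivAt_zero (hζ : ∀ i, D.zeta i ∈ C13)
    (hsq : ∀ i j, i ≠ j → D.zeta i ^ 2 ≠ D.zeta j ^ 2)
    (hanalytic : ∀ i c, AnalyticAt ℂ (fun z => D.v0 i z c) (D.zeta i))
    (hne : ∀ i, D.v0 i (D.zeta i) ≠ 0) (hP : D.SolvesRHP x t P) (a b : Fin 2) :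
    HasDerivAt (fun z => P z a b) (potentialMatrix D.quotient x t a b) 0 := by
  have h0 := zero_notMem_nodes hζ
  have hr0 := row_eval_zero_ne_zero hζ hsq hanalytic hne x t
  have hD0 := eval_poleDen_ne_zero D fun i => (notMem_nodes.1 h0 i).2
  have hev : ∀ᶠ z in 𝓝 (0 : ℂ), z ∉ D.nodes := by
    have : IsOpen ((D.nodes : Set ℂ)ᶜ) := D.nodes.finite_toSet.isClosed.isOpen_compl
    filter_upwards [this.mem_nhds (by simpa using h0)] with z hz using by simpa using hz
  have hr1 : (D.row x t 1).eval 0 = 0 := by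
    have := congrArg (eval 0) (isRow_row hζ hsq hanalytic hne x t).odd
    rw [eval_comp, eval_neg, eval_neg, eval_X, neg_zero] at this
    linear_combination this / 2
  have h01 : HasDerivAt (fun z => P z 0 1) (D.quotient x t) 0 := by
    have h := ((((D.row x t 1).hasDerivAt 0).div (D.poleDen.hasDerivAt 0) hD0).const_mul
      (D.poleDen.eval 0 / (D.row x t 0).eval 0)).congr_of_eventuallyEq
        (hev.mono fun z hz => hP.row_eq hζ hsq hanalytic hne 1 hz)
    refine h.congr_deriv ?_
    have h4 : (D.row x t 1).coeff 1 = (derivative (D.row x t 1)).eval 0 := by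
      rw [← coeff_zero_eq_eval_zero, coeff_derivative]
      simp
    rw [quotient_eq hζ hsq hanalytic hne, h4, hr1]
    field_simp
    ring
  -- Parity makes the diagonal entries even, so their derivative at 0 vanishes.
  have hdiag : ∀ a, HasDerivAt (fun z => P z a a) 0 0 := by
    intro a
    have h := (hP.differentiableAt (fun i => (notMem_nodes.1 h0 i).2) a a).hasDerivAt
    have h' : HasDerivAt (fun z => P (-z) a a) (deriv (fun z => P z a a) 0 * (-1)) 0 := by
      have h1 : HasDerivAt (fun z => P z a a) (deriv (fun z => P z a a) 0) (-0) := by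
        rwa [neg_zero]
      exact h1.comp 0 (hasDerivAt_neg 0)
    have h2 := h.unique (h'.congr_of_eventuallyEq (hev.mono fun z hz => ?_))
    · have : deriv (fun z => P z a a) 0 = 0 := by linear_combination h2 / 2
      rwa [this] at h
    · have := hP.parity z fun i => (notMem_nodes.1 hz i).2
      simp only [this, sigma3_mul_mul_sigma3]
      fin_cases a <;> simp [sgn]
  have hnorm : ∀ a b, P 0 a b = (1 : Matrix (Fin 2) (Fin 2) ℂ) a b := fun a b => by
    rw [hP.normalized]
  -- The lower left entry comes from differentiating the (1, 0) entry of P(z)P(z^*)^† = 1 at 0.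
  have h10 : HasDerivAt (fun z => P z 1 0) (-conj (D.quotient x t)) 0 := by
    have hc : ∀ {f : ℂ → ℂ} {f' : ℂ}, HasDerivAt f f' 0 →
        HasDerivAt (fun z => conj (f (conj z))) (conj f') 0 := by
      intro f f' hf
      have := hf.conj_conj
      rwa [map_zero] at this
    have h := (hP.differentiableAt (fun i => (notMem_nodes.1 h0 i).2) 1 0).hasDerivAt
    have h1 := (h.mul (hc (hdiag 0))).add ((hdiag 1).mul (hc h01))
    have h2 := (hasDerivAt_const (0 : ℂ) (0 : ℂ)).congr_of_eventuallyEq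
      (hev.mono fun z hz => (?_ : P z 1 0 * conj (P (conj z) 0 0)
        + P z 1 1 * conj (P (conj z) 0 1) = 0))
    · have h3 := h1.unique h2
      simp only [map_zero, hnorm, Matrix.one_apply_eq, map_one, mul_one, zero_mul, add_zero,
        mul_zero, one_mul, zero_add] at h3
      rwa [eq_neg_of_add_eq_zero_left h3] at h
    · have := congrFun (congrFun (hP.mul_inv hz) 1) 0
      simpa [Matrix.mul_apply, Fin.sum_univ_two] using this
  fin_cases a <;> fin_cases b
  · exact hdiag 0
  · exact h01
  · exact h10
  · exact hdiag 1

end SolitonData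
end KaupNewell
end

/-! ### Parameter derivatives of rows and smooth dependence on x and t -/

noncomputable section

namespace KaupNewell

open Polynomial

lemma coeff_comp_neg_X (p : ℂ[X]) (n : ℕ) : (p.comp (-X)).coeff n = (-1) ^ n * p.coeff n := by
  have : (-X : ℂ[X]) = C (-1) * X := by simp
  rw [this, comp_C_mul_X_coeff, mul_comm]

/-! ### Polynomials depending on a parameter -/

/-- The coefficients of a family of polynomials of bounded degree are differentiable. -/
structure HasPolyDeriv (p : ℝ → ℂ[X]) (p' : ℂ[X]) (τ : ℝ) : Prop where
  bound : ∃ N, ∀ s, (p s).natDegree ≤ N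
  coeff : ∀ n, HasDerivAt (fun s => (p s).coeff n) (p'.coeff n) τ

namespace HasPolyDeriv

variable {p q : ℝ → ℂ[X]} {p' q' : ℂ[X]} {τ : ℝ}

lemma natDegree_le (h : HasPolyDeriv p p' τ) {N : ℕ} (hN : ∀ s, (p s).natDegree ≤ N) :
    p'.natDegree ≤ N := by
  rw [natDegree_le_iff_coeff_eq_zero]
  intro n hn
  refine (h.coeff n).unique ?_
  have : (fun s => (p s).coeff n) = fun _ => 0 :=
    funext fun s => coeff_eq_zero_of_natDegree_lt ((hN s).trans_lt hn)
  rw [this]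
  exact hasDerivAt_const _ _

/-- A uniform degree bound turns a linear functional into a fixed finite combination of
coefficients, so no continuity of the functional is needed. -/
lemma apply (h : HasPolyDeriv p p' τ) (φ : ℂ[X] →ₗ[ℂ] ℂ) :
    HasDerivAt (fun s => φ (p s)) (φ p') τ := by
  obtain ⟨N, hN⟩ := h.bound
  have e : ∀ {r : ℂ[X]}, r.natDegree ≤ N →
      φ r = ∑ n ∈ Finset.range (N + 1), r.coeff n * φ (X ^ n) := by
    intro r hr
    conv_lhs => rw [r.as_sum_range_C_mul_X_pow' (Nat.lt_succ_of_le hr)]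
    rw [map_sum]
    refine Finset.sum_congr rfl fun n _ => ?_
    rw [← smul_eq_C_mul, map_smul, smul_eq_mul]
  rw [e (h.natDegree_le hN)]
  have : (fun s => φ (p s)) = fun s => ∑ n ∈ Finset.range (N + 1), (p s).coeff n * φ (X ^ n) :=
    funext fun s => e (hN s)
  rw [this]
  exact HasDerivAt.fun_sum fun n _ => (h.coeff n).mul_const _

/-- Divisibility by a fixed monic polynomial is the vanishing of finitely many linear functionals,
namely the coefficients of the remainder, and so passes to the derivative. -/
lemma dvd (h : HasPolyDeriv p p' τ) {K : ℂ[X]} (hK : K.Monic) (hd : ∀ s, K ∣ p s) : K ∣ p' := by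
  rw [← modByMonic_eq_zero_iff_dvd hK]
  ext n
  refine (h.apply ((lcoeff ℂ n).comp (modByMonicHom K))).unique ?_
  have : (fun s => ((lcoeff ℂ n).comp (modByMonicHom K)) (p s)) = fun _ => 0 := by
    funext s
    simp [modByMonicHom, (modByMonic_eq_zero_iff_dvd hK).2 (hd s)]
  rw [this, coeff_zero]
  exact hasDerivAt_const _ _

lemma unique (h : HasPolyDeriv p p' τ) (h' : HasPolyDeriv p q' τ) : p' = q' := by
  ext n
  exact (h.coeff n).unique (h'.coeff n)

lemma const (P : ℂ[X]) : HasPolyDeriv (fun _ => P) 0 τ :=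
  ⟨⟨P.natDegree, fun _ => le_rfl⟩, fun n => by simpa using hasDerivAt_const τ (P.coeff n)⟩

lemma add (hp : HasPolyDeriv p p' τ) (hq : HasPolyDeriv q q' τ) :
    HasPolyDeriv (fun s => p s + q s) (p' + q') τ := by
  obtain ⟨N, hN⟩ := hp.bound
  obtain ⟨M, hM⟩ := hq.bound
  refine ⟨⟨max N M, fun s => (natDegree_add_le _ _).trans (max_le_max (hN s) (hM s))⟩, fun n => ?_⟩
  simpa using (hp.coeff n).fun_add (hq.coeff n)

lemma mul (hp : HasPolyDeriv p p' τ) (hq : HasPolyDeriv q q' τ) :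
    HasPolyDeriv (fun s => p s * q s) (p' * q τ + p τ * q') τ := by
  obtain ⟨N, hN⟩ := hp.bound
  obtain ⟨M, hM⟩ := hq.bound
  refine ⟨⟨N + M, fun s => natDegree_mul_le.trans (add_le_add (hN s) (hM s))⟩, fun n => ?_⟩
  simp only [coeff_mul, coeff_add, ← Finset.sum_add_distrib]
  exact HasDerivAt.fun_sum fun k _ => (hp.coeff k.1).mul (hq.coeff k.2)

lemma const_mul (P : ℂ[X]) (hq : HasPolyDeriv q q' τ) :
    HasPolyDeriv (fun s => P * q s) (P * q') τ := by
  simpa using (HasPolyDeriv.const P).mul hq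

lemma neg (hq : HasPolyDeriv q q' τ) : HasPolyDeriv (fun s => -q s) (-q') τ := by
  simpa using hq.const_mul (-1)

lemma sub (hp : HasPolyDeriv p p' τ) (hq : HasPolyDeriv q q' τ) :
    HasPolyDeriv (fun s => p s - q s) (p' - q') τ := by
  simpa [sub_eq_add_neg] using hp.add hq.neg

lemma sum {ι : Type*} {S : Finset ι} {p : ι → ℝ → ℂ[X]} {p' : ι → ℂ[X]}
    (h : ∀ i ∈ S, HasPolyDeriv (p i) (p' i) τ) :
    HasPolyDeriv (fun s => ∑ i ∈ S, p i s) (∑ i ∈ S, p' i) τ := by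
  classical
  induction S using Finset.induction_on with
  | empty => simpa using HasPolyDeriv.const 0
  | insert i S hi ih =>
    simp only [Finset.sum_insert hi]
    exact (h i (Finset.mem_insert_self i S)).add (ih fun j hj => h j (Finset.mem_insert_of_mem hj))

lemma C {f : ℝ → ℂ} {f' : ℂ} (h : HasDerivAt f f' τ) :
    HasPolyDeriv (fun s => Polynomial.C (f s)) (Polynomial.C f') τ := by
  refine ⟨⟨0, fun s => (natDegree_C _).le⟩, fun n => ?_⟩
  simp only [coeff_C]
  split_ifs
  · exact h
  · exact hasDerivAt_const _ _

lemma conjugate (hp : HasPolyDeriv p p' τ) :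
    HasPolyDeriv (fun s => conjPoly (p s)) (conjPoly p') τ := by
  obtain ⟨N, hN⟩ := hp.bound
  refine ⟨⟨N, fun s => by rw [natDegree_conjPoly]; exact hN s⟩, fun n => ?_⟩
  simp only [coeff_conjPoly]
  exact (hp.coeff n).star

lemma comp_neg_X (hp : HasPolyDeriv p p' τ) :
    HasPolyDeriv (fun s => (p s).comp (-X)) (p'.comp (-X)) τ := by
  obtain ⟨N, hN⟩ := hp.bound
  refine ⟨⟨N, fun s => by rw [natDegree_comp]; simpa using hN s⟩, fun n => ?_⟩
  simp only [coeff_comp_neg_X]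
  exact (hp.coeff n).const_mul _

end HasPolyDeriv

lemma exists_hasPolyDeriv {p : ℝ → ℂ[X]} {τ : ℝ} {N : ℕ} (hN : ∀ s, (p s).natDegree ≤ N)
    (h : ∀ n, DifferentiableAt ℝ (fun s => (p s).coeff n) τ) : ∃ p', HasPolyDeriv p p' τ := by
  refine ⟨∑ n ∈ Finset.range (N + 1), monomial n (deriv (fun s => (p s).coeff n) τ),
    ⟨N, hN⟩, fun n => ?_⟩
  simp only [finsetSum_coeff, coeff_monomial, Finset.sum_ite_eq', Finset.mem_range]
  split_ifs with hn
  · exact (h n).hasDerivAt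
  · have : (fun s => (p s).coeff n) = fun _ => 0 :=
      funext fun s => coeff_eq_zero_of_natDegree_lt (by have := hN s; omega)
    rw [this]
    exact hasDerivAt_const _ _

namespace SolitonData

variable {D : SolitonData}

/-- Derivatives of rows along an isospectral flow, corrected by the generator of the flow of the
kernel vectors, are rows. -/
lemma isRow_deriv {v : ℝ → Fin D.r → Fin 2 → ℂ[X]} {p : ℝ → Fin 2 → ℂ[X]} {τ : ℝ}
    (hp : ∀ s, D.IsRow (v s) (p s)) {p' : Fin 2 → ℂ[X]} {v' : Fin D.r → Fin 2 → ℂ[X]} {η : ℂ[X]}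
    (hp' : ∀ c, HasPolyDeriv (fun s => p s c) (p' c) τ)
    (hv' : ∀ i c, HasPolyDeriv (fun s => v s i c) (v' i c) τ)
    (hv0 : ∀ i, (X - C (D.zeta i)) ^ D.mult i ∣ v' i 0 + η * v τ i 0)
    (hv1 : ∀ i, (X - C (D.zeta i)) ^ D.mult i ∣ v' i 1 - η * v τ i 1)
    (hη : η.comp (-X) = η) (hη' : conjPoly η = -η) :
    D.IsRow (v τ) ![p' 0 - η * p τ 0, p' 1 + η * p τ 1] where
  even := by
    have h := (hp' 0).comp_neg_X
    simp only [(hp _).even] at h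
    simp [sub_comp, mul_comp, hη, (hp τ).even, h.unique (hp' 0)]
  odd := by
    have h := (hp' 1).comp_neg_X
    simp only [(hp _).odd] at h
    simp only [Matrix.cons_val_one, Matrix.cons_val_fin_one, add_comp, mul_comp, hη, (hp τ).odd,
      h.unique (hp' 1).neg]
    ring
  zeros i := by
    have h := (((hp' 0).mul (hv' i 0)).add ((hp' 1).mul (hv' i 1))).dvd
      ((monic_X_sub_C (D.zeta i)).pow _) fun s => (hp s).zeros i
    -- The differentiated condition contains p·v'. Modulo the given power v' is −ησ₃v, and moving η
    -- onto p gives the corrected row. At the conjugate points η^* = −η makes the same correction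
    -- work.
    have h2 := (h.sub ((hv0 i).mul_left (p τ 0))).sub ((hv1 i).mul_left (p τ 1))
    convert h2 using 1
    simp only [Matrix.cons_val_zero, Matrix.cons_val_one, Matrix.cons_val_fin_one]
    ring
  poles i := by
    have h := (((hp' 0).mul (hv' i 1).conjugate).sub ((hp' 1).mul (hv' i 0).conjugate)).dvd
      ((monic_X_sub_C (conj (D.zeta i))).pow _) fun s => (hp s).poles i
    have h0 := X_sub_C_pow_dvd_conjPoly (hv0 i)
    have h1 := X_sub_C_pow_dvd_conjPoly (hv1 i)
    simp only [map_add, map_sub, map_mul, hη'] at h0 h1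
    have h2 := (h.sub (h1.mul_left (p τ 0))).add (h0.mul_left (p τ 1))
    convert h2 using 1
    simp only [Matrix.cons_val_zero, Matrix.cons_val_one, Matrix.cons_val_fin_one]
    ring

/-! ### Smoothness -/

lemma contDiff_ketCoeff (hanalytic : ∀ i c, AnalyticAt ℂ (fun z => D.v0 i z c) (D.zeta i))
    (i : Fin D.r) (c : Fin 2) (a : ℕ) :
    ContDiff ℝ ∞ (fun p : ℝ × ℝ => D.ketCoeff p.1 p.2 i c a) := by
  have h := contDiff_taylorCoeff_exp (α := fun z => sgn c * (-Complex.I * z ^ 2))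
    (β := fun z => sgn c * (-2 * Complex.I * z ^ 6)) (c := D.zeta i) (by fun_prop) (by fun_prop) a
    (hanalytic i c)
  convert h using 4 with p z
  unfold ketCoeff
  congr 1
  funext z
  fin_cases c
  · simp [ket, sgn]
    left
    congr 1
    ring
  · simp [ket, sgn]
    left
    congr 1
    ring

lemma contDiff_conj {f : ℝ × ℝ → ℂ} (hf : ContDiff ℝ ∞ f) :
    ContDiff ℝ ∞ (fun p => conj (f p)) :=
  (Complex.conjCLE.contDiff (n := ∞)).comp hf

/-- Leibniz in both variables writes each entry as a finite sum of products of Taylor coefficients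
of the kernel vectors, their conjugates, and constants independent of x and t. -/
lemma contDiff_matM (hζ : ∀ i, D.zeta i ∈ C13)
    (hanalytic : ∀ i c, AnalyticAt ℂ (fun z => D.v0 i z c) (D.zeta i)) (q s : D.Index) :
    ContDiff ℝ ∞ (fun p : ℝ × ℝ => D.matM p.1 p.2 q s) := by
  have h1 : ∀ x t, D.matM x t q s = -∑ c, ∑ k ∈ Finset.range (q.2 + 1),
      taylorCoeff k (D.poleFun x t s c) (D.zeta q.1) * D.ketCoeff x t q.1 c (q.2 - k) := by
    intro x t
    have ha := fun c => analyticAt_poleFun x t s c (ne_conj_of_mem_C13 (hζ q.1) (hζ s.1))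
      (ne_neg_conj_of_mem_C13 (hζ q.1) (hζ s.1))
    have hk := fun c => analyticAt_ket hanalytic x t q.1 c
    rw [matM_apply_eq hζ hanalytic, taylorCoeff_sum fun c _ => (ha c).fun_mul (hk c)]
    congr 1
    refine Finset.sum_congr rfl fun c _ => ?_
    rw [taylorCoeff_mul (ha c) (hk c)]
    rfl
  simp only [h1]
  refine ContDiff.neg (ContDiff.sum fun c _ => ContDiff.sum fun k _ =>
    ContDiff.mul ?_ (contDiff_ketCoeff hanalytic _ _ _))
  have hz : D.zeta q.1 - conj (D.zeta s.1) ≠ 0 :=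
    sub_ne_zero.2 (ne_conj_of_mem_C13 (hζ q.1) (hζ s.1))
  have hz' : D.zeta q.1 + conj (D.zeta s.1) ≠ 0 := fun h =>
    ne_neg_conj_of_mem_C13 (hζ q.1) (hζ s.1) (eq_neg_of_add_eq_zero_left h)
  have h2 : ∀ x t, taylorCoeff k (D.poleFun x t s c) (D.zeta q.1)
      = ∑ a ∈ Finset.range (s.2 + 1), conj (D.ketCoeff x t s.1 c a) *
        taylorCoeff k (fun z => ((z - conj (D.zeta s.1)) ^ ((s.2 : ℕ) - a + 1))⁻¹
          - sgn c * ((-1) ^ ((s.2 : ℕ) - a) * ((z + conj (D.zeta s.1)) ^ ((s.2 : ℕ) - a + 1))⁻¹))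
          (D.zeta q.1) := by
    intro x t
    have ha : ∀ a, AnalyticAt ℂ (fun z => ((z - conj (D.zeta s.1)) ^ ((s.2 : ℕ) - a + 1))⁻¹
          - sgn c * ((-1) ^ ((s.2 : ℕ) - a) * ((z + conj (D.zeta s.1)) ^ ((s.2 : ℕ) - a + 1))⁻¹))
          (D.zeta q.1) := by
      intro a
      refine AnalyticAt.sub ?_ (analyticAt_const.mul (analyticAt_const.mul ?_))
      · exact AnalyticAt.inv (by fun_prop) (pow_ne_zero _ hz)
      · exact AnalyticAt.inv (by fun_prop) (pow_ne_zero _ hz')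
    unfold poleFun
    rw [taylorCoeff_sum fun a _ => analyticAt_const.fun_mul (ha a)]
    exact Finset.sum_congr rfl fun a _ => taylorCoeff_const_mul _ _
  simp only [h2]
  exact ContDiff.sum fun a _ => (contDiff_conj (contDiff_ketCoeff hanalytic _ _ _)).mul
    contDiff_const

lemma contDiff_det {ι : Type*} [Fintype ι] [DecidableEq ι] {A : ℝ × ℝ → Matrix ι ι ℂ}
    (hA : ∀ i j, ContDiff ℝ ∞ (fun p => A p i j)) : ContDiff ℝ ∞ (fun p => (A p).det) := by
  simp only [Matrix.det_apply']
  exact ContDiff.sum fun σ _ => contDiff_const.mul (contDiff_prod fun i _ => hA _ _)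

lemma contDiff_rowCoeff (hζ : ∀ i, D.zeta i ∈ C13)
    (hsq : ∀ i j, i ≠ j → D.zeta i ^ 2 ≠ D.zeta j ^ 2)
    (hanalytic : ∀ i c, AnalyticAt ℂ (fun z => D.v0 i z c) (D.zeta i))
    (hne : ∀ i, D.v0 i (D.zeta i) ≠ 0) (s : D.Index) :
    ContDiff ℝ ∞ (fun p : ℝ × ℝ => D.rowCoeff p.1 p.2 s) := by
  have hM := contDiff_matM hζ hanalytic
  have hadj : ∀ i j, ContDiff ℝ ∞ (fun p : ℝ × ℝ => (D.matM p.1 p.2).adjugate i j) := by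
    intro i j
    simp only [Matrix.adjugate_apply]
    refine contDiff_det fun k l => ?_
    simp only [Matrix.updateRow_apply]
    split_ifs
    · exact contDiff_const
    · exact hM k l
  have h1 : ∀ x t, D.rowCoeff x t s
      = ((D.matM x t).det)⁻¹ * ∑ l, (D.matM x t).adjugate s l * D.chi x t l := by
    intro x t
    rw [rowCoeff, Matrix.inv_def, Matrix.smul_mulVec, Ring.inverse_eq_inv', Pi.smul_apply,
      smul_eq_mul]
    rfl
  simp only [h1]
  exact ((contDiff_det hM).inv fun p => det_matM_ne_zero hζ hsq hanalytic hne p.1 p.2).mul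
    (ContDiff.sum fun l _ => (hadj s l).mul (contDiff_ketCoeff hanalytic l.1 0 l.2))

lemma contDiff_coeff_row (hζ : ∀ i, D.zeta i ∈ C13)
    (hsq : ∀ i j, i ≠ j → D.zeta i ^ 2 ≠ D.zeta j ^ 2)
    (hanalytic : ∀ i c, AnalyticAt ℂ (fun z => D.v0 i z c) (D.zeta i))
    (hne : ∀ i, D.v0 i (D.zeta i) ≠ 0) (c : Fin 2) (n : ℕ) :
    ContDiff ℝ ∞ (fun p : ℝ × ℝ => (D.row p.1 p.2 c).coeff n) := by
  have h1 : ∀ s m, ContDiff ℝ ∞ (fun p : ℝ × ℝ => (D.poleNum p.1 p.2 s c).coeff m) := by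
    intro s m
    simp only [poleNum, Finset.mul_sum, finsetSum_coeff]
    refine ContDiff.sum fun a _ => ?_
    simp only [mul_left_comm (D.cofactor s.1 s.2), coeff_C_mul]
    exact (contDiff_conj (contDiff_ketCoeff hanalytic _ _ _)).mul contDiff_const
  simp only [row, rowPoly, rowTerm, coeff_add, finsetSum_coeff, coeff_C_mul, coeff_comp_neg_X]
  exact contDiff_const.add (ContDiff.sum fun s _ =>
    (contDiff_rowCoeff hζ hsq hanalytic hne s).mul
      ((h1 s n).add (contDiff_const.mul (contDiff_const.mul (h1 s n)))))

lemma contDiff_quotient (hζ : ∀ i, D.zeta i ∈ C13)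
    (hsq : ∀ i j, i ≠ j → D.zeta i ^ 2 ≠ D.zeta j ^ 2)
    (hanalytic : ∀ i c, AnalyticAt ℂ (fun z => D.v0 i z c) (D.zeta i))
    (hne : ∀ i, D.v0 i (D.zeta i) ≠ 0) :
    ContDiff ℝ ∞ (fun p : ℝ × ℝ => D.quotient p.1 p.2) := by
  simp only [quotient_eq hζ hsq hanalytic hne]
  simp only [← coeff_zero_eq_eval_zero, div_eq_mul_inv]
  refine (contDiff_coeff_row hζ hsq hanalytic hne 1 1).mul
    ((contDiff_coeff_row hζ hsq hanalytic hne 0 0).inv fun p => ?_)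
  rw [coeff_zero_eq_eval_zero]
  exact row_eval_zero_ne_zero hζ hsq hanalytic hne p.1 p.2

end SolitonData
end KaupNewell
end

/-! ### Flow of the jets and normalization of the row -/

noncomputable section

namespace KaupNewell

open Polynomial

/-! ### Flows of the kernel vectors -/

/-- Differentiating exp(s·a + ξ)h in s multiplies it by a. For truncated Taylor polynomials this
stays true modulo (X − c)^n, since both sides are Taylor approximations of the same function. -/
lemma exists_hasPolyDeriv_taylor {a : ℂ[X]} {ξ : ℂ → ℂ} {c : ℂ} (hξ : AnalyticAt ℂ ξ c)
    {h : ℂ → ℂ} (hh : AnalyticAt ℂ h c) (n : ℕ) (τ : ℝ) :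
    ∃ J : ℂ[X], HasPolyDeriv (fun s : ℝ => ∑ k ∈ Finset.range n,
        C (SolitonData.taylorCoeff k (fun z => Complex.exp (s * a.eval z + ξ z) * h z) c)
          * (X - C c) ^ k) J τ ∧
      (X - C c) ^ n ∣ J - a * ∑ k ∈ Finset.range n,
        C (SolitonData.taylorCoeff k (fun z => Complex.exp (τ * a.eval z + ξ z) * h z) c)
          * (X - C c) ^ k := by
  have ha : AnalyticAt ℂ (fun z => a.eval z) c := AnalyticAt.aeval_polynomial analyticAt_id _
  refine ⟨_, HasPolyDeriv.sum fun k _ => (HasPolyDeriv.C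
    (SolitonData.hasDerivAt_taylorCoeff_exp ha hξ k hh τ)).mul (HasPolyDeriv.const _), ?_⟩
  have he : AnalyticAt ℂ (fun z => Complex.exp (τ * a.eval z + ξ z)) c :=
    ((analyticAt_const.fun_mul ha).fun_add hξ).cexp
  have h1 := SolitonData.vanishesAt_sub_taylor (he.fun_mul (ha.fun_mul hh)) n
  have h2 := (SolitonData.vanishesAt_sub_taylor (he.fun_mul hh) n).mul_left ha
  refine VanishesAt.dvd ((h2.sub h1).congr (Eventually.of_forall fun z => ?_))
  simp [eval_finsetSum]
  ring

namespace SolitonData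

variable {D : SolitonData}

lemma exists_hasPolyDeriv_jet_space
    (hanalytic : ∀ i c, AnalyticAt ℂ (fun z => D.v0 i z c) (D.zeta i)) (x t : ℝ) (i : Fin D.r)
    (c : Fin 2) : ∃ J, HasPolyDeriv (fun s => D.jet s t i c) J x ∧
      (X - C (D.zeta i)) ^ D.mult i ∣ J - C (-sgn c) * (C Complex.I * X ^ 2) * D.jet x t i c := by
  have hk : ∀ (s : ℝ) (a : ℕ), D.ketCoeff s t i c a = taylorCoeff a (fun z =>
      Complex.exp (s * (C (-sgn c) * (C Complex.I * X ^ 2) : ℂ[X]).eval z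
        + -sgn c * (2 * Complex.I * z ^ 6 * t)) * D.v0 i z c) (D.zeta i) := by
    intro s a
    unfold ketCoeff
    congr 1
    funext z
    fin_cases c <;> simp [ket, sgn] <;> left <;> congr 1 <;> ring
  simp only [jet, hk]
  exact exists_hasPolyDeriv_taylor (by fun_prop) (hanalytic i c) _ _

lemma exists_hasPolyDeriv_jet_time
    (hanalytic : ∀ i c, AnalyticAt ℂ (fun z => D.v0 i z c) (D.zeta i)) (x t : ℝ) (i : Fin D.r)
    (c : Fin 2) : ∃ J, HasPolyDeriv (fun s => D.jet x s i c) J t ∧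
      (X - C (D.zeta i)) ^ D.mult i ∣
        J - C (-sgn c) * (C (2 * Complex.I) * X ^ 6) * D.jet x t i c := by
  have hk : ∀ (s : ℝ) (a : ℕ), D.ketCoeff x s i c a = taylorCoeff a (fun z =>
      Complex.exp (s * (C (-sgn c) * (C (2 * Complex.I) * X ^ 6) : ℂ[X]).eval z
        + -sgn c * (Complex.I * z ^ 2 * x)) * D.v0 i z c) (D.zeta i) := by
    intro s a
    unfold ketCoeff
    congr 1
    funext z
    fin_cases c <;> simp [ket, sgn] <;> left <;> congr 1 <;> ring
  simp only [jet, hk]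
  exact exists_hasPolyDeriv_taylor (by fun_prop) (hanalytic i c) _ _

/-! ### The normalized row -/

/-- The numerator of the first row of the solution of the Riemann-Hilbert problem. -/
def nrow (D : SolitonData) (x t : ℝ) (c : Fin 2) : ℂ[X] :=
  C (D.poleDen.eval 0 / (D.row x t 0).eval 0) * D.row x t c

lemma IsRow.C_mul {v : Fin D.r → Fin 2 → ℂ[X]} {p : Fin 2 → ℂ[X]} (h : D.IsRow v p) (k : ℂ) :
    D.IsRow v (fun c => C k * p c) where
  even := by rw [mul_comp, C_comp, h.even]
  odd := by rw [mul_comp, C_comp, h.odd]; ring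
  zeros i := by
    have := (h.zeros i).mul_left (C k)
    convert this using 1
    ring
  poles i := by
    have := (h.poles i).mul_left (C k)
    convert this using 1
    ring

lemma natDegree_nrow_le (x t : ℝ) (c : Fin 2) :
    (D.nrow x t c).natDegree ≤ D.poleDen.natDegree :=
  (natDegree_C_mul_le _ _).trans (natDegree_rowPoly_le _ _ _ _ _)

lemma coeff_nrow_one (x t : ℝ) : (D.nrow x t 1).coeff D.poleDen.natDegree = 0 := by
  rw [nrow, coeff_C_mul, row, coeff_rowPoly _ _ _ _ _ le_rfl]
  simp

lemma poleDen_eval_zero_ne_zero (hζ : ∀ i, D.zeta i ∈ C13) : D.poleDen.eval 0 ≠ 0 :=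
  eval_poleDen_ne_zero D fun i => (notMem_nodes.1 (zero_notMem_nodes hζ) i).2

lemma zeroDen_eval_zero : D.zeroDen.eval 0 = conj (D.poleDen.eval 0) := by
  rw [← conjPoly_poleDen, eval_conjPoly, map_zero]

lemma IsRow.coeff_one_eq_zero {v : Fin D.r → Fin 2 → ℂ[X]} {p : Fin 2 → ℂ[X]} (h : D.IsRow v p) :
    (p 0).coeff 1 = 0 ∧ (p 1).coeff 0 = 0 := by
  have h0 := congrArg (fun q : ℂ[X] => q.coeff 1) h.even
  have h1 := congrArg (fun q : ℂ[X] => q.coeff 0) h.odd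
  simp only [coeff_comp_neg_X, coeff_neg] at h0 h1
  exact ⟨by linear_combination -h0 / 2, by linear_combination h1 / 2⟩

section main

variable (hζ : ∀ i, D.zeta i ∈ C13) (hsq : ∀ i j, i ≠ j → D.zeta i ^ 2 ≠ D.zeta j ^ 2)
  (hanalytic : ∀ i c, AnalyticAt ℂ (fun z => D.v0 i z c) (D.zeta i))
  (hne : ∀ i, D.v0 i (D.zeta i) ≠ 0) (x t : ℝ)

include hζ hsq hanalytic hne

lemma isRow_nrow : D.IsRow (D.jet x t) (D.nrow x t) :=
  (isRow_row hζ hsq hanalytic hne x t).C_mul _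

lemma coeff_zero_nrow : (D.nrow x t 0).coeff 0 = D.poleDen.eval 0 := by
  rw [nrow, coeff_C_mul, coeff_zero_eq_eval_zero,
    div_mul_cancel₀ _ (row_eval_zero_ne_zero hζ hsq hanalytic hne x t)]

lemma coeff_one_nrow : (D.nrow x t 1).coeff 1 = D.poleDen.eval 0 * D.quotient x t := by
  rw [nrow, coeff_C_mul, quotient_eq hζ hsq hanalytic hne]
  ring

/-- Rescaling by γ multiplies the product by |γ|². Comparing values at 0, where the normalized first
component is `poleDen`(0) and the second vanishes, forces |γ| = 1. -/
lemma nrow_inner : D.nrow x t 0 * conjPoly (D.nrow x t 0)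
    + D.nrow x t 1 * conjPoly (D.nrow x t 1) = D.fullDen := by
  have h := row_inner hζ hsq hanalytic hne x t
  set γ := D.poleDen.eval 0 / (D.row x t 0).eval 0 with hγ
  have h1 : D.nrow x t 0 * conjPoly (D.nrow x t 0) + D.nrow x t 1 * conjPoly (D.nrow x t 1)
      = C (γ * conj γ) * D.fullDen := by
    rw [← h, nrow, nrow, map_mul, map_mul, conjPoly_C, C_mul]
    ring
  have h2 := congrArg (fun q : ℂ[X] => q.coeff 0) h1
  simp only [coeff_add, mul_coeff_zero, coeff_C_zero, coeff_conjPoly, fullDen,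
    coeff_zero_nrow hζ hsq hanalytic hne, (isRow_nrow hζ hsq hanalytic hne x t).coeff_one_eq_zero.2,
    zero_mul, add_zero] at h2
  rw [coeff_zero_eq_eval_zero, coeff_zero_eq_eval_zero, zeroDen_eval_zero] at h2
  have h3 := poleDen_eval_zero_ne_zero hζ
  have h4 : D.poleDen.eval 0 * conj (D.poleDen.eval 0) ≠ 0 := mul_ne_zero h3 (by simpa using h3)
  rw [h1, show γ * conj γ = 1 from mul_right_cancel₀ h4 (by rw [one_mul]; exact h2.symm), C_1,
    one_mul]

lemma contDiff_coeff_nrow (c : Fin 2) (n : ℕ) :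
    ContDiff ℝ ∞ (fun p : ℝ × ℝ => (D.nrow p.1 p.2 c).coeff n) := by
  simp only [nrow, coeff_C_mul, ← coeff_zero_eq_eval_zero, div_eq_mul_inv]
  refine (contDiff_const.mul ((contDiff_coeff_row hζ hsq hanalytic hne 0 0).inv fun p => ?_)).mul
    (contDiff_coeff_row hζ hsq hanalytic hne c n)
  rw [coeff_zero_eq_eval_zero]
  exact row_eval_zero_ne_zero hζ hsq hanalytic hne p.1 p.2

lemma exists_hasPolyDeriv_nrow_space (c : Fin 2) :
    ∃ p', HasPolyDeriv (fun s => D.nrow s t c) p' x :=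
  exists_hasPolyDeriv (fun s => natDegree_nrow_le s t c) fun n =>
    (((contDiff_coeff_nrow hζ hsq hanalytic hne c n).comp
      (contDiff_id.prodMk contDiff_const : ContDiff ℝ ∞ fun s : ℝ => (s, t))).differentiable
        (by simp)).differentiableAt

lemma exists_hasPolyDeriv_nrow_time (c : Fin 2) :
    ∃ p', HasPolyDeriv (fun s => D.nrow x s c) p' t :=
  exists_hasPolyDeriv (fun s => natDegree_nrow_le x s c) fun n =>
    (((contDiff_coeff_nrow hζ hsq hanalytic hne c n).comp
      (contDiff_const.prodMk contDiff_id : ContDiff ℝ ∞ fun s : ℝ => (x, s))).differentiable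
        (by simp)).differentiableAt

end main

end SolitonData
end KaupNewell
end

/-! ### The space and time flows of the normalized row -/

noncomputable section

namespace KaupNewell

open Polynomial

/-- For the space flow, cross and inner products exceed deg K by at most 2 and vanish at 0, so two
scalars determine their quotients by K; these are read off from the lowest and the highest
coefficients. -/
lemma exists_quadratic {K S : ℂ[X]} (hK : K.Monic) (h : K ∣ S)
    (hS : S.natDegree ≤ K.natDegree + 2) (h0 : S.coeff 0 = 0) (hK0 : K.coeff 0 ≠ 0) :
    ∃ a b, S = (C a * X + C b * X ^ 2) * K ∧ S.coeff 1 = a * K.coeff 0 ∧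
      S.coeff 2 = a * K.coeff 1 + b * K.coeff 0 ∧ S.coeff (K.natDegree + 2) = b := by
  obtain ⟨Q, rfl⟩ := h
  have hQ : Q.natDegree ≤ 2 := by
    by_cases hQ0 : Q = 0
    · simp [hQ0]
    rw [hK.natDegree_mul' hQ0] at hS
    omega
  have hQ0 : Q.coeff 0 = 0 := by
    rw [mul_coeff_zero] at h0
    exact (mul_eq_zero.1 h0).resolve_left hK0
  have hQe : Q = C (Q.coeff 1) * X + C (Q.coeff 2) * X ^ 2 := by
    conv_lhs => rw [Q.as_sum_range_C_mul_X_pow' (Nat.lt_succ_of_le hQ)]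
    simp [Finset.sum_range_succ, hQ0]
  refine ⟨Q.coeff 1, Q.coeff 2, ?_, ?_, ?_, ?_⟩
  · rw [← hQe, mul_comm]
  · rw [mul_coeff_one, hQ0]
    ring
  · rw [coeff_mul, Finset.Nat.sum_antidiagonal_eq_sum_range_succ_mk]
    simp [Finset.sum_range_succ, hQ0]
    ring
  · rw [coeff_mul_add_eq_of_natDegree_le le_rfl hQ, hK.coeff_natDegree, one_mul]

lemma coeff_eq_zero_of_even {p : ℂ[X]} (h : p.comp (-X) = p) : p.coeff 1 = 0 := by
  have := congrArg (fun q : ℂ[X] => q.coeff 1) h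
  simp only [coeff_comp_neg_X] at this
  linear_combination -this / 2

lemma coeff_eq_zero_of_odd {p : ℂ[X]} (h : p.comp (-X) = -p) :
    p.coeff 0 = 0 ∧ p.coeff 2 = 0 := by
  have h0 := congrArg (fun q : ℂ[X] => q.coeff 0) h
  have h2 := congrArg (fun q : ℂ[X] => q.coeff 2) h
  simp only [coeff_comp_neg_X, coeff_neg] at h0 h2
  exact ⟨by linear_combination h0 / 2, by linear_combination h2 / 2⟩

namespace SolitonData

variable {D : SolitonData}

lemma fullDen_comp : D.fullDen.comp (-X) = D.fullDen := by
  rw [fullDen, mul_comp, poleDen_comp, ← conjPoly_poleDen, conjPoly_comp_neg_X, poleDen_comp]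

lemma coeff_zero_fullDen : D.fullDen.coeff 0 = D.poleDen.eval 0 * conj (D.poleDen.eval 0) := by
  rw [coeff_zero_eq_eval_zero, fullDen, eval_mul, zeroDen_eval_zero]

/-- The unimodular constant `poleDen(0) / zeroDen(0)`. -/
def phase (D : SolitonData) : ℂ := D.poleDen.eval 0 / conj (D.poleDen.eval 0)

lemma phase_mul_conj (hζ : ∀ i, D.zeta i ∈ C13) : D.phase * conj D.phase = 1 := by
  have h := poleDen_eval_zero_ne_zero hζ
  have h' : conj (D.poleDen.eval 0) ≠ 0 := by simpa using h
  rw [phase, map_div₀, Complex.conj_conj]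
  field_simp

lemma natDegree_sub_mul_le {p p' η : ℂ[X]} {N k : ℕ} (hp : p.natDegree ≤ N)
    (hp' : p'.natDegree ≤ N) (hη : η.natDegree ≤ k) :
    (p' - η * p).natDegree ≤ N + k ∧ (p' + η * p).natDegree ≤ N + k := by
  have h1 : (η * p).natDegree ≤ N + k := by
    refine natDegree_mul_le.trans ?_
    omega
  exact ⟨(natDegree_sub_le _ _).trans (max_le (by omega) h1),
    (natDegree_add_le _ _).trans (max_le (by omega) h1)⟩

section main

variable (hζ : ∀ i, D.zeta i ∈ C13) (hsq : ∀ i j, i ≠ j → D.zeta i ^ 2 ≠ D.zeta j ^ 2)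
  (hanalytic : ∀ i c, AnalyticAt ℂ (fun z => D.v0 i z c) (D.zeta i))
  (hne : ∀ i, D.v0 i (D.zeta i) ≠ 0) (x t : ℝ)

include hζ hsq hanalytic hne

/-- The top coefficient of `nrow_inner` is 1 on the side of the monic K, and the second component of
the row has lower degree. -/
lemma coeff_nrow_zero_mul_conj : (D.nrow x t 0).coeff D.poleDen.natDegree
    * conj ((D.nrow x t 0).coeff D.poleDen.natDegree) = 1 := by
  have hdeg := fun c => natDegree_nrow_le (D := D) x t c
  have hdeg' : ∀ c, (conjPoly (D.nrow x t c)).natDegree ≤ D.poleDen.natDegree := fun c => by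
    rw [natDegree_conjPoly]
    exact hdeg c
  have h := congrArg (fun q : ℂ[X] => q.coeff D.fullDen.natDegree)
    (nrow_inner hζ hsq hanalytic hne x t)
  simp only [D.monic_fullDen.coeff_natDegree] at h
  rw [natDegree_fullDen, coeff_add, coeff_mul_add_eq_of_natDegree_le (hdeg 0) (hdeg' 0),
    coeff_mul_add_eq_of_natDegree_le (hdeg 1) (hdeg' 1), coeff_nrow_one] at h
  simpa using h

/-- The flow of the first row in the space variable. -/
lemma hasPolyDeriv_nrow_space :
    HasPolyDeriv (fun s => D.nrow s t 0)
      (-(C (D.phase * D.soliton x t) * X * conjPoly (D.nrow x t 1))) x ∧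
    HasPolyDeriv (fun s => D.nrow s t 1)
      (C (-2 * Complex.I) * X ^ 2 * D.nrow x t 1
        + C (D.phase * D.soliton x t) * X * conjPoly (D.nrow x t 0)) x := by
  choose p' hp' using exists_hasPolyDeriv_nrow_space hζ hsq hanalytic hne x t
  choose v' hv' hv using fun i c => exists_hasPolyDeriv_jet_space hanalytic x t i c
  set p := D.nrow x t with hp
  set η : ℂ[X] := C Complex.I * X ^ 2 with hη
  set K := D.fullDen with hKdef
  have hrow : D.IsRow (D.jet x t) p := isRow_nrow hζ hsq hanalytic hne x t
  have hF := isRow_deriv (p := fun s => D.nrow s t) (v := fun s => D.jet s t) (τ := x) (η := η)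
    (fun s => isRow_nrow hζ hsq hanalytic hne s t) hp' hv'
    (fun i => by simpa [sgn] using hv i 0) (fun i => by simpa [sgn, sub_eq_add_neg] using hv i 1)
    (by simp [hη]) (by simp [hη])
  simp only [← hp] at hF
  set F0 := p' 0 - η * p 0 with hF0
  set F1 := p' 1 + η * p 1 with hF1
  have hv := exists_eval_jet_ne_zero hne x t
  have hd1 := hF.fullDen_dvd_cross hζ hsq hv hrow
  have hd2 := hF.fullDen_dvd_inner hζ hsq hv hrow
  simp only [Matrix.cons_val_zero, Matrix.cons_val_one, Matrix.cons_val_fin_one] at hd1 hd2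
  have hdeg := fun c => natDegree_nrow_le (D := D) x t c
  simp only [← hp] at hdeg
  have hdeg' := fun c => (hp' c).natDegree_le (fun s => natDegree_nrow_le s t c)
  have hdegc : ∀ c, (conjPoly (p c)).natDegree ≤ D.poleDen.natDegree := fun c => by
    rw [natDegree_conjPoly]
    exact hdeg c
  have hηd : η.natDegree ≤ 2 := natDegree_C_mul_X_pow_le _ _
  have hF0d := (natDegree_sub_mul_le (hdeg 0) (hdeg' 0) hηd).1
  have hF1d := (natDegree_sub_mul_le (hdeg 1) (hdeg' 1) hηd).2
  rw [← hF0] at hF0d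
  rw [← hF1] at hF1d
  have hKd : K.natDegree = D.poleDen.natDegree + D.poleDen.natDegree := natDegree_fullDen D
  have hDne := poleDen_eval_zero_ne_zero hζ
  have hDne' : conj (D.poleDen.eval 0) ≠ 0 := by simpa using hDne
  have hK0 : K.coeff 0 ≠ 0 := by
    rw [hKdef, coeff_zero_fullDen]
    exact mul_ne_zero hDne hDne'
  have hK1 : K.coeff 1 = 0 := coeff_eq_zero_of_even fullDen_comp
  -- The value of the first component at 0 is normalized to a constant, so its x-derivative has no
  -- constant term; the correction η vanishes at 0 as well.
  have hF00 : F0.coeff 0 = 0 := by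
    have h1 : (p' 0).coeff 0 = 0 := by
      refine ((hp' 0).coeff 0).unique ?_
      simp only [coeff_zero_nrow hζ hsq hanalytic hne]
      exact hasDerivAt_const _ _
    simp [hF0, h1, hη, mul_coeff_zero]
  have hF10 : F1.coeff 0 = 0 := by simpa using hF.coeff_one_eq_zero.2
  have hp10 : (p 1).coeff 0 = 0 := hrow.coeff_one_eq_zero.2
  have hF11 : F1.coeff 1 = D.poleDen.eval 0 * D.soliton x t := by
    have h1 : HasDerivAt (fun s => D.poleDen.eval 0 * D.quotient s t) ((p' 1).coeff 1) x := by
      have := (hp' 1).coeff 1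
      simpa only [coeff_one_nrow hζ hsq hanalytic hne] using this
    have h2 : HasDerivAt (fun s => D.quotient s t) (D.soliton x t) x := by
      refine DifferentiableAt.hasDerivAt ?_
      exact (((contDiff_quotient hζ hsq hanalytic hne).comp
        (contDiff_id.prodMk contDiff_const : ContDiff ℝ ∞ fun s : ℝ => (s, t))).differentiable
        (by simp)).differentiableAt
    simp [hF1, hη, mul_assoc, coeff_X_pow_mul', h1.unique (h2.const_mul _)]
  have hp00 : (p 0).coeff 0 = D.poleDen.eval 0 := coeff_zero_nrow hζ hsq hanalytic hne x t
  -- Oddness removes the quadratic term of the quotient. The linear one comes from the derivative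
  -- u_x = q of the coefficient of z in the second component.
  have hcross : F0 * p 1 - F1 * p 0 = -(C (D.phase * D.soliton x t) * X) * K := by
    obtain ⟨a, b, hS, h1, h2, -⟩ := exists_quadratic D.monic_fullDen hd1 (by
      rw [natDegree_fullDen]
      refine (natDegree_sub_le _ _).trans (max_le (natDegree_mul_le.trans ?_)
        (natDegree_mul_le.trans ?_))
      · have := hdeg 1; omega
      · have := hdeg 0; omega) (by simp [mul_coeff_zero, hF10, hp10]) hK0
    have hodd : (F0 * p 1 - F1 * p 0).comp (-X) = -(F0 * p 1 - F1 * p 0) := by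
      have e0 := hF.even
      have e1 := hF.odd
      simp only [Matrix.cons_val_zero, Matrix.cons_val_one, Matrix.cons_val_fin_one] at e0 e1
      rw [sub_comp, mul_comp, mul_comp, e0, e1, hrow.even, hrow.odd]
      ring
    rw [(coeff_eq_zero_of_odd hodd).2, ← hKdef, hK1, mul_zero, zero_add] at h2
    have hb : b = 0 := (mul_eq_zero.1 h2.symm).resolve_right hK0
    have ha : a = -(D.phase * D.soliton x t) := by
      rw [coeff_sub, mul_coeff_one, mul_coeff_one, hF00, hF10, hF11, hp10, hp00,
        coeff_zero_fullDen] at h1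
      rw [phase]
      field_simp
      refine mul_left_cancel₀ hDne ?_
      linear_combination -h1
    rw [hS, hb, ha, ← hKdef]
    simp
  -- Here the linear term drops out by parity, and the quadratic one is fixed by the top
  -- coefficients: the generator i z² acts on a leading coefficient of modulus 1.
  have hinner : F0 * conjPoly (p 0) + F1 * conjPoly (p 1) = C (-Complex.I) * X ^ 2 * K := by
    obtain ⟨a, b, hS, h1, -, h2⟩ := exists_quadratic D.monic_fullDen hd2 (by
      rw [natDegree_fullDen]
      refine (natDegree_add_le _ _).trans (max_le (natDegree_mul_le.trans ?_)
        (natDegree_mul_le.trans ?_))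
      · have := hdegc 0; omega
      · have := hdegc 1; omega) (by simp [mul_coeff_zero, hF00, hF10]) hK0
    have hp01 : (p 0).coeff 1 = 0 := hrow.coeff_one_eq_zero.1
    have ha : a = 0 := by
      rw [coeff_add, mul_coeff_one, mul_coeff_one, hF00, hF10] at h1
      have hF01 : F0.coeff 1 = 0 := by simpa using hF.coeff_one_eq_zero.1
      simp only [hF01, coeff_conjPoly, hp10, map_zero, zero_mul, mul_zero, add_zero] at h1
      exact (mul_eq_zero.1 h1.symm).resolve_right hK0
    have hb : b = -Complex.I := by
      rw [natDegree_fullDen, add_right_comm, coeff_add,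
        coeff_mul_add_eq_of_natDegree_le hF0d (hdegc 0),
        coeff_mul_add_eq_of_natDegree_le hF1d (hdegc 1)] at h2
      have h3 : F0.coeff (D.poleDen.natDegree + 2)
          = -Complex.I * (p 0).coeff D.poleDen.natDegree := by
        have h4 : (p' 0).coeff (D.poleDen.natDegree + 2) = 0 :=
          coeff_eq_zero_of_natDegree_lt (by have := hdeg' 0; omega)
        simp [hF0, hη, h4, mul_assoc, coeff_X_pow_mul']
      have h5 : (p 1).coeff D.poleDen.natDegree = 0 := coeff_nrow_one x t
      have h6 := coeff_nrow_zero_mul_conj hζ hsq hanalytic hne x t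
      rw [h3, coeff_conjPoly, coeff_conjPoly, h5, map_zero, mul_zero, add_zero] at h2
      rw [← hp] at h6
      linear_combination -h2 - Complex.I * h6
    rw [hS, hb, ha, ← hKdef]
    simp
  have hK : p 0 * conjPoly (p 0) + p 1 * conjPoly (p 1) = K :=
    nrow_inner hζ hsq hanalytic hne x t
  have hKne : K ≠ 0 := D.monic_fullDen.ne_zero
  -- The row F is recovered from its products: K F₀ = p₀(F₀p₀^* + F₁p₁^*) + p₁^*(F₀p₁ − F₁p₀), and
  -- similarly for F₁. Undoing the correction η gives the flow.
  have e0 : p' 0 = -(C (D.phase * D.soliton x t) * X * conjPoly (p 1)) := by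
    refine mul_right_cancel₀ hKne ?_
    have : p' 0 = F0 + η * p 0 := by rw [hF0]; ring
    rw [this]
    rw [C_neg] at hinner
    linear_combination -F0 * hK + p 0 * hinner + conjPoly (p 1) * hcross
  have e1 : p' 1 = C (-2 * Complex.I) * X ^ 2 * p 1
      + C (D.phase * D.soliton x t) * X * conjPoly (p 0) := by
    refine mul_right_cancel₀ hKne ?_
    have : p' 1 = F1 - η * p 1 := by rw [hF1]; ring
    rw [this, hη, C_mul, C_neg, map_ofNat]
    rw [C_neg] at hinner
    linear_combination -F1 * hK + p 1 * hinner - conjPoly (p 0) * hcross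
  rw [← e0, ← e1]
  exact ⟨hp' 0, hp' 1⟩

/-- The flow of the first row in the time variable. -/
lemma exists_nrow_time : ∃ T L : ℂ[X], T.natDegree ≤ D.fullDen.natDegree ∧ L.natDegree ≤ 6 ∧
    L.coeff 1 = dt D.quotient x t ∧
    C (conj D.phase) * T
      + C (-2 * Complex.I) * X ^ 6 * (C (-2 * conj D.phase) * (D.nrow x t 0 * D.nrow x t 1))
      = D.fullDen * L := by
  choose p' hp' using exists_hasPolyDeriv_nrow_time hζ hsq hanalytic hne x t
  choose v' hv' hv using fun i c => exists_hasPolyDeriv_jet_time hanalytic x t i c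
  set p := D.nrow x t with hp
  set η : ℂ[X] := C (2 * Complex.I) * X ^ 6 with hη
  set K := D.fullDen with hKdef
  have hrow : D.IsRow (D.jet x t) p := isRow_nrow hζ hsq hanalytic hne x t
  have hF := isRow_deriv (p := fun s => D.nrow x s) (v := fun s => D.jet x s) (τ := t) (η := η)
    (fun s => isRow_nrow hζ hsq hanalytic hne x s) hp' hv'
    (fun i => by simpa [sgn] using hv i 0) (fun i => by simpa [sgn, sub_eq_add_neg] using hv i 1)
    (by simp [hη, Even.neg_pow (show Even 6 by decide)]) (by
      simp only [hη, map_mul, conjPoly_C, map_pow, conjPoly_X, Complex.conj_I, map_ofNat]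
      simp)
  simp only [← hp] at hF
  set F0 := p' 0 - η * p 0 with hF0
  set F1 := p' 1 + η * p 1 with hF1
  -- The full time flow is not needed. The cross product with p alone already involves u_t through
  -- its coefficient of z.
  have hd := hF.fullDen_dvd_cross hζ hsq (exists_eval_jet_ne_zero hne x t) hrow
  simp only [Matrix.cons_val_zero, Matrix.cons_val_one, Matrix.cons_val_fin_one] at hd
  have hdeg := fun c => natDegree_nrow_le (D := D) x t c
  simp only [← hp] at hdeg
  have hdeg' := fun c => (hp' c).natDegree_le (fun s => natDegree_nrow_le x s c)
  have hηd : η.natDegree ≤ 6 := natDegree_C_mul_X_pow_le _ _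
  have hF0d := (natDegree_sub_mul_le (hdeg 0) (hdeg' 0) hηd).1
  have hF1d := (natDegree_sub_mul_le (hdeg 1) (hdeg' 1) hηd).2
  rw [← hF0] at hF0d
  rw [← hF1] at hF1d
  have hKd : K.natDegree = D.poleDen.natDegree + D.poleDen.natDegree := natDegree_fullDen D
  have hDne := poleDen_eval_zero_ne_zero hζ
  have hDne' : conj (D.poleDen.eval 0) ≠ 0 := by simpa using hDne
  have hK1 : K.coeff 1 = 0 := coeff_eq_zero_of_even fullDen_comp
  have hF10 : F1.coeff 0 = 0 := by simpa using hF.coeff_one_eq_zero.2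
  have hp10 : (p 1).coeff 0 = 0 := hrow.coeff_one_eq_zero.2
  have hF00 : F0.coeff 0 = 0 := by
    have h1 : (p' 0).coeff 0 = 0 := by
      refine ((hp' 0).coeff 0).unique ?_
      simp only [coeff_zero_nrow hζ hsq hanalytic hne]
      exact hasDerivAt_const _ _
    simp [hF0, h1, hη, mul_coeff_zero]
  have hF11 : F1.coeff 1 = D.poleDen.eval 0 * dt D.quotient x t := by
    have h1 : HasDerivAt (fun s => D.poleDen.eval 0 * D.quotient x s) ((p' 1).coeff 1) t := by
      have := (hp' 1).coeff 1
      simpa only [coeff_one_nrow hζ hsq hanalytic hne] using this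
    have h2 : HasDerivAt (fun s => D.quotient x s) (dt D.quotient x t) t := by
      refine DifferentiableAt.hasDerivAt ?_
      exact (((contDiff_quotient hζ hsq hanalytic hne).comp
        (contDiff_const.prodMk contDiff_id : ContDiff ℝ ∞ fun s : ℝ => (x, s))).differentiable
        (by simp)).differentiableAt
    simp [hF1, hη, mul_assoc, coeff_X_pow_mul', h1.unique (h2.const_mul _)]
  have hp00 : (p 0).coeff 0 = D.poleDen.eval 0 := coeff_zero_nrow hζ hsq hanalytic hne x t
  obtain ⟨Q, hQ⟩ := hd
  have hQd : Q.natDegree ≤ 6 := by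
    have h1 : (F0 * p 1 - F1 * p 0).natDegree ≤ K.natDegree + 6 := by
      rw [hKd]
      refine (natDegree_sub_le _ _).trans (max_le (natDegree_mul_le.trans ?_)
        (natDegree_mul_le.trans ?_))
      · have := hdeg 1; omega
      · have := hdeg 0; omega
    by_cases hQ0 : Q = 0
    · simp [hQ0]
    rw [hQ, D.monic_fullDen.natDegree_mul' hQ0, ← hKdef] at h1
    omega
  -- T is the Wronskian of the two components in t, and L is −κ^* times the quotient of the cross
  -- product by K; this scaling makes the coefficient of z in L equal to u_t.
  refine ⟨p 0 * p' 1 - p 1 * p' 0, C (-conj D.phase) * Q, ?_, ?_, ?_, ?_⟩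
  · rw [hKd]
    refine (natDegree_sub_le _ _).trans (max_le (natDegree_mul_le.trans ?_)
      (natDegree_mul_le.trans ?_))
    · exact add_le_add (hdeg 0) (hdeg' 1)
    · exact add_le_add (hdeg 1) (hdeg' 0)
  · exact (natDegree_C_mul_le _ _).trans hQd
  · have h1 := congrArg (fun q : ℂ[X] => q.coeff 1) hQ
    simp only [coeff_sub, mul_coeff_one] at h1
    rw [hF00, hF10, hF11, hp10, hp00, ← hKdef, hK1, hKdef, coeff_zero_fullDen] at h1
    rw [coeff_C_mul, phase, map_div₀, Complex.conj_conj]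
    field_simp
    refine mul_left_cancel₀ hDne ?_
    linear_combination h1
  · have : K * (C (-conj D.phase) * Q) = C (-conj D.phase) * (K * Q) := by ring
    rw [this, ← hQ, hF0, hF1, hη]
    simp only [C_mul, C_neg, map_ofNat]
    ring

end main

end SolitonData
end KaupNewell
end

/-! ### Expansions at infinity and the recursion for squared eigenfunctions -/

noncomputable section

namespace KaupNewell

open Polynomial

/-! ### Expansions at infinity -/

/-- The expansion of `p / K` in powers of the inverse of the variable, for `p` of degree at most
that of `K`. -/
def expandInfty (K p : ℂ[X]) : PowerSeries ℂ :=
  (reflect K.natDegree p : PowerSeries ℂ) * (reflect K.natDegree K : PowerSeries ℂ)⁻¹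

section expand

variable {K : ℂ[X]} (hK : K.Monic)
include hK

lemma reflect_mul_inv : (reflect K.natDegree K : PowerSeries ℂ)
    * (reflect K.natDegree K : PowerSeries ℂ)⁻¹ = 1 := by
  refine PowerSeries.mul_inv_cancel _ ?_
  rw [← PowerSeries.coeff_zero_eq_constantCoeff_apply, Polynomial.coeff_coe, coeff_reflect,
    revAt_zero, hK.coeff_natDegree]
  exact one_ne_zero

lemma coeff_zero_expandInfty (p : ℂ[X]) :
    PowerSeries.coeff 0 (expandInfty K p) = p.coeff K.natDegree := by
  have h := congrArg PowerSeries.constantCoeff (reflect_mul_inv hK)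
  have hc : ∀ q : ℂ[X], PowerSeries.constantCoeff (reflect K.natDegree q : PowerSeries ℂ)
      = q.coeff K.natDegree := fun q => by
    rw [← PowerSeries.coeff_zero_eq_constantCoeff_apply, Polynomial.coeff_coe, coeff_reflect,
      revAt_zero]
  rw [map_mul, hc, hK.coeff_natDegree, one_mul, map_one] at h
  rw [expandInfty, PowerSeries.coeff_zero_eq_constantCoeff_apply, map_mul, hc, h, mul_one]

lemma expandInfty_quadratic {A B E : ℂ[X]} (hA : A.natDegree ≤ K.natDegree)
    (hB : B.natDegree ≤ K.natDegree) (hE : E.natDegree ≤ K.natDegree) (h : A * A + B * E = K * K) :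
    expandInfty K A * expandInfty K A + expandInfty K B * expandInfty K E = 1 := by
  have h1 := congrArg (fun p : ℂ[X] => (reflect (K.natDegree + K.natDegree) p : PowerSeries ℂ)) h
  simp only [reflect_add, reflect_mul A A hA hA, reflect_mul B E hB hE, reflect_mul K K le_rfl le_rfl,
    coe_add, coe_mul] at h1
  have h2 := reflect_mul_inv hK
  simp only [expandInfty]
  set k := (reflect K.natDegree K : PowerSeries ℂ)
  linear_combination (k⁻¹) ^ 2 * h1 + (k * k⁻¹ + 1) * h2

end expand

/-- Reflection at degree 2 + deg K substitutes z = 1/X and clears denominators: z² becomes 1, z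
becomes X, and the left side acquires X². -/
lemma expandInfty_linear {K A B B' : ℂ[X]} {α β : ℂ} (hA : A.natDegree ≤ K.natDegree)
    (hB : B.natDegree ≤ K.natDegree) (hB' : B'.natDegree ≤ K.natDegree)
    (h : B' = C α * X ^ 2 * B + C β * X * A) :
    PowerSeries.X ^ 2 * expandInfty K B'
      = PowerSeries.C α * expandInfty K B + PowerSeries.C β * (PowerSeries.X * expandInfty K A) := by
  have h1 := congrArg (fun p : ℂ[X] => (reflect (2 + K.natDegree) p : PowerSeries ℂ)) h
  have e1 : reflect 2 (1 : ℂ[X]) = X ^ 2 := by simp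
  have e2 : reflect 2 (C α * X ^ 2 : ℂ[X]) = C α := by
    rw [reflect_C_mul_X_pow, revAt_le le_rfl]
    simp
  have e3 : reflect 2 (C β * X : ℂ[X]) = C β * X := by
    have := reflect_C_mul_X_pow 2 1 (c := β)
    rw [revAt_le (by norm_num)] at this
    simpa using this
  have e0 := reflect_mul 1 B' (F := 2) (by simp) hB'
  rw [one_mul] at e0
  have hd : (C β * X : ℂ[X]).natDegree ≤ 2 := (by simpa using natDegree_C_mul_X_pow_le β 1 : (C β * X : ℂ[X]).natDegree ≤ 1).trans one_le_two
  simp only [reflect_add, e0, reflect_mul _ B (natDegree_C_mul_X_pow_le α 2) hB,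
    reflect_mul _ A hd hA, e1, e2, e3, coe_add, coe_mul, coe_C, coe_X, coe_pow] at h1
  simp only [expandInfty, ← mul_assoc, h1]
  ring

/-- Division by K gives αT/K + βz⁶B/K = L. The first term is bounded at infinity, so the coefficient
of z on the right comes only from the z⁻⁵ coefficient of B/K. -/
lemma coeff_expandInfty_of_time {K B T L : ℂ[X]} (hK : K.Monic) {α β : ℂ}
    (hB : B.natDegree ≤ K.natDegree) (hT : T.natDegree ≤ K.natDegree) (hL : L.natDegree ≤ 6)
    (h : C α * T + C β * X ^ 6 * B = K * L) :
    β * PowerSeries.coeff 5 (expandInfty K B) = L.coeff 1 := by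
  have h1 := congrArg (fun p : ℂ[X] => (reflect (6 + K.natDegree) p : PowerSeries ℂ)) h
  have e1 : reflect 6 (C α : ℂ[X]) = C α * X ^ 6 := reflect_C _ _
  have e2 : reflect 6 (C β * X ^ 6 : ℂ[X]) = C β := by
    rw [reflect_C_mul_X_pow, revAt_le le_rfl]
    simp
  have e0 := reflect_mul L K (F := 6) hL le_rfl
  rw [mul_comm] at e0
  simp only [reflect_add, e0, reflect_mul _ B (natDegree_C_mul_X_pow_le β 6) hB,
    reflect_mul (C α) T ((natDegree_C α).le.trans (Nat.zero_le 6)) hT, e1, e2, coe_add, coe_mul,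
    coe_C, coe_X, coe_pow] at h1
  have h2 : PowerSeries.X ^ 6 * (PowerSeries.C α * expandInfty K T)
      + PowerSeries.C β * expandInfty K B = (reflect 6 L : PowerSeries ℂ) := by
    have h2 := reflect_mul_inv hK
    simp only [expandInfty]
    set k := (reflect K.natDegree K : PowerSeries ℂ)
    linear_combination k⁻¹ * h1 + (reflect 6 L : PowerSeries ℂ) * h2
  have h3 := congrArg (PowerSeries.coeff 5) h2
  rw [map_add, PowerSeries.coeff_X_pow_mul', if_neg (by norm_num), zero_add,
    PowerSeries.coeff_C_mul, Polynomial.coeff_coe, coeff_reflect, revAt_le (by norm_num)] at h3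
  exact h3

lemma HasPolyDeriv.expandInfty {p : ℝ → ℂ[X]} {p' : ℂ[X]} {τ : ℝ} (h : HasPolyDeriv p p' τ)
    (K : ℂ[X]) (n : ℕ) :
    HasDerivAt (fun s => PowerSeries.coeff n (expandInfty K (p s)))
      (PowerSeries.coeff n (KaupNewell.expandInfty K p')) τ := by
  simp only [KaupNewell.expandInfty, PowerSeries.coeff_mul, Polynomial.coeff_coe, coeff_reflect]
  exact HasDerivAt.fun_sum fun k _ => (h.coeff _).mul_const _

/-! ### The first coefficients of the squared eigenfunctions -/

/-- The recursion for the expansions of the squared eigenfunctions of the Kaup-Newell spectral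
problem, solved up to the fifth order. -/
lemma coeff_five_eq {a b c : ℝ → PowerSeries ℂ} {q r q₁ r₁ : ℝ → ℂ} {q₂ : ℂ} {τ : ℝ}
    (ha : ∀ s, PowerSeries.coeff 0 (a s) = 1)
    (hq : ∀ s, HasDerivAt q (q₁ s) s) (hr : ∀ s, HasDerivAt r (r₁ s) s)
    (hq₁ : HasDerivAt q₁ q₂ τ)
    (habc : ∀ s, a s * a s + b s * c s = 1)
    (hb : ∀ s, ∃ b', (∀ n, HasDerivAt (fun s => PowerSeries.coeff n (b s))
        (PowerSeries.coeff n b') s) ∧ PowerSeries.X ^ 2 * b'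
          = PowerSeries.C (-2 * Complex.I) * b s
            + PowerSeries.C (-2 * q s) * (PowerSeries.X * a s))
    (hc : ∀ s, ∃ c', (∀ n, HasDerivAt (fun s => PowerSeries.coeff n (c s))
        (PowerSeries.coeff n c') s) ∧ PowerSeries.X ^ 2 * c'
          = PowerSeries.C (2 * Complex.I) * c s
            + PowerSeries.C (2 * r s) * (PowerSeries.X * a s)) :
    -2 * Complex.I * PowerSeries.coeff 5 (b τ)
      = -(1 / 2) * q₂ + (3 * Complex.I / 2) * (q τ * r τ * q₁ τ) + (3 / 4) * (q τ ^ 3 * r τ ^ 2) := by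
  have hI : Complex.I ≠ 0 := Complex.I_ne_zero
  have hI2 : Complex.I * Complex.I = -1 := Complex.I_mul_I
  choose b' hb' hbX using hb
  choose c' hc' hcX using hc
  have cX : ∀ (n : ℕ) (φ : PowerSeries ℂ),
      PowerSeries.coeff (n + 2) (PowerSeries.X ^ 2 * φ) = PowerSeries.coeff n φ :=
    fun n φ => PowerSeries.coeff_X_pow_mul φ 2 n
  have b0 : ∀ s, PowerSeries.coeff 0 (b s) = 0 := by
    intro s
    have := congrArg (PowerSeries.coeff 0) (hbX s)
    simp only [PowerSeries.coeff_X_pow_mul', map_add, PowerSeries.coeff_C_mul,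
      PowerSeries.coeff_zero_X_mul] at this
    simpa [hI] using this
  have c0 : ∀ s, PowerSeries.coeff 0 (c s) = 0 := by
    intro s
    have := congrArg (PowerSeries.coeff 0) (hcX s)
    simp only [PowerSeries.coeff_X_pow_mul', map_add, PowerSeries.coeff_C_mul,
      PowerSeries.coeff_zero_X_mul] at this
    simpa [hI] using this
  have b1 : ∀ s, PowerSeries.coeff 1 (b s) = Complex.I * q s := by
    intro s
    have := congrArg (PowerSeries.coeff (0 + 1)) (hbX s)
    simp only [PowerSeries.coeff_X_pow_mul', map_add, PowerSeries.coeff_C_mul,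
      PowerSeries.coeff_succ_X_mul, ha] at this
    norm_num at this
    linear_combination (-Complex.I / 2) * this + PowerSeries.coeff 1 (b s) * hI2
  have c1 : ∀ s, PowerSeries.coeff 1 (c s) = Complex.I * r s := by
    intro s
    have := congrArg (PowerSeries.coeff (0 + 1)) (hcX s)
    simp only [PowerSeries.coeff_X_pow_mul', map_add, PowerSeries.coeff_C_mul,
      PowerSeries.coeff_succ_X_mul, ha] at this
    norm_num at this
    linear_combination (Complex.I / 2) * this + PowerSeries.coeff 1 (c s) * hI2
  have bn : ∀ n s, PowerSeries.coeff n (b' s) = -2 * Complex.I * PowerSeries.coeff (n + 2) (b s)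
      - 2 * q s * PowerSeries.coeff (n + 1) (a s) := by
    intro n s
    have := congrArg (PowerSeries.coeff (n + 1 + 1)) (hbX s)
    rw [cX, map_add, PowerSeries.coeff_C_mul, PowerSeries.coeff_C_mul,
      PowerSeries.coeff_succ_X_mul] at this
    rw [this]
    ring
  have cn : ∀ n s, PowerSeries.coeff n (c' s) = 2 * Complex.I * PowerSeries.coeff (n + 2) (c s)
      + 2 * r s * PowerSeries.coeff (n + 1) (a s) := by
    intro n s
    have := congrArg (PowerSeries.coeff (n + 1 + 1)) (hcX s)
    rw [cX, map_add, PowerSeries.coeff_C_mul, PowerSeries.coeff_C_mul,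
      PowerSeries.coeff_succ_X_mul] at this
    rw [this]
  -- The coefficients of a are obtained algebraically from a² + bc = 1, so no integration in x and
  -- no integration constants occur.
  have quad : ∀ n s, ∑ k ∈ Finset.range (n + 1),
      (PowerSeries.coeff k (a s) * PowerSeries.coeff (n - k) (a s)
        + PowerSeries.coeff k (b s) * PowerSeries.coeff (n - k) (c s)) = if n = 0 then 1 else 0 := by
    intro n s
    have := congrArg (PowerSeries.coeff n) (habc s)
    rw [map_add, PowerSeries.coeff_mul, PowerSeries.coeff_mul, PowerSeries.coeff_one,
      Finset.Nat.sum_antidiagonal_eq_sum_range_succ_mk,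
      Finset.Nat.sum_antidiagonal_eq_sum_range_succ_mk, ← Finset.sum_add_distrib] at this
    exact this
  have a1 : ∀ s, PowerSeries.coeff 1 (a s) = 0 := by
    intro s
    have := quad 1 s
    simpa [Finset.sum_range_succ, ha, b0, c0] using this
  have b2 : ∀ s, PowerSeries.coeff 2 (b s) = 0 := by
    intro s
    -- The zeroth coefficient of b vanishes for every s, hence so does its derivative.
    have h1 : PowerSeries.coeff 0 (b' s) = 0 := by
      have := hb' s 0
      simp only [b0] at this
      exact this.unique (hasDerivAt_const _ _)
    have := bn 0 s
    rw [h1, zero_add, zero_add, a1] at this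
    simpa [hI] using this
  have c2 : ∀ s, PowerSeries.coeff 2 (c s) = 0 := by
    intro s
    have h1 : PowerSeries.coeff 0 (c' s) = 0 := by
      have := hc' s 0
      simp only [c0] at this
      exact this.unique (hasDerivAt_const _ _)
    have := cn 0 s
    rw [h1, zero_add, zero_add, a1] at this
    simpa [hI] using this
  have a2 : ∀ s, PowerSeries.coeff 2 (a s) = q s * r s / 2 := by
    intro s
    have := quad 2 s
    simp [Finset.sum_range_succ, ha, b0, c0, a1, b1, c1] at this
    linear_combination this / 2 - q s * r s / 2 * hI2
  have a3 : ∀ s, PowerSeries.coeff 3 (a s) = 0 := by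
    intro s
    have := quad 3 s
    simpa [Finset.sum_range_succ, ha, b0, c0, a1, b2, c2] using this
  have b3 : ∀ s, PowerSeries.coeff 3 (b s)
      = -q₁ s / 2 + Complex.I / 2 * (q s ^ 2 * r s) := by
    intro s
    have h1 : PowerSeries.coeff 1 (b' s) = Complex.I * q₁ s := by
      have := hb' s 1
      simp only [b1] at this
      exact this.unique ((hq s).const_mul _)
    have := bn 1 s
    rw [h1, a2] at this
    norm_num at this
    linear_combination (-Complex.I / 2) * this + (q₁ s / 2 + PowerSeries.coeff 3 (b s)) * hI2
  have c3 : ∀ s, PowerSeries.coeff 3 (c s)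
      = r₁ s / 2 + Complex.I / 2 * (q s * r s ^ 2) := by
    intro s
    have h1 : PowerSeries.coeff 1 (c' s) = Complex.I * r₁ s := by
      have := hc' s 1
      simp only [c1] at this
      exact this.unique ((hr s).const_mul _)
    have := cn 1 s
    rw [h1, a2] at this
    norm_num at this
    linear_combination (Complex.I / 2) * this + (-r₁ s / 2 + PowerSeries.coeff 3 (c s)) * hI2
  have a4 : ∀ s, PowerSeries.coeff 4 (a s) = 3 / 8 * (q s ^ 2 * r s ^ 2)
      - Complex.I / 4 * (q s * r₁ s - r s * q₁ s) := by
    intro s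
    have := quad 4 s
    simp [Finset.sum_range_succ, ha, b0, c0, a1, b1, c1, a2, b2, c2, a3, b3, c3] at this
    linear_combination this / 2 - q s ^ 2 * r s ^ 2 / 2 * hI2
  have h1 : PowerSeries.coeff 3 (b' τ)
      = -q₂ / 2 + Complex.I / 2 * (2 * q τ * q₁ τ * r τ + q τ ^ 2 * r₁ τ) := by
    have := hb' τ 3
    simp only [b3] at this
    refine this.unique ?_
    have h2 := (hq₁.neg.div_const 2).add ((((hq τ).pow 2).mul (hr τ)).const_mul (Complex.I / 2))
    refine h2.congr_deriv ?_
    simp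
  -- At order 3 the linear relation gives b₅ from the derivative of b₃ and from a₄; the terms with
  -- r' in the two cancel.
  have h2 := bn 3 τ
  rw [h1, a4] at h2
  norm_num at h2
  linear_combination -h2

end KaupNewell
end

/-! ### Partial derivatives, the expanded equation and the Lax pair -/

noncomputable section

namespace KaupNewell

/-! ### Partial derivatives of smooth functions -/

section partial_deriv

variable {f : ℝ → ℝ → ℂ} (hf : ContDiff ℝ ∞ (fun p : ℝ × ℝ => f p.1 p.2))
include hf

lemma hasDerivAt_fderiv_space (x t : ℝ) : HasDerivAt (fun y => f y t)
    (fderiv ℝ (fun p : ℝ × ℝ => f p.1 p.2) (x, t) (1, 0)) x := by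
  have h := (hf.differentiable (by simp) (x, t)).hasFDerivAt
  exact h.comp_hasDerivAt (f := fun y : ℝ => (y, t)) x
    ((hasDerivAt_id x).prodMk (hasDerivAt_const x t))

lemma hasDerivAt_fderiv_time (x t : ℝ) : HasDerivAt (fun s => f x s)
    (fderiv ℝ (fun p : ℝ × ℝ => f p.1 p.2) (x, t) (0, 1)) t := by
  have h := (hf.differentiable (by simp) (x, t)).hasFDerivAt
  exact h.comp_hasDerivAt (f := fun s : ℝ => (x, s)) t
    ((hasDerivAt_const t x).prodMk (hasDerivAt_id t))

lemma dx_eq_fderiv (x t : ℝ) :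
    dx f x t = fderiv ℝ (fun p : ℝ × ℝ => f p.1 p.2) (x, t) (1, 0) :=
  (hasDerivAt_fderiv_space hf x t).deriv

lemma dt_eq_fderiv (x t : ℝ) :
    dt f x t = fderiv ℝ (fun p : ℝ × ℝ => f p.1 p.2) (x, t) (0, 1) :=
  (hasDerivAt_fderiv_time hf x t).deriv

lemma hasDerivAt_dx (x t : ℝ) : HasDerivAt (fun y => f y t) (dx f x t) x := by
  rw [dx_eq_fderiv hf]
  exact hasDerivAt_fderiv_space hf x t

lemma hasDerivAt_dt (x t : ℝ) : HasDerivAt (fun s => f x s) (dt f x t) t := by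
  rw [dt_eq_fderiv hf]
  exact hasDerivAt_fderiv_time hf x t

lemma contDiff_dx : ContDiff ℝ ∞ (fun p : ℝ × ℝ => dx f p.1 p.2) := by
  simp only [dx_eq_fderiv hf]
  exact (hf.fderiv_right (m := ∞) (by simp)).clm_apply contDiff_const

lemma contDiff_dt : ContDiff ℝ ∞ (fun p : ℝ × ℝ => dt f p.1 p.2) := by
  simp only [dt_eq_fderiv hf]
  exact (hf.fderiv_right (m := ∞) (by simp)).clm_apply contDiff_const

lemma dt_dx_comm (x t : ℝ) : dt (dx f) x t = dx (dt f) x t := by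
  have hd : DifferentiableAt ℝ (fderiv ℝ (fun p : ℝ × ℝ => f p.1 p.2)) (x, t) :=
    ((hf.fderiv_right (m := ∞) (by simp)).differentiable (by simp)) _
  have h : ∀ v w : ℝ × ℝ, fderiv ℝ (fun p : ℝ × ℝ =>
      fderiv ℝ (fun p : ℝ × ℝ => f p.1 p.2) p v) (x, t) w
        = fderiv ℝ (fderiv ℝ (fun p : ℝ × ℝ => f p.1 p.2)) (x, t) w v := by
    intro v w
    rw [fderiv_clm_apply hd (differentiableAt_const v)]
    simp
  rw [dt_eq_fderiv (contDiff_dx hf), dx_eq_fderiv (contDiff_dt hf)]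
  simp only [dx_eq_fderiv hf, dt_eq_fderiv hf]
  rw [h, h]
  exact (hf.contDiffAt (x := (x, t))).isSymmSndFDerivAt
    (by simpa using WithTop.coe_le_coe.2 (le_top (a := (2 : ℕ∞)))) _ _

end partial_deriv

/-- The higher-order Kaup-Newell equation with all derivatives carried out. -/
def EquationAt (q : ℝ → ℝ → ℂ) (x t : ℝ) : Prop :=
  dt q x t = -(1 / 2) * dx (dx (dx q)) x t
    - (3 * Complex.I / 2) * ((dx q x t * conj (q x t) + q x t * conj (dx q x t)) * dx q x t
      + q x t * conj (q x t) * dx (dx q) x t)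
    + (3 / 4) * (3 * q x t ^ 2 * dx q x t * conj (q x t) ^ 2
      + 2 * q x t ^ 3 * conj (q x t) * conj (dx q x t))

lemma isSolution_of_equationAt {q : ℝ → ℝ → ℂ} (hq : ContDiff ℝ ∞ (fun p : ℝ × ℝ => q p.1 p.2))
    (h : ∀ x t, EquationAt q x t) : IsSolution q := by
  refine ⟨hq, fun x t => ?_⟩
  have h0 := hasDerivAt_dx hq x t
  have h1 := hasDerivAt_dx (contDiff_dx hq) x t
  have hn : ∀ y s, ((‖q y s‖ : ℂ)) ^ 2 = q y s * conj (q y s) := fun y s =>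
    (Complex.mul_conj' _).symm
  have hn4 : ∀ y s, ((‖q y s‖ : ℂ)) ^ 4 = q y s ^ 2 * conj (q y s) ^ 2 := fun y s => by
    rw [← mul_pow, ← hn]
    ring
  have e1 : dx (fun y s => (‖q y s‖ : ℂ) ^ 2 * dx q y s) x t
      = (dx q x t * conj (q x t) + q x t * conj (dx q x t)) * dx q x t
        + q x t * conj (q x t) * dx (dx q) x t := by
    simp only [hn]
    exact ((h0.mul h0.star).mul h1).deriv
  have e2 : dx (fun y s => (‖q y s‖ : ℂ) ^ 4 * q y s) x t
      = 3 * q x t ^ 2 * dx q x t * conj (q x t) ^ 2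
        + 2 * q x t ^ 3 * conj (q x t) * conj (dx q x t) := by
    simp only [hn4]
    refine (((h0.pow 2).mul (h0.star.pow 2)).mul h0).deriv.trans ?_
    simp
    ring
  rw [e1, e2]
  exact h x t

lemma laxN_apply (q : ℝ → ℝ → ℂ) (z : ℂ) (x t : ℝ) : laxN q z x t
    = !![-2 * Complex.I * z ^ 6 + Complex.I * z ^ 4 * (q x t * conj (q x t))
          + z ^ 2 / 2 * (q x t * conj (dx q x t) - dx q x t * conj (q x t))
          - 3 / 4 * Complex.I * z ^ 2 * (q x t * conj (q x t)) ^ 2,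
        2 * z ^ 5 * q x t + Complex.I * z ^ 3 * dx q x t - z ^ 3 * (q x t ^ 2 * conj (q x t))
          - z / 2 * dx (dx q) x t
          - 3 * Complex.I / 2 * z * (q x t * conj (q x t) * dx q x t)
          + 3 / 4 * z * (q x t ^ 3 * conj (q x t) ^ 2);
        -2 * z ^ 5 * conj (q x t) + Complex.I * z ^ 3 * conj (dx q x t)
          + z ^ 3 * (q x t * conj (q x t) ^ 2) + z / 2 * conj (dx (dx q) x t)
          - 3 * Complex.I / 2 * z * (q x t * conj (q x t) * conj (dx q x t))
          - 3 / 4 * z * (q x t ^ 2 * conj (q x t) ^ 3),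
        2 * Complex.I * z ^ 6 - Complex.I * z ^ 4 * (q x t * conj (q x t))
          - z ^ 2 / 2 * (q x t * conj (dx q x t) - dx q x t * conj (q x t))
          + 3 / 4 * Complex.I * z ^ 2 * (q x t * conj (q x t)) ^ 2] := by
  simp only [laxN]
  ext a b
  fin_cases a <;> fin_cases b <;> simp [potentialMatrix, sigma3, pow_succ] <;> ring

lemma laxM_apply (q : ℝ → ℝ → ℂ) (z : ℂ) (x t : ℝ) : laxM q z x t
    = !![-Complex.I * z ^ 2, z * q x t; -(z * conj (q x t)), Complex.I * z ^ 2] := by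
  ext a b
  fin_cases a <;> fin_cases b <;> simp [laxM, potentialMatrix, sigma3]

/-- All powers of z except the first cancel identically in the off-diagonal entries, where z
multiplies the equation and its conjugate; the diagonal entries vanish without using the equation.
-/
lemma isLaxCompatible_of_equationAt {q : ℝ → ℝ → ℂ}
    (hq : ContDiff ℝ ∞ (fun p : ℝ × ℝ => q p.1 p.2)) (h : ∀ x t, EquationAt q x t) :
    IsLaxCompatible q := by
  intro z x t a b
  have h0 := hasDerivAt_dx hq x t
  have h1 := hasDerivAt_dx (contDiff_dx hq) x t
  have h2 := hasDerivAt_dx (contDiff_dx (contDiff_dx hq)) x t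
  have ht := hasDerivAt_dt hq x t
  have hI : Complex.I * Complex.I = -1 := Complex.I_mul_I
  have e := h x t
  rw [EquationAt] at e
  have ec := congrArg conj e
  simp only [map_add, map_sub, map_mul, map_neg, map_pow, Complex.conj_conj, Complex.conj_I,
    map_div₀, map_one, map_ofNat] at ec
  have m00 : dt (fun y s => laxM q z y s 0 0) x t = 0 := by
    simp only [laxM_apply]
    exact (hasDerivAt_const t _).deriv
  have m01 : dt (fun y s => laxM q z y s 0 1) x t = z * dt q x t := by
    simp only [laxM_apply]
    exact (ht.const_mul z).deriv
  have m10 : dt (fun y s => laxM q z y s 1 0) x t = -(z * conj (dt q x t)) := by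
    simp only [laxM_apply]
    exact (ht.star.const_mul z).neg.deriv
  have m11 : dt (fun y s => laxM q z y s 1 1) x t = 0 := by
    simp only [laxM_apply]
    exact (hasDerivAt_const t _).deriv
  have n00 := ((((h0.mul h0.star).const_mul (Complex.I * z ^ 4)).const_add
    (-2 * Complex.I * z ^ 6)).add (((h0.mul h1.star).sub (h1.mul h0.star)).const_mul
      (z ^ 2 / 2))).sub (((h0.mul h0.star).pow 2).const_mul (3 / 4 * Complex.I * z ^ 2))
  have n01 := (((((h0.const_mul (2 * z ^ 5)).add (h1.const_mul (Complex.I * z ^ 3))).sub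
    (((h0.pow 2).mul h0.star).const_mul (z ^ 3))).sub (h2.const_mul (z / 2))).sub
      (((h0.mul h0.star).mul h1).const_mul (3 * Complex.I / 2 * z))).add
        (((h0.pow 3).mul (h0.star.pow 2)).const_mul (3 / 4 * z))
  have n10 := (((((h0.star.const_mul (-2 * z ^ 5)).add (h1.star.const_mul (Complex.I * z ^ 3))).add
    ((h0.mul (h0.star.pow 2)).const_mul (z ^ 3))).add (h2.star.const_mul (z / 2))).sub
      (((h0.mul h0.star).mul h1.star).const_mul (3 * Complex.I / 2 * z))).sub
        (((h0.pow 2).mul (h0.star.pow 3)).const_mul (3 / 4 * z))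
  have n11 := ((((h0.mul h0.star).const_mul (Complex.I * z ^ 4)).const_sub
    (2 * Complex.I * z ^ 6)).sub (((h0.mul h1.star).sub (h1.mul h0.star)).const_mul
      (z ^ 2 / 2))).add (((h0.mul h0.star).pow 2).const_mul (3 / 4 * Complex.I * z ^ 2))
  have k00 : dx (fun y s => laxN q z y s 0 0) x t = _ :=
    (n00.congr_of_eventuallyEq (f₁ := fun y => laxN q z y t 0 0)
      (Eventually.of_forall fun y => congrFun (congrFun (laxN_apply q z y t) 0) 0)).deriv
  have k01 : dx (fun y s => laxN q z y s 0 1) x t = _ :=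
    (n01.congr_of_eventuallyEq (f₁ := fun y => laxN q z y t 0 1)
      (Eventually.of_forall fun y => congrFun (congrFun (laxN_apply q z y t) 0) 1)).deriv
  have k10 : dx (fun y s => laxN q z y s 1 0) x t = _ :=
    (n10.congr_of_eventuallyEq (f₁ := fun y => laxN q z y t 1 0)
      (Eventually.of_forall fun y => congrFun (congrFun (laxN_apply q z y t) 1) 0)).deriv
  have k11 : dx (fun y s => laxN q z y s 1 1) x t = _ :=
    (n11.congr_of_eventuallyEq (f₁ := fun y => laxN q z y t 1 1)
      (Eventually.of_forall fun y => congrFun (congrFun (laxN_apply q z y t) 1) 1)).deriv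
  clear n00 n01 n10 n11 h0 h1 h2 ht h
  fin_cases a <;> fin_cases b
  · refine (congrArg₂ (fun u v => u - v + _) m00 k00).trans ?_
    simp [laxM_apply, laxN_apply]
    ring
  · refine (congrArg₂ (fun u v => u - v + _) m01 k01).trans ?_
    simp [laxM_apply, laxN_apply]
    -- The multiple of I² = −1 accounts for the products of i in the commutator at orders z³ and z⁵.
    linear_combination z * e + (3 * z ^ 3 * dx q x t * q x t * conj (q x t)
      - 2 * z ^ 5 * dx q x t) * hI
  · refine (congrArg₂ (fun u v => u - v + _) m10 k10).trans ?_
    simp [laxM_apply, laxN_apply]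
    linear_combination -z * ec + (2 * z ^ 5 * conj (dx q x t)
      - 3 * z ^ 3 * conj (dx q x t) * conj (q x t) * q x t) * hI
  · refine (congrArg₂ (fun u v => u - v + _) m11 k11).trans ?_
    simp [laxM_apply, laxN_apply]
    ring

end KaupNewell
end

/-! ### The evolution equation for the soliton -/

noncomputable section

namespace KaupNewell

open Polynomial

namespace SolitonData

variable {D : SolitonData}

section main

variable (hζ : ∀ i, D.zeta i ∈ C13) (hsq : ∀ i j, i ≠ j → D.zeta i ^ 2 ≠ D.zeta j ^ 2)
  (hanalytic : ∀ i c, AnalyticAt ℂ (fun z => D.v0 i z c) (D.zeta i))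
  (hne : ∀ i, D.v0 i (D.zeta i) ≠ 0)

include hζ hsq hanalytic hne

lemma contDiff_soliton : ContDiff ℝ ∞ (fun p : ℝ × ℝ => D.soliton p.1 p.2) :=
  contDiff_dx (contDiff_quotient hζ hsq hanalytic hne)

/-- The time derivative of the quotient in terms of the potential. -/
lemma dt_quotient (x t : ℝ) : dt D.quotient x t = -(1 / 2) * dx (dx D.soliton) x t
    - (3 * Complex.I / 2) * (D.soliton x t * conj (D.soliton x t) * dx D.soliton x t)
    + (3 / 4) * (D.soliton x t ^ 3 * conj (D.soliton x t) ^ 2) := by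
  set K := D.fullDen with hK
  set κ := D.phase with hκ
  have hκ1 : κ * conj κ = 1 := phase_mul_conj hζ
  -- With K as denominator, A, B and E are the squared eigenfunctions a, b and c; the phases κ^* and
  -- κ remove the constant κ from their flow.
  let p : ℝ → Fin 2 → ℂ[X] := fun s => D.nrow s t
  let A : ℝ → ℂ[X] := fun s => p s 0 * conjPoly (p s 0) - p s 1 * conjPoly (p s 1)
  let B : ℝ → ℂ[X] := fun s => C (-2 * conj κ) * (p s 0 * p s 1)
  let E : ℝ → ℂ[X] := fun s => C (-2 * κ) * (conjPoly (p s 0) * conjPoly (p s 1))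
  have hKd : K.natDegree = D.poleDen.natDegree + D.poleDen.natDegree := natDegree_fullDen D
  have hd : ∀ s c, (p s c).natDegree ≤ D.poleDen.natDegree := fun s c => natDegree_nrow_le s t c
  have hdc : ∀ s c, (conjPoly (p s c)).natDegree ≤ D.poleDen.natDegree := fun s c => by
    rw [natDegree_conjPoly]
    exact hd s c
  have hA : ∀ s, (A s).natDegree ≤ K.natDegree := fun s => by
    rw [hKd]
    exact (natDegree_sub_le _ _).trans (max_le
      (natDegree_mul_le.trans (add_le_add (hd s 0) (hdc s 0)))
      (natDegree_mul_le.trans (add_le_add (hd s 1) (hdc s 1))))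
  have hB : ∀ s, (B s).natDegree ≤ K.natDegree := fun s => by
    rw [hKd]
    exact (natDegree_C_mul_le _ _).trans
      (natDegree_mul_le.trans (add_le_add (hd s 0) (hd s 1)))
  have hE : ∀ s, (E s).natDegree ≤ K.natDegree := fun s => by
    rw [hKd]
    exact (natDegree_C_mul_le _ _).trans
      (natDegree_mul_le.trans (add_le_add (hdc s 0) (hdc s 1)))
  have hinner : ∀ s, p s 0 * conjPoly (p s 0) + p s 1 * conjPoly (p s 1) = K := fun s =>
    nrow_inner hζ hsq hanalytic hne s t
  have hκC : C κ * C (conj κ) = (1 : ℂ[X]) := by rw [← C_mul, hκ1, C_1]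
  have hq := hasDerivAt_dx (contDiff_soliton hζ hsq hanalytic hne)
  have hq1 := hasDerivAt_dx (contDiff_dx (contDiff_soliton hζ hsq hanalytic hne))
  have hflow := fun s => hasPolyDeriv_nrow_space hζ hsq hanalytic hne s t
  obtain ⟨T, L, hT, hL, hL1, hTL⟩ := exists_nrow_time hζ hsq hanalytic hne x t
  have h5 := coeff_expandInfty_of_time D.monic_fullDen (hB x) hT hL hTL
  -- The general recursion is specialized to r = −q^*.
  have key := coeff_five_eq (a := fun s => expandInfty K (A s)) (b := fun s => expandInfty K (B s))
    (c := fun s => expandInfty K (E s)) (q := fun s => D.soliton s t)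
    (r := fun s => -conj (D.soliton s t)) (q₁ := fun s => dx D.soliton s t)
    (r₁ := fun s => -conj (dx D.soliton s t)) (q₂ := dx (dx D.soliton) x t) (τ := x)
    (fun s => ?_) (fun s => hq s t) (fun s => (hq s t).star.neg) (hq1 x t) (fun s => ?_)
    (fun s => ?_) (fun s => ?_)
  · rw [← hL1, ← h5, key]
    ring
  · rw [coeff_zero_expandInfty D.monic_fullDen, coeff_sub, natDegree_fullDen,
      coeff_mul_add_eq_of_natDegree_le (hd s 0) (hdc s 0),
      coeff_mul_add_eq_of_natDegree_le (hd s 1) (hdc s 1), coeff_conjPoly,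
      coeff_nrow_zero_mul_conj hζ hsq hanalytic hne, coeff_nrow_one]
    simp
  -- This is (|p₀|² − |p₁|²)² + 4|p₀|²|p₁|² = (|p₀|² + |p₁|²)², with p^* in place of conjugates,
  -- together with κκ^* = 1.
  · refine expandInfty_quadratic D.monic_fullDen (hA s) (hB s) (hE s) ?_
    simp only [A, B, E, ← hK, ← hinner s, C_mul, C_neg, map_ofNat]
    linear_combination 4 * p s 0 * p s 1 * conjPoly (p s 0) * conjPoly (p s 1) * hκC
  -- In the derivative of p₀p₁ the x-flow produces p₀p₀^* − p₁p₁^*, which closes the system on a.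
  · have hBd := ((hflow s).1.mul (hflow s).2).const_mul (C (-2 * conj κ))
    refine ⟨_, hBd.expandInfty K, expandInfty_linear (hA s) (hB s) (hBd.natDegree_le hB) ?_⟩
    simp only [A, B, ← hκ, C_mul, C_neg, map_ofNat]
    linear_combination (2 * C (D.soliton s t) * X *
      (p s 1 * conjPoly (p s 1) - p s 0 * conjPoly (p s 0))) * hκC
  · have hEd := ((hflow s).1.conjugate.mul (hflow s).2.conjugate).const_mul (C (-2 * κ))
    refine ⟨_, hEd.expandInfty K, expandInfty_linear (hA s) (hE s) (hEd.natDegree_le hE) ?_⟩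
    simp only [A, E, ← hκ, map_ofNat, map_add, map_mul, map_neg, map_pow,
      conjPoly_C, conjPoly_X, conjPoly_conjPoly, Complex.conj_I]
    linear_combination (2 * C (conj (D.soliton s t)) * X *
      (p s 1 * conjPoly (p s 1) - p s 0 * conjPoly (p s 0))) * hκC

/-- Since q = u_x, the equation for q is the x-derivative of the one for u_t, after exchanging the
two partial derivatives of the smooth function u. -/
lemma equationAt_soliton (x t : ℝ) : EquationAt D.soliton x t := by
  have hq := contDiff_soliton hζ hsq hanalytic hne
  have h0 := hasDerivAt_dx hq x t
  have h1 := hasDerivAt_dx (contDiff_dx hq) x t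
  have h2 := hasDerivAt_dx (contDiff_dx (contDiff_dx hq)) x t
  have hc : dt D.soliton x t = dx (dt D.quotient) x t :=
    dt_dx_comm (contDiff_quotient hζ hsq hanalytic hne) x t
  have hf : dt D.quotient = fun x t => -(1 / 2) * dx (dx D.soliton) x t
    - (3 * Complex.I / 2) * (D.soliton x t * conj (D.soliton x t) * dx D.soliton x t)
    + (3 / 4) * (D.soliton x t ^ 3 * conj (D.soliton x t) ^ 2) := by
    funext x t
    exact dt_quotient hζ hsq hanalytic hne x t
  have h := ((h2.const_mul (-(1 / 2))).sub (((h0.mul h0.star).mul h1).const_mul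
    (3 * Complex.I / 2))).add (((h0.pow 3).mul (h0.star.pow 2)).const_mul (3 / 4))
  rw [EquationAt, hc, hf]
  refine h.deriv.trans ?_
  simp
  ring

end main

end SolitonData
end KaupNewell
end

theorem mainTheorem3 (D : KaupNewell.SolitonData)
    (hzeta : ∀ i, D.zeta i ∈ KaupNewell.C13)
    (hdist : ∀ i j, i ≠ j → D.zeta i ≠ D.zeta j ∧ D.zeta i ≠ -D.zeta j)
    (hanalytic : ∀ i c, AnalyticAt ℂ (fun z => D.v0 i z c) (D.zeta i))
    (hne : ∀ i, D.v0 i (D.zeta i) ≠ 0) :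
    -- the denominators in the formula do not vanish, and the quotient is smooth
    (∀ x t : ℝ, (D.matM x t).det ≠ 0 ∧ (D.matM x t).det + 2 * (D.matG x t).det ≠ 0) ∧
    ContDiff ℝ ∞ (fun p : ℝ × ℝ => D.quotient p.1 p.2) ∧
    -- the limits that define the vectors of the dressing factors exist and are nonzero
    (∀ (x t : ℝ) (i : Fin D.r), ∀ j < D.mult i, ∃ w : Fin 2 → ℂ, w ≠ 0 ∧
      Tendsto (KaupNewell.scaledVector (D.zeta i) (D.ket x t i)
        (KaupNewell.dressSteps (D.zeta i) (D.ket x t i) (D.dressStage x t i) j) j)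
        (𝓝[≠] 0) (𝓝 w)) ∧
    -- the normalized dressing matrix solves the reflectionless Riemann-Hilbert problem
    (∀ x t : ℝ, D.SolvesRHP x t
      (fun z => (D.dressingMatrix x t 0)⁻¹ * D.dressingMatrix x t z)) ∧
    -- the first Taylor coefficient at zero of every solution is given by the quotient
    (∀ (x t : ℝ) (P : ℂ → Matrix (Fin 2) (Fin 2) ℂ), D.SolvesRHP x t P →
      ∀ a b, HasDerivAt (fun z => P z a b)
        (KaupNewell.potentialMatrix D.quotient x t a b) 0) ∧
    -- its derivative in `x` solves the higher-order Kaup-Newell equation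
    KaupNewell.IsSolution D.soliton ∧
    KaupNewell.IsLaxCompatible D.soliton := by
  have hsq : ∀ i j, i ≠ j → D.zeta i ^ 2 ≠ D.zeta j ^ 2 := fun i j hij h =>
    (sq_eq_sq_iff_eq_or_eq_neg.1 h).elim (hdist i j hij).1 (hdist i j hij).2
  refine ⟨fun x t => ⟨?_, ?_⟩, ?_, fun x t i j _ => ?_, fun x t => ?_, fun x t P hP a b => ?_,
    ?_, ?_⟩
  · exact KaupNewell.SolitonData.det_matM_ne_zero hzeta hsq hanalytic hne x t
  · exact KaupNewell.SolitonData.det_add_ne_zero hzeta hsq hanalytic hne x t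
  · exact KaupNewell.SolitonData.contDiff_quotient hzeta hsq hanalytic hne
  · exact KaupNewell.SolitonData.exists_tendsto_scaledVector hzeta hsq hanalytic hne x t i j
  · exact KaupNewell.SolitonData.solvesRHP_dressingMatrix hzeta hsq hanalytic hne x t
  · exact hP.hasDerivAt_zero hzeta hsq hanalytic hne a b
  · exact KaupNewell.isSolution_of_equationAt
      (KaupNewell.SolitonData.contDiff_soliton hzeta hsq hanalytic hne)
      (KaupNewell.SolitonData.equationAt_soliton hzeta hsq hanalytic hne)
  · exact KaupNewell.isLaxCompatible_of_equationAt
      (KaupNewell.SolitonData.contDiff_soliton hzeta hsq hanalytic hne)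
      (KaupNewell.SolitonData.equationAt_soliton hzeta hsq hanalytic hne)
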